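/- Let $G,\kappa>0$ and let $M=\{(\tau,\rho,y,z):\rho>0\}$ be four-dimensional Rindler space with background metric $\bar g=-\kappa^2\rho^2d\tau^2+d\rho^2+dy^2+dz^2$. **Conventions.** For a smooth function $h$ on $M$, $h=\mathcal O(\rho^k)$ is understood as $\rho\to0$, locally uniformly in $(\tau,y,z)$, and as differentiable term by term: each $\partial_\rho$ lowers the order by one, while $\partial_\tau,\partial_y,\partial_z$ do not. For smooth families of functions the estimates are also locally uniform in the parameter, and derivatives in the parameter do not lower the order. Quotients such as $(e^{F_1}-1)/F_1$ and $(1-e^{-F_1})/F_1$ have the value $1$ where $F_1=0$. Brackets $A^{[\mu\nu]}=\tfrac12(A^{\mu\nu}-A^{\nu\mu})$. For fixed $\tau$ and $\rho$, $(d^2x)_{\mu\nu}A^{\mu\nu}$ denotes $A^{[\tau\rho]}\,dy\,dz$, and $\int_{\partial\Sigma}$ denotes the limit $\rho\to0$ of the integral over $(y,z)\in\mathbb R^2$ at fixed $\tau$. For a metric $g$, a symmetric tensor $\delta g$ and a vector field $\xi$ let $$Q^{\mu\nu}[\xi]=-\frac{\sqrt{-g}}{8\pi G}\nabla^{[\mu}\xi^{\nu]},\qquad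 \Theta^\mu(g,\delta g)=\frac{\sqrt{-g}}{16\pi G}\left(g^{\mu\alpha}\nabla^\beta\delta g_{\alpha\beta}-g^{\alpha\beta}\nabla^\mu\delta g_{\alpha\beta}\right),$$ $$S^{\mu\nu}(g,\delta g,\pounds_\xi g)=\delta Q^{\mu\nu}[\xi]+2\xi^{[\mu}\Theta^{\nu]}(g,\delta g)=\frac{\sqrt{-g}}{8\pi G}\Big(-\tfrac12\delta g^\alpha{}_\alpha\nabla^{[\mu}\xi^{\nu]}+\delta g^{\alpha[\mu}\nabla_\alpha\xi^{\nu]}-\nabla^{[\mu}\delta g^{\nu]\alpha}\xi_\alpha+\xi^{[\mu}\nabla_\alpha\delta g^{\nu]\alpha}-\xi^{[\mu}\nabla^{\nu]}\delta g^\alpha{}_\alpha\Big).$$ **The algebra and the metrics.** Let $\mathcal A$ be the set of smooth vector fields on $M$, vanishing outside a bounded region of $(\rho,y,z)$, whose components $(\tau,\rho,y,z)$ are $$\left(\tau T_1(y,z)+\mathcal O(\rho^2),\ \tau\rho\,T_2(y,z)+\mathcal O(\rho^2),\ \mathcal O(\rho^2),\ \mathcal O(\rho^2)\right)$$ for some smooth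 $T_1,T_2$. A diffeomorphism of $M$ is generated by $\mathcal A$ if it is a finite product of time-one maps of flows of complete members of $\mathcal A$. A smooth path from the identity to such a $\chi$ is a smooth family $(\chi_s)$ with $\chi_0=\mathrm{id}$, $\chi_1=\chi$, $\chi_s$ generated by $\mathcal A$ for $0\le s\le1$, and $\partial_s\chi_s=\xi_s\circ\chi_s$ for a smooth family $\xi_s\in\mathcal A$ (with the estimates and the supports locally uniform in $s$, and $T_1,T_2$ smooth in $s$ too). **Theorem.** Let $\chi$ be a diffeomorphism generated by $\mathcal A$, and let $g=\chi^*\bar g$. 1. There are smooth functions $F_1,F_2$ of $(y,z)$ with $$\chi(\tau,\rho,y,z)=\left(\tau e^{F_1},\ \rho\exp\!\Big(\frac{F_2}{F_1}\,\tau\,(e^{F_1}-1)\Big),\ y,\ z\right)+\mathcal O(\rho^2),$$ so that $g$ is one of the metrics $g^{(F_1,F_2)}$. 2. The integrability condition holds at the horizon: for all $\xi,\eta,\zeta\in\mathcal A$ the integrand of $$\int_{\partial\Sigma}(d^2x)_{\mu\nu}\,\xi^{[\mu}\partial_\alpha S^{\nu]\alpha}(g,\pounds_\eta g,\pounds_\zeta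 g)$$ is $\mathcal O(\rho)$ as $\rho\to0$ (a bound uniform in $(y,z)$ and locally uniform in $\tau$), it is integrable in $(y,z)$, and the integral is $0$. 3. There is a smooth path from the identity to $\chi$. For every such path $(\chi_s)$, with $g_s=\chi_s^*\bar g$, for all $F_1,F_2$ as in 1, and on every slice of constant $\tau$, the charges $$H[V]=\int_0^1ds\int_{\partial\Sigma}(d^2x)_{\mu\nu}\left(\partial_sQ^{\mu\nu}[V](g_s)+2V^{[\mu}\Theta^{\nu]}(g_s,\partial_sg_s)\right),$$ normalized to vanish on the background $\bar g$, exist (all integrals and limits converge) and are $$H[V_1]=\frac1{16\pi G\kappa}\int T_1\,\frac{F_2}{F_1}\left(1-e^{-F_1}\right)dy\,dz,\qquad H[V_2]=\frac1{16\pi G\kappa}\int T_2\left(e^{-F_1}-1\right)dy\,dz$$ for all members of $\mathcal A$ of the form $V_1=(\tau T_1+\mathcal O(\rho^2),\mathcal O(\rho^2),\mathcal O(\rho^2),\mathcal O(\rho^2))$ and $V_2=(\mathcal O(\rho^2),\tau\rho T_2+\mathcal O(\rho^2),\mathcal O(\rho^2),\mathcal O(\rho^2))$. -/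

import Mathlib

open MeasureTheory Filter Set
open scoped Topology ContDiff

noncomputable section

namespace Rindler

/-! ## Rindler coordinates -/

/-- Coordinates `(x 0, x 1, x 2, x 3) = (τ, ρ, y, z)`. -/
abbrev Pt := Fin 4 → ℝ

/-- Four-dimensional Rindler space: `0 < ρ`. The horizon is `ρ = 0`. -/
def M : Set Pt := {x | 0 < x 1}

/-- Vector fields (upper index), through their coordinate components. -/
abbrev VField := Pt → Fin 4 → ℝ

/-- Covariant two-tensor fields `g_{μν}`, through their coordinate components. -/
abbrev Tensor2 := Pt → Matrix (Fin 4) (Fin 4) ℝ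

/-- The coordinate derivative `∂_μ h`. -/
def pd (μ : Fin 4) (h : Pt → ℝ) : Pt → ℝ := fun x => fderiv ℝ h x (Pi.single μ 1)

/-- Iterated coordinate derivative `∂_{μ₁} ⋯ ∂_{μₙ} h`. -/
def pds : List (Fin 4) → (Pt → ℝ) → Pt → ℝ
  | [], h => h
  | μ :: l, h => pd μ (pds l h)

/-- The background metric `-κ²ρ² dτ² + dρ² + dy² + dz²`. -/
def rindlerMetric (κ : ℝ) : Tensor2 := fun x =>
  Matrix.diagonal ![-(κ ^ 2 * x 1 ^ 2), 1, 1, 1]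

/-! ## Tensor calculus in coordinates -/

/-- `(χ^* g)_{μν}(x) = ∂_μ χ^α ∂_ν χ^β g_{αβ}(χ x)`. -/
def pullback (χ : Pt → Pt) (g : Tensor2) : Tensor2 := fun x =>
  Matrix.of fun μ ν => ∑ α, ∑ β,
    pd μ (fun y => χ y α) x * pd ν (fun y => χ y β) x * g (χ x) α β

/-- The inverse metric `g^{μν}`. -/
def ginv (g : Tensor2) : Tensor2 := fun x => (g x)⁻¹

/-- `√(-det g)`. -/
def sqrtNegDet (g : Tensor2) (x : Pt) : ℝ := Real.sqrt (-(g x).det)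

/-- The Christoffel symbol `Γ^a_{bc}` of the Levi-Civita connection of `g`. -/
def christoffel (g : Tensor2) (a b c : Fin 4) (x : Pt) : ℝ :=
  1 / 2 * ∑ d, ginv g x a d *
    (pd b (fun y => g y d c) x + pd c (fun y => g y d b) x - pd d (fun y => g y b c) x)

/-- `∇_a ξ^b`. -/
def covDerivVec (g : Tensor2) (ξ : VField) (a b : Fin 4) (x : Pt) : ℝ :=
  pd a (fun y => ξ y b) x + ∑ c, christoffel g b a c x * ξ x c

/-- `∇^a ξ^b`. -/
def covDerivVecUp (g : Tensor2) (ξ : VField) (a b : Fin 4) (x : Pt) : ℝ :=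
  ∑ c, ginv g x a c * covDerivVec g ξ c b x

/-- `∇_a h_{bc}`. -/
def covDerivTensor (g h : Tensor2) (a b c : Fin 4) (x : Pt) : ℝ :=
  pd a (fun y => h y b c) x - ∑ d, christoffel g d a b x * h x d c
    - ∑ d, christoffel g d a c x * h x b d

/-- The trace `h^α_α`. -/
def trace (g h : Tensor2) (x : Pt) : ℝ := ∑ a, ∑ b, ginv g x a b * h x a b

/-- `h^{μν}`. -/
def raise (g h : Tensor2) (μ ν : Fin 4) (x : Pt) : ℝ :=
  ∑ a, ∑ b, ginv g x μ a * ginv g x ν b * h x a b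

/-- `∇^μ h^α_α`, which equals `g^{αβ} ∇^μ h_{αβ}`. -/
def gradTrace (g h : Tensor2) (μ : Fin 4) (x : Pt) : ℝ :=
  ∑ c, ∑ a, ∑ b, ginv g x μ c * ginv g x a b * covDerivTensor g h c a b x

/-- `∇_α h^{να}`, which equals `g^{να} ∇^β h_{αβ}` for symmetric `h`. -/
def divergence (g h : Tensor2) (ν : Fin 4) (x : Pt) : ℝ :=
  ∑ a, ∑ b, ∑ c, ginv g x ν a * ginv g x b c * covDerivTensor g h c a b x

/-- `(∇^μ h^{να}) ξ_α = (∇^μ h^ν_β) ξ^β`. -/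
def gradContract (g h : Tensor2) (ξ : VField) (μ ν : Fin 4) (x : Pt) : ℝ :=
  ∑ c, ∑ a, ∑ b, ginv g x μ c * ginv g x ν a * covDerivTensor g h c a b x * ξ x b

/-- The Lie derivative `(£_ξ h)_{ab}`. -/
def lieDeriv (ξ : VField) (h : Tensor2) : Tensor2 := fun x =>
  Matrix.of fun a b => ∑ c, (ξ x c * pd c (fun y => h y a b) x
    + h x c b * pd a (fun y => ξ y c) x + h x a c * pd b (fun y => ξ y c) x)

/-- `A^{[μν]} = (A^{μν} - A^{νμ}) / 2`. -/
def antisymm (A : Fin 4 → Fin 4 → ℝ) (μ ν : Fin 4) : ℝ := (A μ ν - A ν μ) / 2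

/-! ## Covariant phase space quantities of Einstein gravity, with Newton constant `G` -/

/-- Noether-Wald charge density `Q^{μν}[ξ] = -(√-g / 8πG) ∇^{[μ} ξ^{ν]}`. -/
def noetherQ (G : ℝ) (g : Tensor2) (ξ : VField) (μ ν : Fin 4) (x : Pt) : ℝ :=
  -(sqrtNegDet g x / (8 * Real.pi * G)) * antisymm (fun a b => covDerivVecUp g ξ a b x) μ ν

/-- The presymplectic potential
`Θ^μ(g, δg) = (√-g / 16πG) (g^{μα} ∇^β δg_{αβ} - g^{αβ} ∇^μ δg_{αβ})`. -/
def presymplecticPotential (G : ℝ) (g δg : Tensor2) (μ : Fin 4) (x : Pt) : ℝ :=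
  sqrtNegDet g x / (16 * Real.pi * G) * (divergence g δg μ x - gradTrace g δg μ x)

/-- The surface density `S^{μν}(g, δg, £_ξ g)`, which is `δQ^{μν}[ξ] + 2 ξ^{[μ} Θ^{ν]}(g, δg)`:
`(√-g / 8πG) (-½ δg^α_α ∇^{[μ} ξ^{ν]} + δg^{α[μ} ∇_α ξ^{ν]} - ∇^{[μ} δg^{ν]α} ξ_α
  + ξ^{[μ} ∇_α δg^{ν]α} - ξ^{[μ} ∇^{ν]} δg^α_α)`. -/
def surfaceS (G : ℝ) (g δg : Tensor2) (ξ : VField) (μ ν : Fin 4) (x : Pt) : ℝ :=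
  sqrtNegDet g x / (8 * Real.pi * G) * antisymm (fun m n =>
    -(1 / 2) * trace g δg x * covDerivVecUp g ξ m n x
      + ∑ a, raise g δg a m x * covDerivVec g ξ a n x
      - gradContract g δg ξ m n x
      + ξ x m * divergence g δg n x
      - ξ x m * gradTrace g δg n x) μ ν

/-- The coefficient of `dy ∧ dz` in `(d²x)_{μν} A^{μν}`, where
`(d²x)_{μν} = (1 / (2! 2!)) ε_{μνρσ} dx^ρ ∧ dx^σ`, restricted to a surface of constant `τ, ρ`. -/
def corner (A : Fin 4 → Fin 4 → ℝ) : ℝ := (A 0 1 - A 1 0) / 2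

/-- The integrand of the integrability condition,
`(d²x)_{μν} ξ^{[μ} ∂_α S^{ν]α}(g, £_η g, £_ζ g)`. -/
def integrabilityIntegrand (G : ℝ) (g : Tensor2) (ξ η ζ : VField) (x : Pt) : ℝ :=
  corner (antisymm fun m n =>
    ξ x m * ∑ a, pd a (surfaceS G g (lieDeriv η g) ζ n a) x)

/-- The integrand of the charge along a one-parameter family of metrics `g s`,
`(d²x)_{μν} (∂_s Q^{μν}[ξ](g s) + 2 ξ^{[μ} Θ^{ν]}(g s, ∂_s g s))`. -/
def chargeIntegrand (G : ℝ) (g : ℝ → Tensor2) (ξ : VField) (s : ℝ) (x : Pt) : ℝ :=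
  corner fun m n =>
    deriv (fun t => noetherQ G (g t) ξ m n x) s
      + 2 * antisymm (fun a b => ξ x a * presymplecticPotential G (g s)
          (fun y => Matrix.of fun i j => deriv (fun t => g t y i j) s) b x) m n

/-! ## The algebra and its diffeomorphisms -/

/-- `h s x = O(ρ^k)` as `ρ → 0`, for a smooth family of functions on `M`, as a term that may be
differentiated: locally uniformly in `(s, τ, y, z)`, each `∂_ρ` costs one power of `ρ`, and
`∂_s, ∂_τ, ∂_y, ∂_z` cost none. -/
def FamilyBigO (k : ℕ) (h : ℝ → Pt → ℝ) : Prop :=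
  ContDiffOn ℝ ∞ (fun p : ℝ × Pt => h p.1 p.2) (univ ×ˢ M) ∧
  ∀ (m : ℕ) (l : List (Fin 4)) (R : ℝ), ∃ C ε : ℝ, 0 < ε ∧
    ∀ (s : ℝ) (x : Pt), x ∈ M → x 1 < ε → |s| ≤ R → |x 0| ≤ R → |x 2| ≤ R → |x 3| ≤ R →
      |iteratedDeriv m (fun t => pds l (h t) x) s| ≤ C * x 1 ^ ((k : ℤ) - (l.count 1 : ℤ))

/-- `h x = O(ρ^k)` as `ρ → 0` for a single function. -/
def BigO (k : ℕ) (h : Pt → ℝ) : Prop := FamilyBigO k fun _ => h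

/-- A smooth family of vector fields
`ξ s = (τ T₁ + O(ρ²), τ ρ T₂ + O(ρ²), O(ρ²), O(ρ²))` with `T₁ s, T₂ s` functions of `(y, z)`,
each supported in a bounded region of space near the horizon. -/
structure IsSuperdilatationFamily (ξ : ℝ → VField) (T₁ T₂ : ℝ → ℝ → ℝ → ℝ) : Prop where
  smooth₁ : ContDiff ℝ ∞ fun p : ℝ × ℝ × ℝ => T₁ p.1 p.2.1 p.2.2
  smooth₂ : ContDiff ℝ ∞ fun p : ℝ × ℝ × ℝ => T₂ p.1 p.2.1 p.2.2
  comp_τ : FamilyBigO 2 fun s x => ξ s x 0 - x 0 * T₁ s (x 2) (x 3)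
  comp_ρ : FamilyBigO 2 fun s x => ξ s x 1 - x 0 * x 1 * T₂ s (x 2) (x 3)
  comp_y : FamilyBigO 2 fun s x => ξ s x 2
  comp_z : FamilyBigO 2 fun s x => ξ s x 3
  support : ∀ S : ℝ, ∃ R : ℝ, ∀ s : ℝ, |s| ≤ S → ∀ x ∈ M, ξ s x ≠ 0 →
    x 1 ≤ R ∧ |x 2| ≤ R ∧ |x 3| ≤ R

/-- `ξ = (τ T₁(y,z) + O(ρ²), τ ρ T₂(y,z) + O(ρ²), O(ρ²), O(ρ²))`. -/
def IsSuperdilatation (ξ : VField) (T₁ T₂ : ℝ → ℝ → ℝ) : Prop :=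
  IsSuperdilatationFamily (fun _ => ξ) (fun _ => T₁) (fun _ => T₂)

/-- The algebra `𝒜` of superdilatations. -/
def superdilatations : Set VField := {ξ | ∃ T₁ T₂ : ℝ → ℝ → ℝ, IsSuperdilatation ξ T₁ T₂}

/-- `X` is the smooth evolution on `M`, starting at the identity and defined for all times, of the
(possibly time-dependent) vector field `ξ`. -/
structure IsEvolution (ξ : ℝ → VField) (X : ℝ → Pt → Pt) : Prop where
  smooth : ContDiffOn ℝ ∞ (fun p : ℝ × Pt => X p.1 p.2) (univ ×ˢ M)
  mapsTo : ∀ s, MapsTo (X s) M M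
  zero : ∀ x ∈ M, X 0 x = x
  hasDerivAt : ∀ x ∈ M, ∀ s, HasDerivAt (fun t => X t x) (ξ s (X s x)) s

/-- The diffeomorphisms generated by `𝒜`: finite products of exponentials (time-one maps of the
flows) of complete members of `𝒜`. -/
inductive Generated : (Pt → Pt) → Prop
  | id : Generated id
  | comp {ξ : VField} {Φ : ℝ → Pt → Pt} {χ : Pt → Pt} :
      ξ ∈ superdilatations → IsEvolution (fun _ => ξ) Φ → Generated χ → Generated (Φ 1 ∘ χ)

/-- `(e^a - 1) / a`, with its limit `1` at `a = 0`. -/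
def expQuot (a : ℝ) : ℝ := if a = 0 then 1 else (Real.exp a - 1) / a

/-- `χ = (τ e^{F₁}, ρ exp((F₂ / F₁) (e^{F₁} - 1) τ), y, z) + O(ρ²)` with `F₁, F₂` functions of
`(y, z)`; then `χ` pulls the Rindler metric back to a metric `g^{(F₁, F₂)}`. -/
structure HasLabels (χ : Pt → Pt) (F₁ F₂ : ℝ → ℝ → ℝ) : Prop where
  smooth₁ : ContDiff ℝ ∞ fun p : ℝ × ℝ => F₁ p.1 p.2
  smooth₂ : ContDiff ℝ ∞ fun p : ℝ × ℝ => F₂ p.1 p.2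
  comp_τ : BigO 2 fun x => χ x 0 - x 0 * Real.exp (F₁ (x 2) (x 3))
  comp_ρ : BigO 2 fun x => χ x 1 -
    x 1 * Real.exp (F₂ (x 2) (x 3) * expQuot (F₁ (x 2) (x 3)) * x 0)
  comp_y : BigO 2 fun x => χ x 2 - x 2
  comp_z : BigO 2 fun x => χ x 3 - x 3

/-- A smooth path from the identity to `χ` among the diffeomorphisms generated by `𝒜`, with
velocity in `𝒜`. The metrics `(X s)^* g` then form a smooth path from `g` to `χ^* g`. -/
def IsPath (X : ℝ → Pt → Pt) (χ : Pt → Pt) : Prop :=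
  (∀ s ∈ Icc (0 : ℝ) 1, Generated (X s)) ∧
  (∃ (ξ : ℝ → VField) (T₁ T₂ : ℝ → ℝ → ℝ → ℝ),
    IsSuperdilatationFamily ξ T₁ T₂ ∧ IsEvolution ξ X) ∧
  EqOn (X 1) χ M

/-- The integrability condition at the horizon holds for `g`, `ξ`, `η`, `ζ`: its integrand is
`O(ρ)` (uniformly in `(y, z)`, locally uniformly in `τ`), so that its integral over the surface
of constant `τ, ρ` tends to `0` as `ρ → 0`. -/
def IntegrableAtHorizon (G : ℝ) (g : Tensor2) (ξ η ζ : VField) : Prop :=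
  (∀ R : ℝ, ∃ C ε : ℝ, 0 < ε ∧ ∀ x ∈ M, x 1 < ε → |x 0| ≤ R →
    |integrabilityIntegrand G g ξ η ζ x| ≤ C * x 1) ∧
  ∀ τ : ℝ,
    (∀ ρ : ℝ, 0 < ρ →
      Integrable fun p : ℝ × ℝ => integrabilityIntegrand G g ξ η ζ ![τ, ρ, p.1, p.2]) ∧
    Tendsto (fun ρ => ∫ p : ℝ × ℝ, integrabilityIntegrand G g ξ η ζ ![τ, ρ, p.1, p.2])
      (𝓝[>] 0) (𝓝 0)

/-- `H` is the charge of `ξ`, normalized to vanish at `g 0`, computed along the path of metrics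
`g s`, `0 ≤ s ≤ 1`, at the horizon end `ρ → 0` of the slice of constant `τ`:
`H = ∫₀¹ ds lim_{ρ → 0} ∫ (d²x)_{μν} (∂_s Q^{μν}[ξ](g s) + 2 ξ^{[μ} Θ^{ν]}(g s, ∂_s g s))`. -/
def IsCharge (G : ℝ) (g : ℝ → Tensor2) (ξ : VField) (τ H : ℝ) : Prop :=
  ∃ L : ℝ → ℝ,
    (∀ s ∈ Icc (0 : ℝ) 1,
      (∀ ρ : ℝ, 0 < ρ →
        Integrable fun p : ℝ × ℝ => chargeIntegrand G g ξ s ![τ, ρ, p.1, p.2]) ∧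
      Tendsto (fun ρ => ∫ p : ℝ × ℝ, chargeIntegrand G g ξ s ![τ, ρ, p.1, p.2])
        (𝓝[>] 0) (𝓝 (L s))) ∧
    IntervalIntegrable L volume 0 1 ∧
    ∫ s in (0 : ℝ)..1, L s = H

end Rindler

end

open Rindler

/-! Every generated diffeomorphism is the end point of a smooth path driven by a time-dependent
velocity in the algebra (`Generated.exists_isPath`), so it suffices to study evolutions `X s`. To
leading order the flow equations decouple: `y, z` stand still up to `O(ρ²)`, `τ` obeys `dτ/ds = τ
T₁`, and `log ρ` obeys `d(log ρ)/ds = τ T₂`. Hence `X s = (τ e^F, ρ e^{Aτ}, y, z) + O(ρ²)` with `F =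
∫ T₁ ds` and `A = ∫ T₂ e^F ds` (`IsEvolution.horizonMap`). At the end point `F₁ = F` and `F₂ (e^{F₁}
- 1) / F₁ = A`, and these are determined by the diffeomorphism alone (`HorizonMap.labels_unique`).

The analytic burden is that the remainders must be controlled together with all their derivatives.
The class `IsO` of functions `O(ρ^k)` with all derivatives is closed under products, composition
with maps tangential to the horizon (`OO.compX`) and solution of linear differential equations in
the parameter (`OO.linear`). Tangency itself comes from a Grönwall estimate in the variables `τ, log
ρ, y, z` (`IsEvolution.omap_zero`), and its derivatives from the variational equation.

With `a = e^F` and `E = e^{Aτ}` the pulled back metric is, to leading order, `ρ²E²(-κ²a² dτ² + (A dτ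
+ dρ/ρ)²)` plus the flat transverse metric. The index `ρ` carries a weight, `+1` when upper and `-1`
when lower. In the tensor contractions that matter at leading order, a transverse summation index
supplies enough additional powers of `ρ` to leave the leading term, so `Lead.sum` reduces these
contractions to algebra in two dimensions, done once and for all in `HData`.

Two explicit results carry the theorem. The leading term of `S^{τρ}` depends on neither `τ` nor `ρ`
(`HData.surf_antisymm`), so both `∂_τ S^{τρ}` and `∂_ρ S^{τρ}` gain one order, which makes the
integrability integrand `O(ρ)`. The leading term of the charge integrand is `∂_s((T₁ A + T₂) e^{-F})
/ (16πGκ)`: the terms linear in `τ` from `∂_s Q` and from `Θ` cancel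
(`HorizonMetric.lead_chargeIntegrand`). Being an exact `s`-derivative, it integrates to a difference
of end point values, whatever the path. Bounded supports justify taking the limit under the integral
(`Lead.tendsto_integral`) and exchanging the order of integration. -/

noncomputable section

namespace Rindler

/-! ## Calculus of families of functions on `M` -/

/-- A family of functions on Rindler space. -/
abbrev Fam := ℝ → Pt → ℝ

lemma isOpen_M : IsOpen M := isOpen_lt continuous_const (continuous_apply 1)

lemma isOpen_dom : IsOpen ((univ : Set ℝ) ×ˢ M) := isOpen_univ.prod isOpen_M

/-- Joint smoothness of a family on `M`. -/
def Smooth (h : Fam) : Prop := ContDiffOn ℝ ∞ (fun p : ℝ × Pt => h p.1 p.2) (univ ×ˢ M)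

/-- The coordinate directions of `ℝ × Pt`; `none` is the parameter. -/
def dir : Option (Fin 4) → ℝ × Pt
  | none => (1, 0)
  | some a => (0, Pi.single a 1)

/-- Partial derivatives of a family, in the parameter (`none`) or in a coordinate. -/
def D (i : Option (Fin 4)) (h : Fam) : Fam :=
  fun s x => fderiv ℝ (fun p : ℝ × Pt => h p.1 p.2) (s, x) (dir i)

/-- The order lost by a coordinate derivative. -/
def wt (a : Fin 4) : ℤ := if a = 1 then 1 else 0

/-- The order lost by a partial derivative of a family. -/
def wo : Option (Fin 4) → ℤ
  | none => 0
  | some a => wt a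

lemma wo_none : wo none = 0 := rfl
lemma wo_some (a : Fin 4) : wo (some a) = wt a := rfl

lemma wo_nonneg (i : Option (Fin 4)) : 0 ≤ wo i := by
  cases i with
  | none => simp [wo]
  | some a => simp only [wo, wt]; split <;> simp

lemma mem_dom {s : ℝ} {x : Pt} (hx : x ∈ M) : (s, x) ∈ (univ : Set ℝ) ×ˢ M := ⟨trivial, hx⟩

lemma dom_nhds {s : ℝ} {x : Pt} (hx : x ∈ M) : (univ : Set ℝ) ×ˢ M ∈ 𝓝 (s, x) :=
  isOpen_dom.mem_nhds (mem_dom hx)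

lemma Smooth.contDiffAt {h : Fam} (hh : Smooth h) {s : ℝ} {x : Pt} (hx : x ∈ M) :
    ContDiffAt ℝ ∞ (fun p : ℝ × Pt => h p.1 p.2) (s, x) :=
  ContDiffOn.contDiffAt hh (dom_nhds hx)

lemma Smooth.differentiableAt {h : Fam} (hh : Smooth h) {s : ℝ} {x : Pt} (hx : x ∈ M) :
    DifferentiableAt ℝ (fun p : ℝ × Pt => h p.1 p.2) (s, x) :=
  (hh.contDiffAt hx).differentiableAt (by simp)

lemma Smooth.congr {h h' : Fam} (hh : Smooth h) (he : ∀ s, ∀ x ∈ M, h s x = h' s x) :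
    Smooth h' :=
  ContDiffOn.congr hh fun p hp => (he p.1 p.2 hp.2).symm

lemma D_congr {h h' : Fam} (he : ∀ s, ∀ x ∈ M, h s x = h' s x) (i : Option (Fin 4)) (s : ℝ)
    {x : Pt} (hx : x ∈ M) : D i h s x = D i h' s x := by
  unfold D
  rw [Filter.EventuallyEq.fderiv_eq]
  filter_upwards [dom_nhds hx] with p hp using he p.1 p.2 hp.2

lemma Smooth.D {h : Fam} (hh : Smooth h) (i : Option (Fin 4)) : Smooth (D i h) :=
  (ContDiffOn.fderiv_of_isOpen (m := ∞) hh isOpen_dom (by simp)).clm_apply contDiffOn_const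

lemma Smooth.hasDerivAt_none {h : Fam} (hh : Smooth h) (s : ℝ) {x : Pt} (hx : x ∈ M) :
    HasDerivAt (fun t => h t x) (Rindler.D none h s x) s := by
  have h1 := (hh.differentiableAt (s := s) hx).hasFDerivAt
  have h2 : HasDerivAt (fun t : ℝ => ((t, x) : ℝ × Pt)) ((1, 0) : ℝ × Pt) s :=
    (hasDerivAt_id s).prodMk (hasDerivAt_const s x)
  exact h1.comp_hasDerivAt s h2

lemma D_none {h : Fam} (hh : Smooth h) (s : ℝ) {x : Pt} (hx : x ∈ M) :
    D none h s x = deriv (fun t => h t x) s := (hh.hasDerivAt_none s hx).deriv.symm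

lemma Smooth.hasFDerivAt_slice {h : Fam} (hh : Smooth h) (s : ℝ) {x : Pt} (hx : x ∈ M) :
    HasFDerivAt (h s) ((fderiv ℝ (fun p : ℝ × Pt => h p.1 p.2) (s, x)).comp
      (ContinuousLinearMap.inr ℝ ℝ Pt)) x := by
  have h1 := (hh.differentiableAt (s := s) hx).hasFDerivAt
  exact h1.comp x (hasFDerivAt_prodMk_right s x)

lemma D_some {h : Fam} (hh : Smooth h) (a : Fin 4) (s : ℝ) {x : Pt} (hx : x ∈ M) :
    D (some a) h s x = pd a (h s) x := by
  unfold pd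
  rw [(hh.hasFDerivAt_slice s hx).fderiv]
  rfl

lemma Smooth.add {f g : Fam} (hf : Smooth f) (hg : Smooth g) :
    Smooth fun s x => f s x + g s x := ContDiffOn.add hf hg

lemma Smooth.mul {f g : Fam} (hf : Smooth f) (hg : Smooth g) :
    Smooth fun s x => f s x * g s x := ContDiffOn.mul hf hg

lemma Smooth.neg {f : Fam} (hf : Smooth f) : Smooth fun s x => -f s x := ContDiffOn.neg hf

lemma D_add {f g : Fam} (hf : Smooth f) (hg : Smooth g) (i : Option (Fin 4)) (s : ℝ) {x : Pt}
    (hx : x ∈ M) : D i (fun s x => f s x + g s x) s x = D i f s x + D i g s x := by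
  unfold D
  rw [((hf.differentiableAt hx).hasFDerivAt.fun_add (hg.differentiableAt hx).hasFDerivAt).fderiv]
  rfl

lemma D_neg {f : Fam} (i : Option (Fin 4)) (s : ℝ) (x : Pt) :
    D i (fun s x => -f s x) s x = -D i f s x := by
  unfold D
  rw [fderiv_fun_neg]
  rfl

lemma D_mul {f g : Fam} (hf : Smooth f) (hg : Smooth g) (i : Option (Fin 4)) (s : ℝ) {x : Pt}
    (hx : x ∈ M) :
    D i (fun s x => f s x * g s x) s x = f s x * D i g s x + D i f s x * g s x := by
  unfold D
  rw [((hf.differentiableAt hx).hasFDerivAt.fun_mul (hg.differentiableAt hx).hasFDerivAt).fderiv]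
  simp only [add_apply, smul_apply, smul_eq_mul]
  ring

lemma D_comm {h : Fam} (hh : Smooth h) (i j : Option (Fin 4)) (s : ℝ) {x : Pt} (hx : x ∈ M) :
    D i (D j h) s x = D j (D i h) s x := by
  have h1 : ContDiffAt ℝ ∞ (fderiv ℝ (fun p : ℝ × Pt => h p.1 p.2)) (s, x) :=
    (ContDiffOn.fderiv_of_isOpen (m := ∞) hh isOpen_dom (by simp)).contDiffAt (dom_nhds hx)
  have h2 := (h1.differentiableAt (by simp)).hasFDerivAt
  have key : ∀ i j : Option (Fin 4), D i (D j h) s x =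
      fderiv ℝ (fderiv ℝ (fun p : ℝ × Pt => h p.1 p.2)) (s, x) (dir i) (dir j) := by
    intro i j
    have h3 := h2.clm_apply (hasFDerivAt_const (dir j) (s, x))
    have h4 : (fun p : ℝ × Pt => D j h p.1 p.2) =
        fun p => fderiv ℝ (fun p : ℝ × Pt => h p.1 p.2) p (dir j) := rfl
    change fderiv ℝ (fun p : ℝ × Pt => D j h p.1 p.2) (s, x) (dir i) = _
    rw [h4, h3.fderiv]
    simp
  rw [key, key]
  exact (hh.contDiffAt hx).isSymmSndFDerivAt (by
    rw [minSmoothness_of_isRCLikeNormedField]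
    exact WithTop.coe_le_coe.2 (le_top : (2 : ℕ∞) ≤ ⊤)) _ _

/-! ## Orders at the horizon -/

/-- `h = O(ρ^k)` as `ρ → 0`, locally uniformly in the other variables. -/
def Bdd (k : ℤ) (h : Fam) : Prop :=
  ∀ R : ℝ, ∃ C ε : ℝ, 0 < ε ∧ ∀ (s : ℝ) (x : Pt), x ∈ M → x 1 < ε → |s| ≤ R → |x 0| ≤ R →
    |x 2| ≤ R → |x 3| ≤ R → |h s x| ≤ C * x 1 ^ k

/-- `h = O(ρ^k)` together with its derivatives up to order `n`. -/
def OO : ℕ → ℤ → Fam → Prop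
  | 0, k, h => Smooth h ∧ Bdd k h
  | n + 1, k, h => Smooth h ∧ Bdd k h ∧ ∀ i, OO n (k - wo i) (D i h)

/-- `h = O(ρ^k)` together with all its derivatives. -/
def IsO (k : ℤ) (h : Fam) : Prop := ∀ n, OO n k h

lemma OO.smooth {n : ℕ} {k : ℤ} {h : Fam} (hh : OO n k h) : Smooth h := by
  cases n <;> exact hh.1

lemma OO.bdd {n : ℕ} {k : ℤ} {h : Fam} (hh : OO n k h) : Bdd k h := by
  cases n with
  | zero => exact hh.2
  | succ n => exact hh.2.1

lemma IsO.smooth {k : ℤ} {h : Fam} (hh : IsO k h) : Smooth h := (hh 0).1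
lemma IsO.bdd {k : ℤ} {h : Fam} (hh : IsO k h) : Bdd k h := (hh 0).2
lemma IsO.D {k : ℤ} {h : Fam} (hh : IsO k h) (i : Option (Fin 4)) :
    IsO (k - wo i) (D i h) := fun n => (hh (n + 1)).2.2 i

lemma Bdd.congr {k : ℤ} {h h' : Fam} (hh : Bdd k h) (he : ∀ s, ∀ x ∈ M, h s x = h' s x) :
    Bdd k h' := by
  intro R
  obtain ⟨C, ε, hε, hC⟩ := hh R
  exact ⟨C, ε, hε, fun s x hx h1 h2 h3 h4 h5 => he s x hx ▸ hC s x hx h1 h2 h3 h4 h5⟩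

lemma Bdd.mono {k l : ℤ} {h : Fam} (hh : Bdd k h) (hl : l ≤ k) : Bdd l h := by
  intro R
  obtain ⟨C, ε, hε, hC⟩ := hh R
  refine ⟨|C|, min ε 1, by positivity, fun s x hx h1 h2 h3 h4 h5 => ?_⟩
  have hx' : 0 < x 1 := hx
  refine (hC s x hx (h1.trans_le (min_le_left _ _)) h2 h3 h4 h5).trans ?_
  refine (mul_le_mul_of_nonneg_right (le_abs_self C) (by positivity)).trans ?_
  exact mul_le_mul_of_nonneg_left
    (zpow_le_zpow_right_of_le_one₀ hx' (h1.trans_le (min_le_right _ _)).le hl) (abs_nonneg C)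

lemma Bdd.add {k : ℤ} {f g : Fam} (hf : Bdd k f) (hg : Bdd k g) :
    Bdd k fun s x => f s x + g s x := by
  intro R
  obtain ⟨C, ε, hε, hC⟩ := hf R
  obtain ⟨C', ε', hε', hC'⟩ := hg R
  refine ⟨C + C', min ε ε', by positivity, fun s x hx h1 h2 h3 h4 h5 => ?_⟩
  have a1 := hC s x hx (h1.trans_le (min_le_left _ _)) h2 h3 h4 h5
  have a2 := hC' s x hx (h1.trans_le (min_le_right _ _)) h2 h3 h4 h5
  have := abs_add_le (f s x) (g s x)
  linarith

lemma Bdd.neg {k : ℤ} {f : Fam} (hf : Bdd k f) : Bdd k fun s x => -f s x := by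
  intro R
  obtain ⟨C, ε, hε, hC⟩ := hf R
  exact ⟨C, ε, hε, fun s x hx h1 h2 h3 h4 h5 => by
    rw [abs_neg]; exact hC s x hx h1 h2 h3 h4 h5⟩

lemma Bdd.mul {k l : ℤ} {f g : Fam} (hf : Bdd k f) (hg : Bdd l g) :
    Bdd (k + l) fun s x => f s x * g s x := by
  intro R
  obtain ⟨C, ε, hε, hC⟩ := hf R
  obtain ⟨C', ε', hε', hC'⟩ := hg R
  refine ⟨C * C', min ε ε', by positivity, fun s x hx h1 h2 h3 h4 h5 => ?_⟩
  have a1 := hC s x hx (h1.trans_le (min_le_left _ _)) h2 h3 h4 h5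
  have a2 := hC' s x hx (h1.trans_le (min_le_right _ _)) h2 h3 h4 h5
  have hx' : 0 < x 1 := hx
  rw [abs_mul, zpow_add₀ hx'.ne']
  calc |f s x| * |g s x| ≤ (C * x 1 ^ k) * (C' * x 1 ^ l) :=
        mul_le_mul a1 a2 (abs_nonneg _) ((abs_nonneg _).trans a1)
    _ = _ := by ring

lemma OO.congr {n : ℕ} {k : ℤ} {h h' : Fam} (hh : OO n k h)
    (he : ∀ s, ∀ x ∈ M, h s x = h' s x) : OO n k h' := by
  induction n generalizing k h h' with
  | zero => exact ⟨hh.1.congr he, hh.2.congr he⟩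
  | succ n ih =>
    exact ⟨hh.1.congr he, hh.2.1.congr he, fun i =>
      ih (hh.2.2 i) fun s x hx => D_congr he i s hx⟩

lemma OO.mono {n : ℕ} {k l : ℤ} {h : Fam} (hh : OO n k h) (hl : l ≤ k) : OO n l h := by
  induction n generalizing k l h with
  | zero => exact ⟨hh.1, hh.2.mono hl⟩
  | succ n ih => exact ⟨hh.1, hh.2.1.mono hl, fun i => ih (hh.2.2 i) (by omega)⟩

/-- In inductions through the Leibniz or chain rule one factor stays undifferentiated, and has to be
brought down to the same number of available derivatives as the differentiated one. -/
lemma OO.pred {n : ℕ} {k : ℤ} {h : Fam} (hh : OO (n + 1) k h) : OO n k h := by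
  induction n generalizing k h with
  | zero => exact ⟨hh.1, hh.2.1⟩
  | succ n ih => exact ⟨hh.1, hh.2.1, fun i => ih (hh.2.2 i)⟩

lemma OO.add {n : ℕ} {k : ℤ} {f g : Fam} (hf : OO n k f) (hg : OO n k g) :
    OO n k fun s x => f s x + g s x := by
  induction n generalizing k f g with
  | zero => exact ⟨hf.1.add hg.1, hf.2.add hg.2⟩
  | succ n ih =>
    exact ⟨hf.1.add hg.1, hf.2.1.add hg.2.1, fun i => (ih (hf.2.2 i) (hg.2.2 i)).congr
      fun s x hx => (D_add hf.1 hg.1 i s hx).symm⟩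

lemma OO.neg {n : ℕ} {k : ℤ} {f : Fam} (hf : OO n k f) : OO n k fun s x => -f s x := by
  induction n generalizing k f with
  | zero => exact ⟨hf.1.neg, hf.2.neg⟩
  | succ n ih =>
    exact ⟨hf.1.neg, hf.2.1.neg, fun i => (ih (hf.2.2 i)).congr
      fun s x hx => (D_neg i s x).symm⟩

lemma OO.sub {n : ℕ} {k : ℤ} {f g : Fam} (hf : OO n k f) (hg : OO n k g) :
    OO n k fun s x => f s x - g s x := by
  simpa only [sub_eq_add_neg] using hf.add hg.neg

lemma OO.mul {n : ℕ} {k l m : ℤ} {f g : Fam} (hf : OO n k f) (hg : OO n l g)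
    (hm : m = k + l) : OO n m fun s x => f s x * g s x := by
  subst hm
  induction n generalizing k l f g with
  | zero => exact ⟨hf.1.mul hg.1, hf.2.mul hg.2⟩
  | succ n ih =>
    refine ⟨hf.1.mul hg.1, hf.2.1.mul hg.2.1, fun i => ?_⟩
    have h1 := (ih hf.pred (hg.2.2 i))
    have h2 := (ih (hf.2.2 i) hg.pred)
    refine ((h1.mono (l := k + l - wo i) (by omega)).add (h2.mono (by omega))).congr
      fun s x hx => (D_mul hf.1 hg.1 i s hx).symm

lemma IsO.congr {k : ℤ} {h h' : Fam} (hh : IsO k h)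
    (he : ∀ s, ∀ x ∈ M, h s x = h' s x) : IsO k h' := fun n => (hh n).congr he

lemma IsO.mono {k l : ℤ} {h : Fam} (hh : IsO k h) (hl : l ≤ k) : IsO l h :=
  fun n => (hh n).mono hl

lemma IsO.add {k : ℤ} {f g : Fam} (hf : IsO k f) (hg : IsO k g) :
    IsO k fun s x => f s x + g s x := fun n => (hf n).add (hg n)

lemma IsO.neg {k : ℤ} {f : Fam} (hf : IsO k f) : IsO k fun s x => -f s x := fun n => (hf n).neg

lemma IsO.sub {k : ℤ} {f g : Fam} (hf : IsO k f) (hg : IsO k g) :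
    IsO k fun s x => f s x - g s x := fun n => (hf n).sub (hg n)

lemma IsO.mul {k l m : ℤ} {f g : Fam} (hf : IsO k f) (hg : IsO l g) (hm : m ≤ k + l) :
    IsO m fun s x => f s x * g s x := fun n => ((hf n).mul (hg n) rfl).mono hm

/-- A globally smooth function of `(s, x)` is `O(1)`. -/
lemma IsO.of_contDiff {h : Fam} (hh : ContDiff ℝ ∞ fun p : ℝ × Pt => h p.1 p.2) : IsO 0 h := by
  intro n
  induction n generalizing h with
  | zero =>
    refine ⟨hh.contDiffOn, fun R => ?_⟩
    -- The side `R + 1` makes room for the coordinate `ρ`, which is only known to satisfy `0 < ρ <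
    -- 1`.
    have hK : IsCompact (Icc (-R) R ×ˢ (Set.pi univ fun _ : Fin 4 => Icc (-(R + 1)) (R + 1))) :=
      isCompact_Icc.prod (isCompact_univ_pi fun _ => isCompact_Icc)
    obtain ⟨C, hC⟩ := hK.exists_bound_of_continuousOn hh.continuous.continuousOn
    refine ⟨C, 1, one_pos, fun s x hx h1 h2 h3 h4 h5 => ?_⟩
    rw [zpow_zero, mul_one]
    have hx' : 0 < x 1 := hx
    have hR : 0 ≤ R := (abs_nonneg _).trans h2
    refine hC (s, x) ⟨abs_le.1 h2, fun i _ => ?_⟩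
    rw [abs_le] at *
    fin_cases i <;> simp only [Fin.zero_eta, Fin.mk_one, Fin.reduceFinMk, mem_Icc] <;>
      constructor <;> linarith
  | succ n ih =>
    have := ih (h := h) hh
    refine ⟨hh.contDiffOn, this.bdd, fun i => (ih ?_).mono (by have := wo_nonneg i; omega)⟩
    exact (hh.fderiv_right (m := ∞) (by simp)).clm_apply contDiff_const

lemma IsO.const (c : ℝ) : IsO 0 fun _ _ => c := IsO.of_contDiff contDiff_const

lemma D_const (c : ℝ) (i : Option (Fin 4)) (s : ℝ) (x : Pt) : D i (fun _ _ => c) s x = 0 := by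
  simp [D]

lemma IsO.zero (k : ℤ) : IsO k fun _ _ => 0 := by
  intro n
  induction n generalizing k with
  | zero => exact ⟨contDiffOn_const, fun R => ⟨0, 1, one_pos, by simp⟩⟩
  | succ n ih =>
    exact ⟨contDiffOn_const, fun R => ⟨0, 1, one_pos, by simp⟩, fun i =>
      (ih (k - wo i)).congr fun s x _ => (D_const 0 i s x).symm⟩

lemma IsO.const_mul {k : ℤ} {f : Fam} (c : ℝ) (hf : IsO k f) : IsO k fun s x => c * f s x :=
  (IsO.const c).mul hf (by simp)

lemma IsO.sum {ι : Type*} {k : ℤ} {f : ι → Fam} (S : Finset ι) (hf : ∀ i ∈ S, IsO k (f i)) :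
    IsO k fun s x => ∑ i ∈ S, f i s x := by
  classical
  induction S using Finset.induction_on with
  | empty => simpa using IsO.zero k
  | insert a S ha ih =>
    simp_rw [Finset.sum_insert ha]
    exact (hf a (by simp)).add (ih fun i hi => hf i (by simp [hi]))

lemma OO.sum {ι : Type*} {n : ℕ} {k : ℤ} {f : ι → Fam} (S : Finset ι)
    (hf : ∀ i ∈ S, OO n k (f i)) : OO n k fun s x => ∑ i ∈ S, f i s x := by
  classical
  induction S using Finset.induction_on with
  | empty => simpa using IsO.zero k n
  | insert a S ha ih =>
    simp_rw [Finset.sum_insert ha]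
    exact (hf a (by simp)).add (ih fun i hi => hf i (by simp [hi]))

lemma dir_some_apply (a b : Fin 4) : (dir (some a)).2 b = if a = b then 1 else 0 := by
  simp [dir, Pi.single_apply, eq_comm]

/-- The coordinate functions on `ℝ × Pt`. -/
def coordL (b : Fin 4) : ℝ × Pt →L[ℝ] ℝ :=
  (ContinuousLinearMap.proj (R := ℝ) (φ := fun _ : Fin 4 => ℝ) b).comp
    (ContinuousLinearMap.snd ℝ ℝ Pt)

lemma hasFDerivAt_coord (b : Fin 4) (p : ℝ × Pt) :
    HasFDerivAt (fun p : ℝ × Pt => p.2 b) (coordL b) p := (coordL b).hasFDerivAt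

lemma D_coord (b : Fin 4) (i : Option (Fin 4)) (s : ℝ) (x : Pt) :
    D i (fun _ x => x b) s x = (dir i).2 b := by
  unfold D
  rw [(hasFDerivAt_coord b _).fderiv]
  rfl

lemma contDiff_coord (b : Fin 4) : ContDiff ℝ ∞ fun p : ℝ × Pt => p.2 b := by fun_prop

lemma IsO.coord (b : Fin 4) : IsO (wt b) fun _ x => x b := by
  have h0 : IsO 0 fun _ x => x b := IsO.of_contDiff (contDiff_coord b)
  by_cases hb : b = 1
  · subst hb
    intro n
    have hb : Bdd (wt 1) fun _ x => x 1 := fun R =>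
      ⟨1, 1, one_pos, fun s x hx _ _ _ _ _ => by
        have : 0 < x 1 := hx
        simp [wt, abs_of_pos this]⟩
    cases n with
    | zero => exact ⟨h0.smooth, hb⟩
    | succ n =>
      refine ⟨h0.smooth, hb, fun i => ?_⟩
      by_cases hi : i = some 1
      · subst hi
        exact ((IsO.const 1 n).mono (by simp [wo])).congr fun s x _ => by
          rw [D_coord, dir_some_apply]; simp
      · refine (IsO.zero _ n).congr fun s x _ => ?_
        rw [D_coord]
        cases i with
        | none => rfl
        | some a =>
          rw [dir_some_apply, if_neg]
          rintro rfl
          exact hi rfl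
  · simpa [wt, hb] using h0

lemma IsO.rho_pow (n : ℕ) : IsO n fun _ x => x 1 ^ n := by
  induction n with
  | zero => simpa using IsO.const 1
  | succ n ih =>
    simp_rw [pow_succ]
    exact ih.mul (IsO.coord 1) (by simp [wt])

lemma Smooth.inv {f : Fam} (hf : Smooth f) (h0 : ∀ s, ∀ x ∈ M, f s x ≠ 0) :
    Smooth fun s x => (f s x)⁻¹ := ContDiffOn.inv hf fun p hp => h0 p.1 p.2 hp.2

lemma D_inv {f : Fam} (hf : Smooth f) (h0 : ∀ s, ∀ x ∈ M, f s x ≠ 0) (i : Option (Fin 4))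
    (s : ℝ) {x : Pt} (hx : x ∈ M) :
    D i (fun s x => (f s x)⁻¹) s x = -(D i f s x * ((f s x)⁻¹ * (f s x)⁻¹)) := by
  have h1 := (hf.differentiableAt (s := s) hx).hasFDerivAt
  have h2 := (hasDerivAt_inv (h0 s x hx)).comp_hasFDerivAt (s, x) h1
  unfold D
  have h3 : (fun p : ℝ × Pt => (f p.1 p.2)⁻¹) = (Inv.inv ∘ fun p : ℝ × Pt => f p.1 p.2) := rfl
  rw [h3, h2.fderiv]
  simp only [smul_apply, smul_eq_mul]
  field_simp

/-- Only the size of `1/f` has to be assumed: its derivatives are `-Df · f⁻²`, of order `(k - wo i)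
- 2k`, so they follow by induction. -/
lemma IsO.inv {k : ℤ} {f : Fam} (hf : IsO k f) (h0 : ∀ s, ∀ x ∈ M, f s x ≠ 0)
    (hb : Bdd (-k) fun s x => (f s x)⁻¹) : IsO (-k) fun s x => (f s x)⁻¹ := by
  intro n
  induction n with
  | zero => exact ⟨hf.smooth.inv h0, hb⟩
  | succ n ih =>
    refine ⟨hf.smooth.inv h0, hb, fun i => ?_⟩
    exact (((hf.D i) n).mul (ih.mul ih rfl) (by omega)).neg.congr fun s x hx =>
      (D_inv hf.smooth h0 i s hx).symm

lemma IsO.rho_zpow (k : ℤ) : IsO k fun _ x => x 1 ^ k := by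
  cases k with
  | ofNat n => simpa using IsO.rho_pow n
  | negSucc n =>
    have h1 := IsO.rho_pow (n + 1)
    have h2 := h1.inv (fun s x (hx : 0 < x 1) => (pow_pos hx _).ne') (fun R =>
      ⟨1, 1, one_pos, fun s x (hx : 0 < x 1) _ _ _ _ _ => by
        rw [abs_of_pos (by positivity), one_mul, zpow_neg, zpow_natCast]⟩)
    simp_rw [zpow_negSucc]
    exact h2.mono (by simp [Int.negSucc_eq])

lemma rho_ne {x : Pt} (hx : x ∈ M) : x 1 ≠ 0 := (show 0 < x 1 from hx).ne'

lemma D_rho_zpow (k : ℤ) (i : Option (Fin 4)) (s : ℝ) {x : Pt} (hx : x ∈ M) :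
    D i (fun _ x => x 1 ^ k) s x = k * x 1 ^ (k - 1) * (dir i).2 1 := by
  have h1 := hasFDerivAt_coord 1 (s, x)
  have h2 := (hasDerivAt_zpow k (x 1) (Or.inl (rho_ne hx))).comp_hasFDerivAt (s, x) h1
  unfold D
  have h3 : (fun p : ℝ × Pt => p.2 1 ^ k) = ((fun y : ℝ => y ^ k) ∘ fun p : ℝ × Pt => p.2 1) := rfl
  rw [h3, h2.fderiv]
  simp [coordL]

/-! ## Comparison with `FamilyBigO` -/

/-- Iterated coordinate derivatives of a family. -/
def Ds : List (Fin 4) → Fam → Fam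
  | [], h => h
  | a :: l, h => D (some a) (Ds l h)

/-- Iterated parameter derivatives of a family. -/
def DS : ℕ → Fam → Fam
  | 0, h => h
  | m + 1, h => D none (DS m h)

lemma Smooth.Ds {h : Fam} (hh : Smooth h) (l : List (Fin 4)) : Smooth (Ds l h) := by
  induction l with
  | nil => exact hh
  | cons a l ih => exact ih.D _

lemma Smooth.DS {h : Fam} (hh : Smooth h) (m : ℕ) : Smooth (DS m h) := by
  induction m with
  | zero => exact hh
  | succ m ih => exact ih.D _

lemma Ds_eq {h : Fam} (hh : Smooth h) (l : List (Fin 4)) (s : ℝ) :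
    ∀ x ∈ M, Ds l h s x = pds l (h s) x := by
  induction l with
  | nil => exact fun _ _ => rfl
  | cons a l ih =>
    intro x hx
    change D (some a) (Ds l h) s x = pd a (pds l (h s)) x
    rw [D_some (hh.Ds l) a s hx]
    unfold pd
    rw [Filter.EventuallyEq.fderiv_eq]
    filter_upwards [isOpen_M.mem_nhds hx] with y hy using ih y hy

lemma DS_eq {h : Fam} (hh : Smooth h) (m : ℕ) (s : ℝ) {x : Pt} (hx : x ∈ M) :
    DS m h s x = iteratedDeriv m (fun t => h t x) s := by
  induction m generalizing s with
  | zero => simp [Rindler.DS]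
  | succ m ih =>
    rw [iteratedDeriv_succ, Rindler.DS, D_none (hh.DS m) s hx]
    congr 1
    ext t
    exact ih t

lemma DS_Ds_eq {h : Fam} (hh : Smooth h) (m : ℕ) (l : List (Fin 4)) (s : ℝ) {x : Pt}
    (hx : x ∈ M) : DS m (Ds l h) s x = iteratedDeriv m (fun t => pds l (h t) x) s := by
  rw [DS_eq (hh.Ds l) m s hx]
  congr 1
  ext t
  exact Ds_eq hh l t x hx

lemma D_DS_comm {h : Fam} (hh : Smooth h) (a : Fin 4) (m : ℕ) (s : ℝ) {x : Pt} (hx : x ∈ M) :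
    D (some a) (DS m h) s x = DS m (D (some a) h) s x := by
  induction m generalizing s x with
  | zero => rfl
  | succ m ih =>
    change D (some a) (D none (DS m h)) s x = D none (DS m (D (some a) h)) s x
    rw [D_comm (hh.DS m) _ _ s hx]
    exact D_congr (fun s x hx => ih s hx) _ s hx

lemma IsO.Ds {k : ℤ} {h : Fam} (hh : IsO k h) (l : List (Fin 4)) :
    IsO (k - l.count 1) (Ds l h) := by
  induction l with
  | nil => simpa [Rindler.Ds] using hh
  | cons a l ih =>
    refine (ih.D (some a)).mono ?_
    simp only [wo, wt, List.count_cons, beq_iff_eq]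
    split <;> simp

lemma IsO.DS {k : ℤ} {h : Fam} (hh : IsO k h) (m : ℕ) : IsO k (DS m h) := by
  induction m with
  | zero => exact hh
  | succ m ih => simpa [wo, Rindler.DS] using ih.D none

lemma IsO.familyBigO {k : ℕ} {h : Fam} (hh : IsO k h) : FamilyBigO k h := by
  refine ⟨hh.smooth, fun m l R => ?_⟩
  obtain ⟨C, ε, hε, hC⟩ := ((hh.Ds l).DS m).bdd R
  refine ⟨C, ε, hε, fun s x hx h1 h2 h3 h4 h5 => ?_⟩
  rw [← DS_Ds_eq hh.smooth m l s hx]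
  exact hC s x hx h1 h2 h3 h4 h5

/-- `FamilyBigO` bounds derivatives in one fixed order, coordinates before parameter, while `IsO`
allows any order. The induction therefore runs over all `DS m (Ds l h)` at once: a parameter
derivative raises `m`, and a coordinate derivative is moved inside by symmetry of second derivatives
and lengthens `l`. -/
lemma FamilyBigO.isO {k : ℕ} {h : Fam} (hh : FamilyBigO k h) : IsO k h := by
  have hs : Smooth h := hh.1
  have key : ∀ n m l, OO n ((k : ℤ) - (l.count 1 : ℤ)) (DS m (Ds l h)) := by
    intro n
    have hb : ∀ m l, Bdd ((k : ℤ) - (l.count 1 : ℤ)) (DS m (Ds l h)) := by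
      intro m l R
      obtain ⟨C, ε, hε, hC⟩ := hh.2 m l R
      refine ⟨C, ε, hε, fun s x hx h1 h2 h3 h4 h5 => ?_⟩
      rw [DS_Ds_eq hs m l s hx]
      exact hC s x hx h1 h2 h3 h4 h5
    induction n with
    | zero => exact fun m l => ⟨(hs.Ds l).DS m, hb m l⟩
    | succ n ih =>
      refine fun m l => ⟨(hs.Ds l).DS m, hb m l, fun i => ?_⟩
      cases i with
      | none => simpa [wo, Rindler.DS] using ih (m + 1) l
      | some a =>
        refine ((ih m (a :: l)).mono ?_).congr fun s x hx => (D_DS_comm (hs.Ds l) a m s hx).symm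
        simp only [wo, wt, List.count_cons, beq_iff_eq]
        split <;> (simp; try omega)
  intro n
  simpa [DS, Ds] using key n 0 []

end Rindler
end

noncomputable section

namespace Rindler

/-! ## Grönwall estimates -/

/-- A continuity argument: the differential inequality is available only while `‖f‖ ≤ R`, but up to
the first time when `‖f‖` reaches `R` it yields a Grönwall bound that is strictly below `R`, so that
time never comes. -/
lemma gronwall_bootstrap_right {E : Type*} [NormedAddCommGroup E] [NormedSpace ℝ E]
    {f f' : ℝ → E} {T δ K c R : ℝ} (hf : ∀ s, HasDerivAt f (f' s) s) (h0 : ‖f 0‖ ≤ δ)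
    (hK : 0 ≤ K) (hc : 0 ≤ c) (hR : gronwallBound δ K c T < R)
    (hb : ∀ s ∈ Icc 0 T, ‖f s‖ ≤ R → ‖f' s‖ ≤ K * ‖f s‖ + c) :
    ∀ s ∈ Icc 0 T, ‖f s‖ ≤ gronwallBound δ K c T := by
  have hδ : 0 ≤ δ := (norm_nonneg _).trans h0
  have hcont : Continuous f := continuous_iff_continuousAt.2 fun s => (hf s).continuousAt
  have mono := gronwallBound_mono hδ hc hK
  have gron : ∀ t ∈ Icc 0 T, (∀ s ∈ Ico 0 t, ‖f s‖ ≤ R) → ‖f t‖ ≤ gronwallBound δ K c T := by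
    intro t ht hs
    have := norm_le_gronwallBound_of_norm_deriv_right_le (f := f) (f' := f') (δ := δ) (K := K)
      (ε := c) (a := 0) (b := t) hcont.continuousOn (fun x _ => (hf x).hasDerivWithinAt) h0
      (fun x hx => hb x ⟨hx.1, hx.2.le.trans ht.2⟩ (hs x hx)) t ⟨ht.1, le_rfl⟩
    rw [sub_zero] at this
    exact this.trans (mono ht.2)
  have small : ∀ t ∈ Icc 0 T, ‖f t‖ < R := by
    by_contra! hcon
    obtain ⟨t, ht, htR⟩ := hcon
    set S : Set ℝ := Icc 0 T ∩ {t | R ≤ ‖f t‖}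
    have hS : IsClosed S := isClosed_Icc.inter (isClosed_le continuous_const hcont.norm)
    have hbd : BddBelow S := ⟨0, fun x hx => hx.1.1⟩
    have hmem : sInf S ∈ S := hS.csInf_mem ⟨t, ht, htR⟩ hbd
    have := gron (sInf S) hmem.1 fun s hs => by
      by_contra! hlt
      exact absurd (csInf_le hbd (show s ∈ S from ⟨⟨hs.1, hs.2.le.trans hmem.1.2⟩, hlt.le⟩))
        (not_le.2 hs.2)
    exact absurd (hmem.2 : R ≤ _) (not_le.2 (this.trans_lt hR))
  exact fun s hs => gron s hs fun t ht => (small t ⟨ht.1, ht.2.le.trans hs.2⟩).le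

lemma gronwall_bootstrap {E : Type*} [NormedAddCommGroup E] [NormedSpace ℝ E]
    {f f' : ℝ → E} {T δ K c R : ℝ} (hf : ∀ s, HasDerivAt f (f' s) s) (h0 : ‖f 0‖ ≤ δ)
    (hK : 0 ≤ K) (hc : 0 ≤ c) (hR : gronwallBound δ K c T < R)
    (hb : ∀ s, |s| ≤ T → ‖f s‖ ≤ R → ‖f' s‖ ≤ K * ‖f s‖ + c) :
    ∀ s, |s| ≤ T → ‖f s‖ ≤ gronwallBound δ K c T := by
  intro s hs
  rcases le_total 0 s with h | h
  · exact gronwall_bootstrap_right hf h0 hK hc hR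
      (fun t ht => hb t (by rw [abs_of_nonneg ht.1]; exact ht.2)) s
      ⟨h, (le_abs_self s).trans hs⟩
  · have hf2 : ∀ t, HasDerivAt (fun t => f (-t)) (-f' (-t)) t := fun t => by
      simpa [Function.comp_def] using (hf (-t)).scomp t (hasDerivAt_neg t)
    have := gronwall_bootstrap_right (T := T) (R := R) hf2 (by simpa using h0) hK hc hR
      (fun t ht h1 => by
        rw [norm_neg]
        exact hb (-t) (by rw [abs_neg, abs_of_nonneg ht.1]; exact ht.2) h1) (-s)
      ⟨by linarith, (neg_le_abs s).trans hs⟩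
    simpa using this

lemma gronwall_symm {E : Type*} [NormedAddCommGroup E] [NormedSpace ℝ E]
    {f f' : ℝ → E} {T δ K c : ℝ} (hf : ∀ s, HasDerivAt f (f' s) s) (h0 : ‖f 0‖ ≤ δ)
    (hK : 0 ≤ K) (hc : 0 ≤ c) (hb : ∀ s, |s| ≤ T → ‖f' s‖ ≤ K * ‖f s‖ + c) :
    ∀ s, |s| ≤ T → ‖f s‖ ≤ gronwallBound δ K c T :=
  gronwall_bootstrap hf h0 hK hc (lt_add_one _) fun s hs _ => hb s hs

/-! ## Linear equations in the class -/

lemma Bdd.exists_nonneg {k : ℤ} {h : Fam} (hh : Bdd k h) (R : ℝ) : ∃ C ε : ℝ, 0 ≤ C ∧ 0 < ε ∧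
    ∀ (s : ℝ) (x : Pt), x ∈ M → x 1 < ε → |s| ≤ R → |x 0| ≤ R → |x 2| ≤ R → |x 3| ≤ R →
      |h s x| ≤ C * x 1 ^ k := by
  obtain ⟨C, ε, hε, hC⟩ := hh R
  refine ⟨|C|, ε, abs_nonneg _, hε, fun s x hx h1 h2 h3 h4 h5 => ?_⟩
  have hx' : 0 < x 1 := hx
  exact (hC s x hx h1 h2 h3 h4 h5).trans
    (mul_le_mul_of_nonneg_right (le_abs_self _) (by positivity))

/-- A common bound for a finite collection. -/
lemma exists_uniform_bound {ι : Type*} [Finite ι] {k : ι → ℤ} {h : ι → Fam}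
    (hh : ∀ i, Bdd (k i) (h i)) (R : ℝ) : ∃ C ε : ℝ, 0 ≤ C ∧ 0 < ε ∧
    ∀ i (s : ℝ) (x : Pt), x ∈ M → x 1 < ε → |s| ≤ R → |x 0| ≤ R → |x 2| ≤ R → |x 3| ≤ R →
      |h i s x| ≤ C * x 1 ^ k i := by
  classical
  cases nonempty_fintype ι
  choose C ε hC hε hb using fun i => (hh i).exists_nonneg R
  refine ⟨∑ i, C i, if hn : Nonempty ι then Finset.univ.inf' Finset.univ_nonempty ε else 1,
    Finset.sum_nonneg fun i _ => hC i, ?_, fun i s x hx h1 h2 h3 h4 h5 => ?_⟩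
  · split
    · rw [Finset.lt_inf'_iff]
      exact fun i _ => hε i
    · exact one_pos
  · have hn : Nonempty ι := ⟨i⟩
    have hx' : 0 < x 1 := hx
    rw [dif_pos hn] at h1
    refine (hb i s x hx (h1.trans_le (Finset.inf'_le _ (Finset.mem_univ i))) h2 h3 h4 h5).trans ?_
    exact mul_le_mul_of_nonneg_right
      (Finset.single_le_sum (fun i _ => hC i) (Finset.mem_univ i)) (by positivity)

/-- The rescaled unknowns `ρ^{-(v + u j)} Z j` solve a system whose coefficients `ρ^{u k - u j} B j
k` and source are bounded, because the point `x`, hence `ρ`, is fixed along the equation. Grönwall's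
inequality then gives a bound uniform in `ρ`. -/
lemma Bdd.linear {ι : Type*} [Fintype ι] {u : ι → ℤ} {v : ℤ} {B : ι → ι → Fam}
    {Z R : ι → Fam} (hB : ∀ j k, Bdd (u j - u k) (B j k)) (hR : ∀ j, Bdd (v + u j) (R j))
    (hZ0 : ∀ j, Bdd (v + u j) fun _ x => Z j 0 x) (hZ : ∀ j, Smooth (Z j))
    (hode : ∀ j s, ∀ x ∈ M, D none (Z j) s x = ∑ k, B j k s x * Z k s x + R j s x) (j : ι) :
    Bdd (v + u j) (Z j) := by
  intro r
  obtain ⟨CB, εB, hCB, hεB, bB⟩ :=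
    exists_uniform_bound (ι := ι × ι) (k := fun p => u p.1 - u p.2) (fun p => hB p.1 p.2) r
  obtain ⟨CR, εR, hCR, hεR, bR⟩ := exists_uniform_bound hR r
  obtain ⟨C0, ε0, hC0, hε0, b0⟩ := exists_uniform_bound hZ0 r
  refine ⟨gronwallBound C0 (Fintype.card ι * CB) CR r, min εB (min εR ε0), by positivity,
    fun s x hx h1 h2 h3 h4 h5 => ?_⟩
  have hx' : 0 < x 1 := hx
  obtain ⟨h1B, h1R, h10⟩ : x 1 < εB ∧ x 1 < εR ∧ x 1 < ε0 := by simpa [lt_min_iff] using h1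
  let f : ℝ → ι → ℝ := fun t j => x 1 ^ (-(v + u j)) * Z j t x
  let f' : ℝ → ι → ℝ := fun t j => x 1 ^ (-(v + u j)) * D none (Z j) t x
  have hpos : ∀ k : ℤ, 0 < x 1 ^ k := fun k => zpow_pos hx' k
  have hf : ∀ t, HasDerivAt f (f' t) t := fun t =>
    hasDerivAt_pi.2 fun j => ((hZ j).hasDerivAt_none t hx).const_mul _
  have hr : 0 ≤ r := (abs_nonneg _).trans h2
  have scale : ∀ (j : ι) (a C : ℝ), |a| ≤ C * x 1 ^ (v + u j) →
      |x 1 ^ (-(v + u j)) * a| ≤ C := by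
    intro j a C ha
    rw [abs_mul, abs_of_pos (hpos _)]
    calc x 1 ^ (-(v + u j)) * |a| ≤ x 1 ^ (-(v + u j)) * (C * x 1 ^ (v + u j)) :=
          mul_le_mul_of_nonneg_left ha (hpos _).le
      _ = C := by rw [zpow_neg]; field_simp
  have g := gronwall_symm (T := r) (δ := C0) (K := Fintype.card ι * CB) (c := CR) hf
    ((pi_norm_le_iff_of_nonneg hC0).2 fun j => by
      rw [Real.norm_eq_abs]
      exact scale j _ _ (b0 j s x hx h10 h2 h3 h4 h5)) (by positivity) hCR
    (fun t ht => (pi_norm_le_iff_of_nonneg (by positivity)).2 fun j => by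
      rw [Real.norm_eq_abs]
      have e : f' t j = ∑ k, (x 1 ^ (u k - u j) * B j k t x) * f t k +
          x 1 ^ (-(v + u j)) * R j t x := by
        simp only [f', f]
        rw [hode j t x hx, mul_add, Finset.mul_sum]
        congr 1
        refine Finset.sum_congr rfl fun k _ => ?_
        have : x 1 ^ (-(v + u j)) = x 1 ^ (u k - u j) * x 1 ^ (-(v + u k)) := by
          rw [← zpow_add₀ hx'.ne']; congr 1; ring
        rw [this]; ring
      rw [e]
      refine (abs_add_le _ _).trans (add_le_add ?_ (scale j _ _ (bR j t x hx h1R ht h3 h4 h5)))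
      refine (Finset.abs_sum_le_sum_abs _ _).trans ?_
      calc ∑ k, |x 1 ^ (u k - u j) * B j k t x * f t k| ≤ ∑ k : ι, CB * ‖f t‖ := by
            refine Finset.sum_le_sum fun k _ => ?_
            rw [abs_mul]
            refine mul_le_mul ?_ (norm_le_pi_norm (f t) k) (abs_nonneg _) hCB
            rw [abs_mul, abs_of_pos (hpos _)]
            calc x 1 ^ (u k - u j) * |B j k t x| ≤ x 1 ^ (u k - u j) * (CB * x 1 ^ (u j - u k)) :=
                  mul_le_mul_of_nonneg_left (bB (j, k) t x hx h1B ht h3 h4 h5) (hpos _).le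
              _ = CB := by
                  rw [mul_comm CB, ← mul_assoc, ← zpow_add₀ hx'.ne']
                  simp
        _ = Fintype.card ι * CB * ‖f t‖ := by simp [mul_assoc]) s h2
  have g1 := (norm_le_pi_norm (f s) j).trans g
  rw [Real.norm_eq_abs, abs_mul, abs_of_pos (hpos _), zpow_neg] at g1
  rwa [inv_mul_le_iff₀ (hpos _), mul_comm] at g1

lemma D_some_slice {h : Fam} (hh : Smooth h) (t : ℝ) (a : Fin 4) (s : ℝ) {x : Pt} (hx : x ∈ M) :
    D (some a) (fun _ x => h t x) s x = D (some a) h t x := by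
  have : Smooth fun _ x => h t x := by
    have h1 : ContDiff ℝ ∞ fun p : ℝ × Pt => (t, p.2) := by fun_prop
    exact ContDiffOn.comp (t := (univ : Set ℝ) ×ˢ M) hh h1.contDiffOn fun p hp => ⟨trivial, hp.2⟩
  rw [D_some this a s hx, D_some hh a t hx]

/-- A parameter derivative is read off from the equation. A coordinate derivative of the solution
satisfies the same homogeneous system, with the overall weight `v` lowered by the order of the
derivative and with the additional source `∑ (∂B) Z`, which is already controlled; this is why `v`,
`Z` and `R` vary in the induction. -/
lemma OO.linear {ι : Type*} [Fintype ι] {n : ℕ} {u : ι → ℤ} {v : ℤ} {B : ι → ι → Fam}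
    {Z R : ι → Fam} (hB : ∀ j k, OO n (u j - u k) (B j k)) (hR : ∀ j, OO n (v + u j) (R j))
    (hZ0 : ∀ j, OO n (v + u j) fun _ x => Z j 0 x) (hZ : ∀ j, Smooth (Z j))
    (hode : ∀ j s, ∀ x ∈ M, D none (Z j) s x = ∑ k, B j k s x * Z k s x + R j s x) (j : ι) :
    OO n (v + u j) (Z j) := by
  induction n generalizing v Z R j with
  | zero =>
    exact ⟨hZ j, Bdd.linear (fun j k => (hB j k).bdd) (fun j => (hR j).bdd)
      (fun j => (hZ0 j).bdd) hZ hode j⟩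
  | succ n ih =>
    have h1 : ∀ j, OO n (v + u j) (Z j) := fun j => ih (fun j k => (hB j k).pred)
      (fun j => (hR j).pred) (fun j => (hZ0 j).pred) hZ hode j
    refine ⟨hZ j, (h1 j).bdd, fun i => ?_⟩
    cases i with
    | none =>
      refine OO.congr (OO.add (OO.sum Finset.univ fun k _ => ((hB j k).pred.mul (h1 k) ?_))
        (hR j).pred) (fun s x hx => (hode j s x hx).symm) |>.mono (l := v + u j - wo none) (by simp [wo])
      ring
    | some a =>
      have h2 := ih (v := v - wt a) (Z := fun j => D (some a) (Z j))
        (R := fun j s x => ∑ k, D (some a) (B j k) s x * Z k s x + D (some a) (R j) s x)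
        (fun j k => (hB j k).pred)
        (fun j => (OO.sum Finset.univ fun k _ => (((hB j k).2.2 (some a)).mul (h1 k) (by
          simp only [wo]; ring))).add (((hR j).2.2 (some a)).mono (by simp only [wo]; omega)))
        (fun j => (((hZ0 j).2.2 (some a)).mono (by simp only [wo]; omega)).congr
          fun s x hx => D_some_slice (hZ j) 0 a s hx)
        (fun j => (hZ j).D _) ?_ j
      · exact h2.mono (by simp only [wo]; omega)
      · intro j s x hx
        have hs : Smooth fun s x => ∑ k, B j k s x * Z k s x :=
          (OO.sum Finset.univ fun k _ => ((hB j k).pred.mul (h1 k) rfl).mono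
            (l := v + u j) (by omega)).smooth
        rw [D_comm (hZ j) _ _ s hx, D_congr (hode j) _ s hx, D_add hs (hR j).smooth _ s hx]
        have h3 : D (some a) (fun s x => ∑ k, B j k s x * Z k s x) s x =
            ∑ k, (B j k s x * D (some a) (Z k) s x + D (some a) (B j k) s x * Z k s x) := by
          have hd : ∀ k ∈ Finset.univ, HasFDerivAt (fun p : ℝ × Pt => B j k p.1 p.2 * Z k p.1 p.2)
              (fderiv ℝ (fun p : ℝ × Pt => B j k p.1 p.2 * Z k p.1 p.2) (s, x)) (s, x) :=
            fun k _ => (((hB j k).smooth.mul (hZ k)).differentiableAt hx).hasFDerivAt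
          have h4 := HasFDerivAt.fun_sum hd
          have h5 : D (some a) (fun s x => ∑ k, B j k s x * Z k s x) s x =
              ∑ k, D (some a) (fun s x => B j k s x * Z k s x) s x := by
            unfold D
            rw [h4.fderiv, sum_apply]
          rw [h5]
          exact Finset.sum_congr rfl fun k _ => D_mul (hB j k).smooth (hZ k) _ s hx
        rw [h3, Finset.sum_add_distrib]
        ring

/-- A scalar linear equation with zero initial value. -/
lemma IsO.linear_scalar {k : ℤ} {b Z R : Fam} (hb : IsO 0 b) (hR : IsO k R) (hZ : Smooth Z)
    (h0 : ∀ x ∈ M, Z 0 x = 0)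
    (hode : ∀ s, ∀ x ∈ M, Rindler.D none Z s x = b s x * Z s x + R s x) : IsO k Z := by
  intro n
  have := OO.linear (ι := Unit) (n := n) (u := fun _ => 0) (v := k) (B := fun _ _ => b)
    (Z := fun _ => Z) (R := fun _ => R) (fun _ _ => (hb n).mono (by simp))
    (fun _ => (hR n).mono (by simp))
    (fun _ => ((IsO.zero _) n).congr fun s x hx => (h0 x hx).symm) (fun _ => hZ)
    (fun _ s x hx => by simpa using hode s x hx) ()
  exact this.mono (by simp)

/-! ## Composition -/

/-- A family of maps of `M` which is tangential to the horizon, up to order `n`. -/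
structure OMap (n : ℕ) (X : ℝ → Pt → Pt) : Prop where
  mapsTo : ∀ s, MapsTo (X s) M M
  comp : ∀ a, OO n (wt a) fun s x => X s x a
  lower : Bdd (-1) fun s x => (X s x 1)⁻¹

/-- Composition of a family with a family of maps. -/
def compX (h : Fam) (X : ℝ → Pt → Pt) : Fam := fun s x => h s (X s x)

lemma contDiffOn_of_comp {X : ℝ → Pt → Pt} (hX : ∀ a, Smooth fun s x => X s x a) :
    ContDiffOn ℝ ∞ (fun p : ℝ × Pt => (p.1, X p.1 p.2)) (univ ×ˢ M) :=
  contDiffOn_fst.prodMk (contDiffOn_pi.2 hX)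

lemma Smooth.compX {h : Fam} {X : ℝ → Pt → Pt} (hh : Smooth h)
    (hX : ∀ a, Smooth fun s x => X s x a) (hm : ∀ s, MapsTo (X s) M M) : Smooth (compX h X) :=
  ContDiffOn.comp (t := (univ : Set ℝ) ×ˢ M) hh (contDiffOn_of_comp hX)
    fun p hp => ⟨trivial, hm p.1 hp.2⟩

lemma dir_decomp (v : ℝ × Pt) : v = v.1 • dir none + ∑ a, v.2 a • dir (some a) := by
  have hp : v.2 = ∑ a, Pi.single a (v.2 a) := (Finset.univ_sum_single v.2).symm
  ext b
  · simp [dir, Prod.fst_sum]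
  · simp [dir, Prod.snd_sum, Pi.single_apply]

lemma D_compX {h : Fam} {X : ℝ → Pt → Pt} (hh : Smooth h)
    (hX : ∀ a, Smooth fun s x => X s x a) (hm : ∀ s, MapsTo (X s) M M) (i : Option (Fin 4))
    (s : ℝ) {x : Pt} (hx : x ∈ M) :
    D i (compX h X) s x = (dir i).1 * compX (D none h) X s x +
      ∑ a, compX (D (some a) h) X s x * D i (fun s x => X s x a) s x := by
  have h1 := (hh.differentiableAt (s := s) (hm s hx)).hasFDerivAt
  have h2 : HasFDerivAt (fun p : ℝ × Pt => (p.1, X p.1 p.2)) _ (s, x) :=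
    (hasFDerivAt_fst (𝕜 := ℝ)).prodMk (hasFDerivAt_pi.2 fun a => ((hX a).differentiableAt
      (s := s) hx).hasFDerivAt)
  have h3 := h1.comp (s, x) h2
  have h4 : D i (compX h X) s x = _ := congrArg (fun L => L (dir i)) h3.fderiv
  rw [h4, ContinuousLinearMap.comp_apply]
  rw [dir_decomp ((ContinuousLinearMap.prod _ _) (dir i)), map_add, map_smul, map_sum]
  congr 1
  refine Finset.sum_congr rfl fun a _ => ?_
  rw [map_smul, smul_eq_mul, mul_comm]
  rfl

/-- Two-sided comparability is needed because the orders that are transported may be negative. -/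
lemma zpow_le_of_comparable {r ρ C : ℝ} (hr : 0 < r) (h1 : r ≤ C * ρ)
    (h2 : r⁻¹ ≤ C * ρ⁻¹) (k : ℤ) : r ^ k ≤ C ^ k.natAbs * ρ ^ k := by
  rcases Int.natAbs_eq k with h | h
  · rw [h]
    simp only [zpow_natCast, Int.natAbs_natCast, ← mul_pow]
    exact pow_le_pow_left₀ hr.le h1 _
  · rw [h]
    simp only [zpow_neg, zpow_natCast, Int.natAbs_neg, Int.natAbs_natCast, ← inv_pow, ← mul_pow]
    exact pow_le_pow_left₀ (by positivity) h2 _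

lemma Bdd.compX {k : ℤ} {h : Fam} {X : ℝ → Pt → Pt} (hh : Bdd k h) (hX : OMap 0 X) :
    Bdd k (compX h X) := by
  intro R
  obtain ⟨C, ε, hC, hε, b⟩ := exists_uniform_bound (fun a => (hX.comp a).bdd) R
  obtain ⟨C', ε', hC', hε', b'⟩ := hX.lower.exists_nonneg R
  obtain ⟨Ch, εh, hCh, hεh, bh⟩ := hh.exists_nonneg (max R C)
  -- Since `X s x 1 ≤ C ρ`, the condition `ρ < εh / (C + 1)` keeps the image inside the collar where
  -- the bound on `h` holds; the box for `h` is enlarged to `max R C` because it has to contain the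
  -- image.
  refine ⟨Ch * (max C C') ^ k.natAbs, min (min ε ε') (εh / (C + 1)), by positivity,
    fun s x hx h1 h2 h3 h4 h5 => ?_⟩
  have hx' : 0 < x 1 := hx
  simp only [lt_min_iff] at h1
  have hX1 : 0 < X s x 1 := hX.mapsTo s hx
  have b0 := b 0 s x hx h1.1.1 h2 h3 h4 h5
  have b1 := b 1 s x hx h1.1.1 h2 h3 h4 h5
  have b2 := b 2 s x hx h1.1.1 h2 h3 h4 h5
  have b3 := b 3 s x hx h1.1.1 h2 h3 h4 h5
  have b4 := b' s x hx h1.1.2 h2 h3 h4 h5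
  have w0 : wt 0 = 0 := rfl
  have w1 : wt 1 = 1 := rfl
  have w2 : wt 2 = 0 := rfl
  have w3 : wt 3 = 0 := rfl
  rw [w0, zpow_zero, mul_one] at b0
  rw [w2, zpow_zero, mul_one] at b2
  rw [w3, zpow_zero, mul_one] at b3
  rw [w1, zpow_one, abs_of_pos hX1] at b1
  rw [abs_of_pos (by positivity), zpow_neg_one] at b4
  have h6 : X s x 1 < εh := by
    have := (lt_div_iff₀ (by positivity : 0 < C + 1)).1 h1.2
    nlinarith
  refine (bh s (X s x) (hX.mapsTo s hx) h6 (h2.trans (le_max_left _ _))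
    (b0.trans (le_max_right _ _)) (b2.trans (le_max_right _ _))
    (b3.trans (le_max_right _ _))).trans ?_
  rw [mul_assoc]
  refine mul_le_mul_of_nonneg_left (zpow_le_of_comparable hX1 ?_ ?_ k) hCh
  · exact b1.trans (mul_le_mul_of_nonneg_right (le_max_left _ _) hx'.le)
  · exact b4.trans (mul_le_mul_of_nonneg_right (le_max_right _ _) (by positivity))

lemma OMap.pred {n : ℕ} {X : ℝ → Pt → Pt} (hX : OMap (n + 1) X) : OMap n X :=
  ⟨hX.mapsTo, fun a => (hX.comp a).pred, hX.lower⟩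

lemma OMap.smooth {n : ℕ} {X : ℝ → Pt → Pt} (hX : OMap n X) (a : Fin 4) :
    Smooth fun s x => X s x a := (hX.comp a).smooth

lemma OMap.zero {n : ℕ} {X : ℝ → Pt → Pt} (hX : OMap n X) : OMap 0 X :=
  ⟨hX.mapsTo, fun a => ⟨(hX.comp a).smooth, (hX.comp a).bdd⟩, hX.lower⟩

lemma IsO.D_fst (i : Option (Fin 4)) : IsO (-wo i) fun _ _ => (dir i).1 := by
  cases i with
  | none => exact IsO.const _
  | some a => exact IsO.zero _

/-- In the chain rule the order `wt a` lost by `∂_a h` is restored by the component `X^a`, which is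
itself of order `wt a`; so every term has order `k - wo i`. -/
lemma OO.compX {n : ℕ} {k : ℤ} {h : Fam} {X : ℝ → Pt → Pt} (hh : OO n k h) (hX : OMap n X) :
    OO n k (compX h X) := by
  induction n generalizing k h with
  | zero => exact ⟨hh.1.compX hX.smooth hX.mapsTo, hh.2.compX hX⟩
  | succ n ih =>
    refine ⟨hh.1.compX hX.smooth hX.mapsTo, hh.2.1.compX hX.zero, fun i => ?_⟩
    refine OO.congr (OO.add ((IsO.D_fst i n).mul (ih (hh.2.2 none) hX.pred) ?_)
      (OO.sum Finset.univ fun a _ => (ih (hh.2.2 (some a)) hX.pred).mul ((hX.comp a).2.2 i) ?_))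
      fun s x hx => (D_compX hh.1 hX.smooth hX.mapsTo i s hx).symm
    · simp only [wo_none]; ring
    · simp only [wo_some]; ring

lemma IsO.compX {k : ℤ} {h : Fam} {X : ℝ → Pt → Pt} (hh : IsO k h) (hX : ∀ n, OMap n X) :
    IsO k (compX h X) := fun n => (hh n).compX (hX n)

end Rindler
end

noncomputable section

namespace Rindler

/-! ## Smoothness of primitives depending on parameters -/

/-- Differentiation under the integral sign, repeated. The target space varies in the induction,
because the derivative of the integrand takes values in a space of linear maps. -/
theorem contDiff_integral_unit {E : Type} [NormedAddCommGroup E] [NormedSpace ℝ E]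
    [FiniteDimensional ℝ E] (n : ℕ) : ∀ {F : Type} [NormedAddCommGroup F] [NormedSpace ℝ F]
    [CompleteSpace F] (g : ℝ × E → F), ContDiff ℝ ∞ g →
    ContDiff ℝ n fun x => ∫ θ in (0 : ℝ)..1, g (θ, x) := by
  induction n with
  | zero =>
    intro F _ _ _ g hg
    refine contDiff_zero.2 (intervalIntegral.continuous_parametric_intervalIntegral_of_continuous'
      (f := fun x θ => g (θ, x)) ?_ 0 1)
    exact hg.continuous.comp continuous_swap
  | succ n ih =>
    intro F _ _ _ g hg
    have hg' : ContDiff ℝ ∞ fun p => (fderiv ℝ g p).comp (ContinuousLinearMap.inr ℝ ℝ E) :=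
      (hg.fderiv_right (m := ∞) (by simp)).clm_comp contDiff_const
    refine contDiff_succ_iff_hasFDerivAt.2 ⟨_, ih _ hg', fun x => ?_⟩
    obtain ⟨C, hC⟩ := (isCompact_Icc.prod (isCompact_closedBall x 1)).exists_bound_of_continuousOn
      (hg'.continuous.continuousOn (s := Icc (0 : ℝ) 1 ×ˢ Metric.closedBall x 1))
    refine (intervalIntegral.hasFDerivAt_integral_of_dominated_of_fderiv_le (𝕜 := ℝ)
      (F := fun x θ => g (θ, x))
      (F' := fun x θ => (fderiv ℝ g (θ, x)).comp (ContinuousLinearMap.inr ℝ ℝ E))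
      (bound := fun _ => C) (Metric.closedBall_mem_nhds x one_pos) ?_ ?_ ?_ ?_ ?_ ?_)
    · exact Eventually.of_forall fun x =>
        (hg.continuous.comp (by fun_prop : Continuous fun θ : ℝ => (θ, x))).aestronglyMeasurable
    · exact (hg.continuous.comp
        (by fun_prop : Continuous fun θ : ℝ => (θ, x))).intervalIntegrable _ _
    · exact (hg'.continuous.comp
        (by fun_prop : Continuous fun θ : ℝ => (θ, x))).aestronglyMeasurable
    · refine Eventually.of_forall fun θ hθ y hy => hC (θ, y) ⟨?_, hy⟩
      rw [uIoc_of_le zero_le_one] at hθ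
      exact Ioc_subset_Icc_self hθ
    · exact intervalIntegrable_const
    · refine Eventually.of_forall fun θ _ y _ => ?_
      exact ((hg.differentiable (by simp)) (θ, y)).hasFDerivAt.comp y
        (hasFDerivAt_prodMk_right θ y)

/-- The primitive in the parameter. -/
def prim (T : ℝ → ℝ → ℝ → ℝ) (s y z : ℝ) : ℝ := ∫ t in (0 : ℝ)..s, T t y z

lemma contDiff_prim {T : ℝ → ℝ → ℝ → ℝ}
    (hT : ContDiff ℝ ∞ fun p : ℝ × ℝ × ℝ => T p.1 p.2.1 p.2.2) :
    ContDiff ℝ ∞ fun p : ℝ × ℝ × ℝ => prim T p.1 p.2.1 p.2.2 := by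
  -- Rescaling to a fixed interval turns the variable end point into an ordinary parameter of the
  -- integrand.
  have e : (fun p : ℝ × ℝ × ℝ => prim T p.1 p.2.1 p.2.2) = fun p =>
      p.1 * ∫ θ in (0 : ℝ)..1, T (p.1 * θ) p.2.1 p.2.2 := by
    ext p
    have := intervalIntegral.mul_integral_comp_mul_left (a := 0) (b := 1)
      (f := fun t => T t p.2.1 p.2.2) p.1
    rw [this]
    simp [prim]
  rw [e]
  refine contDiff_fst.mul (contDiff_infty.2 fun n => contDiff_integral_unit n
    (fun q : ℝ × (ℝ × ℝ × ℝ) => T (q.2.1 * q.1) q.2.2.1 q.2.2.2) ?_)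
  exact hT.comp (f := fun q : ℝ × (ℝ × ℝ × ℝ) => (q.2.1 * q.1, q.2.2.1, q.2.2.2)) (by fun_prop)

lemma hasDerivAt_prim {T : ℝ → ℝ → ℝ → ℝ}
    (hT : ContDiff ℝ ∞ fun p : ℝ × ℝ × ℝ => T p.1 p.2.1 p.2.2) (s y z : ℝ) :
    HasDerivAt (fun s => prim T s y z) (T s y z) s := by
  have : Continuous fun t => T t y z :=
    hT.continuous.comp (by fun_prop : Continuous fun t : ℝ => ((t, y, z) : ℝ × ℝ × ℝ))
  exact (this.integral_hasStrictDerivAt 0 s).hasDerivAt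

lemma prim_zero (T : ℝ → ℝ → ℝ → ℝ) (y z : ℝ) : prim T 0 y z = 0 := by simp [prim]

/-- A function of `(s, y, z)` as a family. -/
def lift (T : ℝ → ℝ → ℝ → ℝ) : Fam := fun s x => T s (x 2) (x 3)

lemma contDiff_lift {T : ℝ → ℝ → ℝ → ℝ}
    (hT : ContDiff ℝ ∞ fun p : ℝ × ℝ × ℝ => T p.1 p.2.1 p.2.2) :
    ContDiff ℝ ∞ fun p : ℝ × Pt => lift T p.1 p.2 :=
  hT.comp (f := fun p : ℝ × Pt => (p.1, p.2 2, p.2 3)) (by fun_prop)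

lemma IsO.lift {T : ℝ → ℝ → ℝ → ℝ}
    (hT : ContDiff ℝ ∞ fun p : ℝ × ℝ × ℝ => T p.1 p.2.1 p.2.2) : IsO 0 (lift T) :=
  IsO.of_contDiff (contDiff_lift hT)

/-! ## Differences of smooth functions of the transverse position -/

lemma D_smooth_comp {T : ℝ × ℝ × ℝ → ℝ} (hT : ContDiff ℝ ∞ T) {Y Z : Fam} (hY : Smooth Y)
    (hZ : Smooth Z) (i : Option (Fin 4)) (s : ℝ) {x : Pt} (hx : x ∈ M) :
    D i (fun s x => T (s, Y s x, Z s x)) s x =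
      (dir i).1 * fderiv ℝ T (s, Y s x, Z s x) (1, 0, 0) +
      D i Y s x * fderiv ℝ T (s, Y s x, Z s x) (0, 1, 0) +
      D i Z s x * fderiv ℝ T (s, Y s x, Z s x) (0, 0, 1) := by
  have h1 := ((hT.differentiable (by simp)) (s, Y s x, Z s x)).hasFDerivAt
  have h2 : HasFDerivAt (fun p : ℝ × Pt => (p.1, Y p.1 p.2, Z p.1 p.2)) _ (s, x) :=
    (hasFDerivAt_fst (𝕜 := ℝ)).prodMk ((hY.differentiableAt hx).hasFDerivAt.prodMk
      (hZ.differentiableAt hx).hasFDerivAt)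
  have h4 : D i (fun s x => T (s, Y s x, Z s x)) s x = _ :=
    congrArg (fun L => L (dir i)) (h1.comp (s, x) h2).fderiv
  rw [h4, ContinuousLinearMap.comp_apply]
  have h5 : ∀ a b c : ℝ, ((a, b, c) : ℝ × ℝ × ℝ) =
      a • ((1, 0, 0) : ℝ × ℝ × ℝ) + b • ((0, 1, 0) : ℝ × ℝ × ℝ) + c • ((0, 0, 1) : ℝ × ℝ × ℝ) := by
    intro a b c
    simp
  have h6 : ((ContinuousLinearMap.fst ℝ ℝ Pt).prod
      ((fderiv ℝ (fun p : ℝ × Pt => Y p.1 p.2) (s, x)).prod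
        (fderiv ℝ (fun p : ℝ × Pt => Z p.1 p.2) (s, x)))) (dir i) =
      ((dir i).1, D i Y s x, D i Z s x) := rfl
  rw [h6, h5 (dir i).1 (D i Y s x) (D i Z s x), map_add, map_add, map_smul, map_smul, map_smul]
  rfl

lemma Smooth.smooth_comp {T : ℝ × ℝ × ℝ → ℝ} (hT : ContDiff ℝ ∞ T) {Y Z : Fam} (hY : Smooth Y)
    (hZ : Smooth Z) : Smooth fun s x => T (s, Y s x, Z s x) :=
  hT.comp_contDiffOn (contDiffOn_fst.prodMk (hY.prodMk hZ))

lemma Smooth.sub {f g : Fam} (hf : Smooth f) (hg : Smooth g) :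
    Smooth fun s x => f s x - g s x := ContDiffOn.sub hf hg

lemma D_sub {f g : Fam} (hf : Smooth f) (hg : Smooth g) (i : Option (Fin 4)) (s : ℝ) {x : Pt}
    (hx : x ∈ M) : D i (fun s x => f s x - g s x) s x = D i f s x - D i g s x := by
  simp only [sub_eq_add_neg]
  rw [D_add hf hg.neg i s hx, D_neg]

lemma Bdd.smooth_comp {T : ℝ × ℝ × ℝ → ℝ} (hT : ContDiff ℝ ∞ T) {Y Z : Fam} (hY : Bdd 0 Y)
    (hZ : Bdd 0 Z) : Bdd 0 fun s x => T (s, Y s x, Z s x) := by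
  intro R
  obtain ⟨C, ε, hC, hε, b⟩ := hY.exists_nonneg R
  obtain ⟨C', ε', hC', hε', b'⟩ := hZ.exists_nonneg R
  obtain ⟨K, hK⟩ := (isCompact_closedBall (0 : ℝ × ℝ × ℝ) (max |R| (max C C'))
    ).exists_bound_of_continuousOn hT.continuous.continuousOn
  refine ⟨K, min ε ε', by positivity, fun s x hx h1 h2 h3 h4 h5 => ?_⟩
  rw [zpow_zero, mul_one]
  refine hK _ ?_
  have a1 := b s x hx (h1.trans_le (min_le_left _ _)) h2 h3 h4 h5
  have a2 := b' s x hx (h1.trans_le (min_le_right _ _)) h2 h3 h4 h5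
  rw [zpow_zero, mul_one] at a1 a2
  rw [mem_closedBall_zero_iff]
  exact max_le_max (h2.trans (le_abs_self R)) (max_le_max a1 a2)

lemma OO.smooth_comp {n : ℕ} {T : ℝ × ℝ × ℝ → ℝ} (hT : ContDiff ℝ ∞ T) {Y Z : Fam}
    (hY : OO n 0 Y) (hZ : OO n 0 Z) : OO n 0 fun s x => T (s, Y s x, Z s x) := by
  induction n generalizing T with
  | zero => exact ⟨hY.1.smooth_comp hT hZ.1, hY.2.smooth_comp hT hZ.2⟩
  | succ n ih =>
    refine ⟨hY.1.smooth_comp hT hZ.1, hY.bdd.smooth_comp hT hZ.bdd, fun i => ?_⟩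
    have hP : ∀ v, ContDiff ℝ ∞ fun q => fderiv ℝ T q v := fun v =>
      (hT.fderiv_right (m := ∞) (by simp)).clm_apply contDiff_const
    refine OO.congr (((((IsO.D_fst i) n).mul (ih (hP (1, 0, 0)) hY.pred hZ.pred) ?_).add
      ((hY.2.2 i).mul (ih (hP (0, 1, 0)) hY.pred hZ.pred) ?_)).add
      ((hZ.2.2 i).mul (ih (hP (0, 0, 1)) hY.pred hZ.pred) ?_))
      fun s x hx => (D_smooth_comp hT hY.1 hZ.1 i s hx).symm
    all_goals ring

lemma Bdd.smooth_comp_sub {k : ℤ} {T : ℝ × ℝ × ℝ → ℝ} (hT : ContDiff ℝ ∞ T) {Y Z Y' Z' : Fam}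
    (hY : Bdd 0 Y) (hZ : Bdd 0 Z) (hY' : Bdd 0 Y') (hZ' : Bdd 0 Z')
    (hYd : Bdd k fun s x => Y s x - Y' s x) (hZd : Bdd k fun s x => Z s x - Z' s x) :
    Bdd k fun s x => T (s, Y s x, Z s x) - T (s, Y' s x, Z' s x) := by
  intro R
  obtain ⟨C1, ε1, hC1, hε1, b1⟩ := exists_uniform_bound
    (ι := Fin 4) (k := fun _ => 0) (h := ![Y, Z, Y', Z'])
    (by intro i; fin_cases i <;> assumption) R
  obtain ⟨C2, ε2, hC2, hε2, b2⟩ := exists_uniform_bound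
    (ι := Fin 2) (k := fun _ => k) (h := ![fun s x => Y s x - Y' s x, fun s x => Z s x - Z' s x])
    (by intro i; fin_cases i <;> assumption) R
  obtain ⟨K, hK⟩ := (isCompact_closedBall (0 : ℝ × ℝ × ℝ) (max |R| C1)
    ).exists_bound_of_continuousOn (hT.continuous_fderiv (by simp)).continuousOn
  refine ⟨|K| * C2, min ε1 ε2, by positivity, fun s x hx h1 h2 h3 h4 h5 => ?_⟩
  have hx' : 0 < x 1 := hx
  have a1 := fun i => b1 i s x hx (h1.trans_le (min_le_left _ _)) h2 h3 h4 h5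
  have a2 := fun i => b2 i s x hx (h1.trans_le (min_le_right _ _)) h2 h3 h4 h5
  simp only [zpow_zero, mul_one] at a1
  have mem : ∀ y z : ℝ, |y| ≤ C1 → |z| ≤ C1 →
      ((s, y, z) : ℝ × ℝ × ℝ) ∈ Metric.closedBall (0 : ℝ × ℝ × ℝ) (max |R| C1) := by
    intro y z hy hz
    rw [mem_closedBall_zero_iff]
    exact max_le ((h2.trans (le_abs_self R)).trans (le_max_left _ _))
      (max_le (hy.trans (le_max_right _ _)) (hz.trans (le_max_right _ _)))
  have := (convex_closedBall (0 : ℝ × ℝ × ℝ) (max |R| C1)).norm_image_sub_le_of_norm_fderiv_le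
    (𝕜 := ℝ) (f := T) (C := |K|) (fun q _ => hT.differentiable (by simp) q)
    (fun q hq => (hK q hq).trans (le_abs_self K)) (mem _ _ (a1 2) (a1 3)) (mem _ _ (a1 0) (a1 1))
  rw [Real.norm_eq_abs] at this
  refine this.trans ?_
  rw [mul_assoc]
  refine mul_le_mul_of_nonneg_left ?_ (abs_nonneg K)
  have e : ((s, (![Y, Z, Y', Z'] : Fin 4 → Fam) 0 s x, (![Y, Z, Y', Z'] : Fin 4 → Fam) 1 s x) :
      ℝ × ℝ × ℝ) - (s, (![Y, Z, Y', Z'] : Fin 4 → Fam) 2 s x,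
        (![Y, Z, Y', Z'] : Fin 4 → Fam) 3 s x) = (0, Y s x - Y' s x, Z s x - Z' s x) := by
    simp
  rw [e]
  refine max_le ?_ (max_le (a2 0) (a2 1))
  rw [norm_zero]
  positivity

/-- The size is the mean value inequality. The derivatives are differences of products, split as `∂Y
(T_y - T_y') + (∂Y - ∂Y') T_y'`: the first bracket is the same kind of difference for a partial
derivative of `T`, and the second is controlled by hypothesis. -/
lemma OO.smooth_comp_sub {n : ℕ} {k : ℤ} {T : ℝ × ℝ × ℝ → ℝ} (hT : ContDiff ℝ ∞ T)
    {Y Z Y' Z' : Fam} (hY : OO n 0 Y) (hZ : OO n 0 Z) (hY' : OO n 0 Y') (hZ' : OO n 0 Z')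
    (hYd : OO n k fun s x => Y s x - Y' s x) (hZd : OO n k fun s x => Z s x - Z' s x) :
    OO n k fun s x => T (s, Y s x, Z s x) - T (s, Y' s x, Z' s x) := by
  induction n generalizing T with
  | zero => exact ⟨(hY.1.smooth_comp hT hZ.1).sub (hY'.1.smooth_comp hT hZ'.1),
      Bdd.smooth_comp_sub hT hY.2 hZ.2 hY'.2 hZ'.2 hYd.2 hZd.2⟩
  | succ n ih =>
    refine ⟨(hY.1.smooth_comp hT hZ.1).sub (hY'.1.smooth_comp hT hZ'.1),
      Bdd.smooth_comp_sub hT hY.bdd hZ.bdd hY'.bdd hZ'.bdd hYd.bdd hZd.bdd, fun i => ?_⟩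
    have hP : ∀ v, ContDiff ℝ ∞ fun q => fderiv ℝ T q v := fun v =>
      (hT.fderiv_right (m := ∞) (by simp)).clm_apply contDiff_const
    have I := fun v => ih (hP v) hY.pred hZ.pred hY'.pred hZ'.pred hYd.pred hZd.pred
    have I' := fun v => OO.smooth_comp (hP v) hY'.pred hZ'.pred
    refine OO.congr ((((IsO.D_fst i n).mul (I (1, 0, 0)) ?_).add
      (((hY.2.2 i).mul (I (0, 1, 0)) ?_).add ((hYd.2.2 i).mul (I' (0, 1, 0)) ?_))).add
      (((hZ.2.2 i).mul (I (0, 0, 1)) ?_).add ((hZd.2.2 i).mul (I' (0, 0, 1)) ?_)))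
      fun s x hx => ?_
    rotate_left 5
    · rw [D_sub (hY.1.smooth_comp hT hZ.1) (hY'.1.smooth_comp hT hZ'.1) i s hx,
        D_smooth_comp hT hY.1 hZ.1 i s hx, D_smooth_comp hT hY'.1 hZ'.1 i s hx,
        D_sub hY.1 hY'.1 i s hx, D_sub hZ.1 hZ'.1 i s hx]
      ring
    all_goals ring

end Rindler
end

noncomputable section

namespace Rindler

/-! ## Superdilatations -/

lemma eq_zero_of_le_rho {c C ε : ℝ} (hε : 0 < ε) (h : ∀ ρ, 0 < ρ → ρ < ε → |c| ≤ C * ρ) :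
    c = 0 := by
  have h1 : Tendsto (fun ρ : ℝ => C * ρ) (𝓝[>] 0) (𝓝 0) := by
    have : Tendsto (fun ρ : ℝ => C * ρ) (𝓝 0) (𝓝 (C * 0)) := tendsto_id.const_mul C
    rw [mul_zero] at this
    exact this.mono_left nhdsWithin_le_nhds
  have h2 : |c| ≤ 0 := ge_of_tendsto h1 (by
    filter_upwards [Ioo_mem_nhdsGT hε] with ρ hρ using h ρ hρ.1 hρ.2)
  exact abs_nonpos_iff.1 h2

/-- The device for reading off leading coefficients: a term `c ρ^k` that is `O(ρ^{k+1})` on a ray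
towards the horizon has `c = 0`. -/
lemma bdd_mul_rho_eq_zero {k : ℤ} {h : Fam} (hh : Bdd (k + 1) h) (s τ y z c : ℝ)
    (hc : ∀ ρ : ℝ, 0 < ρ → |h s ![τ, ρ, y, z]| = ρ ^ k * |c|) : c = 0 := by
  obtain ⟨C, ε, hε, hC⟩ := hh (max |s| (max |τ| (max |y| |z|)))
  refine eq_zero_of_le_rho (C := C) hε fun ρ h0 h1 => ?_
  have := hC s ![τ, ρ, y, z] h0 h1 (by simp) (by simp) (by simp) (by simp)
  rw [hc ρ h0] at this
  have hp : 0 < ρ ^ k := zpow_pos h0 k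
  simp only [Matrix.cons_val_one, Matrix.cons_val_zero] at this
  rw [zpow_add₀ h0.ne', zpow_one] at this
  have h3 : ρ ^ k * |c| ≤ ρ ^ k * (C * ρ) := by linarith
  exact le_of_mul_le_mul_left h3 hp

namespace IsSuperdilatationFamily

variable {ξ : ℝ → VField} {T₁ T₂ : ℝ → ℝ → ℝ → ℝ}

/-- Outside a bounded region the leading coefficients vanish. -/
lemma coeff_support (h : IsSuperdilatationFamily ξ T₁ T₂) (S : ℝ) : ∃ R : ℝ, 0 ≤ R ∧
    (∀ s, |s| ≤ S → ∀ x ∈ M, R < |x 2| ∨ R < |x 3| → ξ s x = 0) ∧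
    ∀ s, |s| ≤ S → ∀ y z, R < |y| ∨ R < |z| → T₁ s y z = 0 ∧ T₂ s y z = 0 := by
  obtain ⟨R, hR⟩ := h.support S
  have h0 : ∀ s, |s| ≤ S → ∀ x ∈ M, |R| < |x 2| ∨ |R| < |x 3| → ξ s x = 0 := by
    intro s hs x hx hyz
    by_contra hne
    obtain ⟨-, h2, h3⟩ := hR s hs x hx hne
    have := le_abs_self R
    rcases hyz with h | h <;> linarith
  refine ⟨|R|, abs_nonneg R, h0, fun s hs y z hyz => ?_⟩
  -- The slice `τ = 1` is chosen because the leading terms `τ T₁` and `τ ρ T₂` carry no information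
  -- at `τ = 0`.
  have hz : ∀ ρ : ℝ, 0 < ρ → ξ s ![1, ρ, y, z] = 0 := fun ρ hρ => h0 s hs _ hρ (by simpa using hyz)
  constructor
  · refine bdd_mul_rho_eq_zero (k := 0)
      (h.comp_τ.isO.bdd.mono (by norm_num : (0 + 1 : ℤ) ≤ _)) s 1 y z _ fun ρ hρ => ?_
    simp [hz ρ hρ]
  · refine bdd_mul_rho_eq_zero (k := 1)
      (h.comp_ρ.isO.bdd.mono (by norm_num : (1 + 1 : ℤ) ≤ _)) s 1 y z _ fun ρ hρ => ?_
    simp [hz ρ hρ, abs_mul, abs_of_pos hρ]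

lemma coeff_bound (h : IsSuperdilatationFamily ξ T₁ T₂) (S : ℝ) : ∃ K : ℝ, 0 ≤ K ∧
    ∀ s, |s| ≤ S → ∀ y z, |T₁ s y z| ≤ K ∧ |T₂ s y z| ≤ K := by
  obtain ⟨R, hR, -, hT⟩ := h.coeff_support S
  have hK := isCompact_closedBall (0 : ℝ × ℝ × ℝ) (max |S| R)
  obtain ⟨K1, h1⟩ := hK.exists_bound_of_continuousOn h.smooth₁.continuous.continuousOn
  obtain ⟨K2, h2⟩ := hK.exists_bound_of_continuousOn h.smooth₂.continuous.continuousOn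
  refine ⟨max |K1| |K2|, by positivity, fun s hs y z => ?_⟩
  by_cases hyz : R < |y| ∨ R < |z|
  · rw [(hT s hs y z hyz).1, (hT s hs y z hyz).2]
    simp
  · push Not at hyz
    have hm : ((s, y, z) : ℝ × ℝ × ℝ) ∈ Metric.closedBall (0 : ℝ × ℝ × ℝ) (max |S| R) := by
      rw [mem_closedBall_zero_iff]
      exact max_le ((hs.trans (le_abs_self S)).trans (le_max_left _ _))
        (max_le (hyz.1.trans (le_max_right _ _)) (hyz.2.trans (le_max_right _ _)))
    exact ⟨((h1 _ hm).trans (le_abs_self _)).trans (le_max_left _ _),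
      ((h2 _ hm).trans (le_abs_self _)).trans (le_max_right _ _)⟩

/-- The remainder of a component. -/
def rem (ξ : ℝ → VField) (T₁ T₂ : ℝ → ℝ → ℝ → ℝ) (a : Fin 4) : Fam := fun s x =>
  ξ s x a - (![x 0 * T₁ s (x 2) (x 3), x 0 * x 1 * T₂ s (x 2) (x 3), 0, 0] : Fin 4 → ℝ) a

lemma isO_rem (h : IsSuperdilatationFamily ξ T₁ T₂) (a : Fin 4) : IsO 2 (rem ξ T₁ T₂ a) := by
  fin_cases a
  · exact h.comp_τ.isO
  · exact h.comp_ρ.isO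
  · exact h.comp_y.isO.congr fun s x _ => by simp [rem]
  · exact h.comp_z.isO.congr fun s x _ => by simp [rem]

lemma isO_comp (h : IsSuperdilatationFamily ξ T₁ T₂) (a : Fin 4) :
    IsO (wt a) fun s x => ξ s x a := by
  have h1 := h.isO_rem a
  have hT1 : IsO 0 fun s x => x 0 * T₁ s (x 2) (x 3) :=
    (IsO.coord 0).mul (IsO.lift h.smooth₁) (by simp [wt])
  have hT2 : IsO 1 fun s x => x 0 * x 1 * T₂ s (x 2) (x 3) :=
    ((IsO.coord 0).mul (IsO.coord 1) (m := 1) (by simp [wt])).mul (IsO.lift h.smooth₂) (by simp)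
  have h2 : IsO (wt a) fun s x =>
      (![x 0 * T₁ s (x 2) (x 3), x 0 * x 1 * T₂ s (x 2) (x 3), 0, 0] : Fin 4 → ℝ) a := by
    fin_cases a
    · exact hT1
    · exact hT2
    · exact IsO.zero _
    · exact IsO.zero _
  refine ((h1.mono (l := wt a) ?_).add h2).congr fun s x _ => by simp [rem]
  simp only [wt]; split <;> norm_num

end IsSuperdilatationFamily

/-! ## Evolutions are tangential to the horizon -/

variable {ξ : ℝ → VField} {T₁ T₂ : ℝ → ℝ → ℝ → ℝ} {X : ℝ → Pt → Pt}

lemma IsEvolution.smooth_comp (hX : IsEvolution ξ X) (a : Fin 4) : Smooth fun s x => X s x a :=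
  contDiffOn_pi.1 hX.smooth a

lemma IsEvolution.D_none (hX : IsEvolution ξ X) (a : Fin 4) (s : ℝ) {x : Pt} (hx : x ∈ M) :
    D none (fun s x => X s x a) s x = compX (fun s x => ξ s x a) X s x := by
  rw [Rindler.D_none (hX.smooth_comp a) s hx]
  exact (hasDerivAt_pi.1 (hX.hasDerivAt x hx s) a).deriv

/-- In the variables `τ`, `log ρ` and the displacements of `log ρ, y, z`, the velocity has size at
most `K |τ| + 1` near the horizon: the leading terms are linear in `τ`, and the remainders `O(ρ²)`,
even after division by `ρ`, are at most `1` for small `ρ`. Grönwall's inequality bounds the change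
of `log ρ`, so that `X^ρ` stays comparable to `ρ`. -/
lemma IsEvolution.omap_zero (hξ : IsSuperdilatationFamily ξ T₁ T₂) (hX : IsEvolution ξ X) :
    OMap 0 X := by
  have key : ∀ R : ℝ, ∃ B ε : ℝ, 0 < ε ∧ ∀ (s : ℝ) (x : Pt), x ∈ M → x 1 < ε → |s| ≤ R →
      |x 0| ≤ R → |x 2| ≤ R → |x 3| ≤ R → |X s x 0| ≤ B ∧
        |Real.log (X s x 1) - Real.log (x 1)| ≤ B ∧ |X s x 2| ≤ B ∧ |X s x 3| ≤ B := by
    intro R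
    by_cases hR0 : 0 ≤ R
    swap
    · exact ⟨0, 1, one_pos, fun s x _ _ hs => absurd ((abs_nonneg s).trans hs) hR0⟩
    obtain ⟨K, hK, hT⟩ := hξ.coeff_bound R
    -- The value `1` for the source frees `B` from the remainder constant `C`, which can only be
    -- chosen afterwards, on a box whose size depends on `B`.
    set B := gronwallBound R K 1 R
    obtain ⟨C, ε, hC, hε, b⟩ := exists_uniform_bound (fun a => (hξ.isO_rem a).bdd) (R + (B + 1))
    have hB : R ≤ B := by
      have := gronwallBound_mono hR0 zero_le_one hK hR0
      rwa [gronwallBound_x0] at this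
    set ε' := min ε (min 1 (1 / (C + 1)))
    -- As long as `log ρ` has moved by at most `B + 1`, starting below `ε' e^{-(B+1)}` keeps the
    -- trajectory below `ε'`, where the remainder estimates apply.
    refine ⟨R + B, ε' * Real.exp (-(B + 1)), by positivity, fun s x hx h1 h2 h3 h4 h5 => ?_⟩
    have hx' : 0 < x 1 := hx
    have hpos : ∀ t, 0 < X t x 1 := fun t => hX.mapsTo t hx
    let f : ℝ → Fin 4 → ℝ := fun t =>
      ![X t x 0, Real.log (X t x 1) - Real.log (x 1), X t x 2 - x 2, X t x 3 - x 3]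
    let f' : ℝ → Fin 4 → ℝ := fun t =>
      ![ξ t (X t x) 0, ξ t (X t x) 1 / X t x 1, ξ t (X t x) 2, ξ t (X t x) 3]
    have hXd : ∀ t a, HasDerivAt (fun t => X t x a) (ξ t (X t x) a) t :=
      fun t => hasDerivAt_pi.1 (hX.hasDerivAt x hx t)
    have hf : ∀ t, HasDerivAt f (f' t) t := by
      refine fun t => hasDerivAt_pi.2 fun a => ?_
      fin_cases a
      · exact hXd t 0
      · exact ((hXd t 1).log (hpos t).ne').sub_const _
      · exact (hXd t 2).sub_const _
      · exact (hXd t 3).sub_const _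
    have hX0 : X 0 x = x := hX.zero x hx
    have g := gronwall_bootstrap (T := R) (δ := R) (K := K) (c := 1) (R := B + 1) hf
      ((pi_norm_le_iff_of_nonneg hR0).2 fun a => by
        fin_cases a <;> simp [f, hX0] <;> assumption) hK zero_le_one (lt_add_one _)
      (fun t ht hft => by
        have c0 : |X t x 0| ≤ ‖f t‖ := norm_le_pi_norm (f t) 0
        have c1 : |Real.log (X t x 1) - Real.log (x 1)| ≤ ‖f t‖ := norm_le_pi_norm (f t) 1
        have c2 : |X t x 2 - x 2| ≤ ‖f t‖ := norm_le_pi_norm (f t) 2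
        have c3 : |X t x 3 - x 3| ≤ ‖f t‖ := norm_le_pi_norm (f t) 3
        have hr : X t x 1 < ε' := by
          have : Real.log (X t x 1) ≤ Real.log (x 1) + (B + 1) := by
            have := (le_abs_self _).trans (c1.trans hft)
            linarith
          calc X t x 1 = Real.exp (Real.log (X t x 1)) := (Real.exp_log (hpos t)).symm
            _ ≤ Real.exp (Real.log (x 1) + (B + 1)) := Real.exp_le_exp.2 this
            _ = x 1 * Real.exp (B + 1) := by rw [Real.exp_add, Real.exp_log hx']
            _ < ε' * Real.exp (-(B + 1)) * Real.exp (B + 1) :=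
                mul_lt_mul_of_pos_right h1 (Real.exp_pos _)
            _ = ε' := by rw [mul_assoc, ← Real.exp_add]; simp
        obtain ⟨r1, r2, r3⟩ : X t x 1 < ε ∧ X t x 1 < 1 ∧ X t x 1 < 1 / (C + 1) := by
          simpa [ε', lt_min_iff] using hr
        have hp := hpos t
        have hr1 : C * X t x 1 ≤ 1 := by
          have := (lt_div_iff₀ (by positivity : 0 < C + 1)).1 r3
          nlinarith
        have hr2 : C * X t x 1 ^ 2 ≤ 1 := by nlinarith
        have rb := fun a => b a t (X t x) (hX.mapsTo t hx) r1 (by linarith)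
          (by linarith) (by have := abs_sub_abs_le_abs_sub (X t x 2) (x 2); linarith)
          (by have := abs_sub_abs_le_abs_sub (X t x 3) (x 3); linarith)
        have hTt := hT t ht (X t x 2) (X t x 3)
        have e1 : |X t x 0| * K ≤ K * ‖f t‖ := by nlinarith
        have hn : 0 ≤ K * ‖f t‖ := by positivity
        refine (pi_norm_le_iff_of_nonneg (by positivity)).2 fun a => ?_
        have rb0 : |ξ t (X t x) 0 - X t x 0 * T₁ t (X t x 2) (X t x 3)| ≤ C * X t x 1 ^ 2 := rb 0
        have rb1 : |ξ t (X t x) 1 - X t x 0 * X t x 1 * T₂ t (X t x 2) (X t x 3)| ≤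
          C * X t x 1 ^ 2 := rb 1
        have rb2 : |ξ t (X t x) 2 - 0| ≤ C * X t x 1 ^ 2 := rb 2
        have rb3 : |ξ t (X t x) 3 - 0| ≤ C * X t x 1 ^ 2 := rb 3
        rw [sub_zero] at rb2 rb3
        have m1 := mul_le_mul_of_nonneg_left hTt.1 (abs_nonneg (X t x 0))
        have m2 := mul_le_mul_of_nonneg_left hTt.2 (abs_nonneg (X t x 0))
        fin_cases a
        · change |ξ t (X t x) 0| ≤ _
          have := abs_sub_abs_le_abs_sub (ξ t (X t x) 0) (X t x 0 * T₁ t (X t x 2) (X t x 3))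
          rw [abs_mul] at this
          linarith
        · change |ξ t (X t x) 1 / X t x 1| ≤ _
          have := abs_sub_abs_le_abs_sub (ξ t (X t x) 1)
            (X t x 0 * X t x 1 * T₂ t (X t x 2) (X t x 3))
          rw [abs_mul, abs_mul, abs_of_pos hp] at this
          rw [abs_div, abs_of_pos hp, div_le_iff₀ hp]
          nlinarith
        · change |ξ t (X t x) 2| ≤ _
          linarith
        · change |ξ t (X t x) 3| ≤ _
          linarith) s h2
    have c0 : |X s x 0| ≤ ‖f s‖ := norm_le_pi_norm (f s) 0
    have c1 : |Real.log (X s x 1) - Real.log (x 1)| ≤ ‖f s‖ := norm_le_pi_norm (f s) 1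
    have c2 : |X s x 2 - x 2| ≤ ‖f s‖ := norm_le_pi_norm (f s) 2
    have c3 : |X s x 3 - x 3| ≤ ‖f s‖ := norm_le_pi_norm (f s) 3
    refine ⟨by linarith, by linarith, ?_, ?_⟩
    · have := abs_sub_abs_le_abs_sub (X s x 2) (x 2); linarith
    · have := abs_sub_abs_le_abs_sub (X s x 3) (x 3); linarith
  refine ⟨hX.mapsTo, fun a => ⟨hX.smooth_comp a, fun R => ?_⟩, fun R => ?_⟩
  · obtain ⟨B, ε, hε, h⟩ := key R
    by_cases ha : a = 1
    · subst ha
      refine ⟨Real.exp B, ε, hε, fun s x hx h1 h2 h3 h4 h5 => ?_⟩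
      have hx' : 0 < x 1 := hx
      have hp : 0 < X s x 1 := hX.mapsTo s hx
      have := (le_abs_self _).trans (h s x hx h1 h2 h3 h4 h5).2.1
      rw [abs_of_pos hp, show wt 1 = 1 from rfl, zpow_one]
      calc X s x 1 = Real.exp (Real.log (X s x 1)) := (Real.exp_log hp).symm
        _ ≤ Real.exp (B + Real.log (x 1)) := Real.exp_le_exp.2 (by linarith)
        _ = _ := by rw [Real.exp_add, Real.exp_log hx']
    · refine ⟨B, ε, hε, fun s x hx h1 h2 h3 h4 h5 => ?_⟩
      rw [show wt a = 0 by simp [wt, ha], zpow_zero, mul_one]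
      obtain ⟨e0, -, e2, e3⟩ := h s x hx h1 h2 h3 h4 h5
      fin_cases a
      · exact e0
      · exact absurd rfl ha
      · exact e2
      · exact e3
  · obtain ⟨B, ε, hε, h⟩ := key R
    refine ⟨Real.exp B, ε, hε, fun s x hx h1 h2 h3 h4 h5 => ?_⟩
    have hx' : 0 < x 1 := hx
    have hp : 0 < X s x 1 := hX.mapsTo s hx
    have := (neg_le_abs _).trans (h s x hx h1 h2 h3 h4 h5).2.1
    rw [abs_of_pos (by positivity), zpow_neg_one]
    calc (X s x 1)⁻¹ = Real.exp (-Real.log (X s x 1)) := by rw [Real.exp_neg, Real.exp_log hp]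
      _ ≤ Real.exp (B + -Real.log (x 1)) := Real.exp_le_exp.2 (by linarith)
      _ = _ := by rw [Real.exp_add, Real.exp_neg, Real.exp_log hx']

/-- The variational equation. -/
lemma IsEvolution.variation (hξ : IsSuperdilatationFamily ξ T₁ T₂) (hX : IsEvolution ξ X)
    (a b : Fin 4) (s : ℝ) {x : Pt} (hx : x ∈ M) :
    D none (D (some b) fun s x => X s x a) s x =
      ∑ c, compX (D (some c) fun s x => ξ s x a) X s x * D (some b) (fun s x => X s x c) s x := by
  rw [D_comm (hX.smooth_comp a) _ _ s hx, D_congr (fun s x hx => hX.D_none a s hx) _ s hx,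
    D_compX (hξ.isO_comp a).smooth hX.smooth_comp hX.mapsTo _ s hx]
  simp [dir]

lemma IsEvolution.D_zero (hX : IsEvolution ξ X) (a b : Fin 4) {x : Pt} (hx : x ∈ M) :
    D (some b) (fun s x => X s x a) 0 x = if b = a then 1 else 0 := by
  rw [← D_some_slice (hX.smooth_comp a) 0 b 0 hx,
    D_congr (h' := fun _ x => x a) (fun s x hx => by rw [hX.zero x hx]) _ _ hx, D_coord,
    dir_some_apply]

/-- For fixed `b`, the column `∂_b X^a` solves the variational system with coefficients `∂_c ξ^a ∘
X`, of order `wt a - wt c`: exactly the shape required by `OO.linear`, with weights `wt`. Each step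
uses the composition estimate at the level already reached, so that derivatives are gained one at a
time. -/
lemma IsEvolution.omap (hξ : IsSuperdilatationFamily ξ T₁ T₂) (hX : IsEvolution ξ X) (n : ℕ) :
    OMap n X := by
  have h0 := hX.omap_zero hξ
  induction n with
  | zero => exact h0
  | succ n ih =>
    refine ⟨h0.mapsTo, fun a => ⟨h0.smooth a, (h0.comp a).2, fun i => ?_⟩, h0.lower⟩
    cases i with
    | none =>
      refine OO.congr (((hξ.isO_comp a n).compX ih).mono (by simp [wo])) fun s x hx =>
        (hX.D_none a s hx).symm
    | some b =>
      refine OO.mono (OO.linear (u := wt) (v := -wt b)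
        (B := fun a c => compX (D (some c) fun s x => ξ s x a) X)
        (Z := fun a => D (some b) fun s x => X s x a) (R := fun _ _ _ => 0)
        (fun a c => (((hξ.isO_comp a).D (some c)) n).compX ih) (fun a => IsO.zero _ n)
        (fun a => ?_) (fun a => (h0.smooth a).D _)
        (fun a s x hx => by rw [hX.variation hξ a b s hx, add_zero]) a) (by simp only [wo]; omega)
      refine OO.congr (h := fun _ _ => if b = a then 1 else 0) ?_
        fun s x hx => (hX.D_zero a b hx).symm
      by_cases hab : b = a
      · subst hab
        simpa using IsO.const 1 n
      · simpa [hab] using IsO.zero _ n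

/-! ## Asymptotic form of evolutions -/

/-- A family of diffeomorphisms with the asymptotic form
`(τ e^F, ρ e^{A τ}, y, z) + O(ρ²)`, where `F, A` depend on `(s, y, z)`. -/
structure HorizonMap (X : ℝ → Pt → Pt) (F A : ℝ → ℝ → ℝ → ℝ) : Prop where
  smoothF : ContDiff ℝ ∞ fun p : ℝ × ℝ × ℝ => F p.1 p.2.1 p.2.2
  smoothA : ContDiff ℝ ∞ fun p : ℝ × ℝ × ℝ => A p.1 p.2.1 p.2.2
  omap : ∀ n, OMap n X
  comp_τ : IsO 2 fun s x => X s x 0 - x 0 * Real.exp (F s (x 2) (x 3))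
  comp_ρ : IsO 2 fun s x => X s x 1 - x 1 * Real.exp (A s (x 2) (x 3) * x 0)
  comp_y : IsO 2 fun s x => X s x 2 - x 2
  comp_z : IsO 2 fun s x => X s x 3 - x 3
  det_pos : ∀ s, ∀ x ∈ M,
    0 < (Matrix.of fun a b : Fin 4 => D (some b) (fun s x => X s x a) s x).det

lemma OMap.isO {X : ℝ → Pt → Pt} (hX : ∀ n, OMap n X) (a : Fin 4) :
    IsO (wt a) fun s x => X s x a := fun n => (hX n).comp a

lemma IsEvolution.comp_yz (hξ : IsSuperdilatationFamily ξ T₁ T₂) (hX : IsEvolution ξ X)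
    (a : Fin 4) (ha : a = 2 ∨ a = 3) : IsO 2 fun s x => X s x a - x a := by
  have hr := (hξ.isO_rem a).compX (hX.omap hξ)
  have hc : Smooth fun _ x => x a := (IsO.coord a).smooth
  refine IsO.linear_scalar (IsO.zero 0) hr ((hX.smooth_comp a).sub hc)
    (fun x hx => by rw [hX.zero x hx, sub_self]) fun s x hx => ?_
  rw [D_sub (hX.smooth_comp a) hc _ s hx, hX.D_none a s hx, D_coord]
  rcases ha with rfl | rfl <;> simp [compX, IsSuperdilatationFamily.rem, dir]

lemma IsEvolution.coeff_sub (hξ : IsSuperdilatationFamily ξ T₁ T₂) (hX : IsEvolution ξ X)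
    {T : ℝ → ℝ → ℝ → ℝ} (hT : ContDiff ℝ ∞ fun p : ℝ × ℝ × ℝ => T p.1 p.2.1 p.2.2) :
    IsO 2 fun s x => T s (X s x 2) (X s x 3) - T s (x 2) (x 3) := fun n =>
  OO.smooth_comp_sub (T := fun p => T p.1 p.2.1 p.2.2) hT ((hX.omap hξ n).comp 2)
    ((hX.omap hξ n).comp 3) (IsO.coord 2 n) (IsO.coord 3 n) (hX.comp_yz hξ 2 (Or.inl rfl) n)
    (hX.comp_yz hξ 3 (Or.inr rfl) n)

lemma D_none_eq_of_hasDerivAt {h : Fam} (hh : Smooth h) {s : ℝ} {x : Pt} (hx : x ∈ M) {c : ℝ}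
    (hd : HasDerivAt (fun t => h t x) c s) : D none h s x = c := by
  rw [D_none hh s hx, hd.deriv]

/-- The difference `Z = X^τ - τ e^F` starts at zero and satisfies `Z' = T₁ Z + X^τ (T₁(X) - T₁(x)) +
rem`. The source is `O(ρ²)` because the transverse position moves by `O(ρ²)` only. -/
lemma IsEvolution.comp_τ (hξ : IsSuperdilatationFamily ξ T₁ T₂) (hX : IsEvolution ξ X) :
    IsO 2 fun s x => X s x 0 - x 0 * Real.exp (prim T₁ s (x 2) (x 3)) := by
  have hF := contDiff_lift (contDiff_prim hξ.smooth₁)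
  have hE : ContDiff ℝ ∞ fun p : ℝ × Pt => p.2 0 * Real.exp (prim T₁ p.1 (p.2 2) (p.2 3)) :=
    (contDiff_coord 0).mul (Real.contDiff_exp.comp hF)
  have hr := (hξ.isO_rem 0).compX (hX.omap hξ)
  have hd := ((OMap.isO (hX.omap hξ) 0).mul (hX.coeff_sub hξ hξ.smooth₁) (m := 2)
    (by simp [wt])).add hr
  have hEs : Smooth fun s x => x 0 * Real.exp (prim T₁ s (x 2) (x 3)) := hE.contDiffOn
  refine IsO.linear_scalar (IsO.lift hξ.smooth₁) hd ((hX.smooth_comp 0).sub hEs)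
    (fun x hx => by rw [hX.zero x hx, prim_zero]; simp) fun s x hx => ?_
  rw [D_sub (hX.smooth_comp 0) hEs _ s hx, hX.D_none 0 s hx, D_none_eq_of_hasDerivAt hEs hx
    (((hasDerivAt_prim hξ.smooth₁ s (x 2) (x 3)).exp).const_mul (x 0))]
  simp only [compX, IsSuperdilatationFamily.rem, Matrix.cons_val_zero, lift]
  ring

/-- The parameter derivative of the exponent of the `ρ` component of an evolution. -/
def velA (T₁ T₂ : ℝ → ℝ → ℝ → ℝ) (s y z : ℝ) : ℝ := T₂ s y z * Real.exp (prim T₁ s y z)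

/-- The exponent of the `ρ` component of an evolution. -/
def primA (T₁ T₂ : ℝ → ℝ → ℝ → ℝ) : ℝ → ℝ → ℝ → ℝ := prim (velA T₁ T₂)

lemma contDiff_velA (hξ : IsSuperdilatationFamily ξ T₁ T₂) :
    ContDiff ℝ ∞ fun p : ℝ × ℝ × ℝ => velA T₁ T₂ p.1 p.2.1 p.2.2 :=
  hξ.smooth₂.mul (Real.contDiff_exp.comp (contDiff_prim hξ.smooth₁))

/-- Along the flow the logarithmic velocity of `X^ρ` is close to `X^τ T₂`, hence to `τ e^F T₂`; this
is why the exponent `A` integrates `T₂ e^F` and not `T₂`. The difference from `ρ e^{Aτ}` again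
solves a scalar linear equation with source `O(ρ²)`. -/
lemma IsEvolution.comp_ρ (hξ : IsSuperdilatationFamily ξ T₁ T₂) (hX : IsEvolution ξ X) :
    IsO 2 fun s x => X s x 1 - x 1 * Real.exp (primA T₁ T₂ s (x 2) (x 3) * x 0) := by
  have hT := contDiff_velA hξ
  have hA := contDiff_lift (contDiff_prim hT)
  have hE : ContDiff ℝ ∞ fun p : ℝ × Pt =>
      p.2 1 * Real.exp (primA T₁ T₂ p.1 (p.2 2) (p.2 3) * p.2 0) :=
    (contDiff_coord 1).mul (Real.contDiff_exp.comp (hA.mul (contDiff_coord 0)))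
  have hr := (hξ.isO_rem 1).compX (hX.omap hξ)
  have h0 := OMap.isO (hX.omap hξ) 0
  have hd := ((OMap.isO (hX.omap hξ) 1).mul ((h0.mul (hX.coeff_sub hξ hξ.smooth₂) (m := 2)
    (by simp [wt])).add ((IsO.lift hξ.smooth₂).mul (hX.comp_τ hξ) (m := 2) (by simp)))
    (m := 2) (by simp [wt])).add hr
  have hEs : Smooth fun s x => x 1 * Real.exp (primA T₁ T₂ s (x 2) (x 3) * x 0) := hE.contDiffOn
  refine IsO.linear_scalar ((IsO.coord 0).mul (IsO.lift hT) (m := 0) (by simp [wt])) hd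
    ((hX.smooth_comp 1).sub hEs)
    (fun x hx => by rw [hX.zero x hx]; simp [primA, prim_zero]) fun s x hx => ?_
  rw [D_sub (hX.smooth_comp 1) hEs _ s hx, hX.D_none 1 s hx, D_none_eq_of_hasDerivAt hEs hx
    ((((hasDerivAt_prim hT s (x 2) (x 3)).mul_const (x 0)).exp).const_mul (x 1))]
  simp only [compX, IsSuperdilatationFamily.rem, Matrix.cons_val_one, Matrix.cons_val_zero, lift,
    primA, velA]
  ring

/-- If the Jacobian at time `s` kills `v`, then the Jacobian applied to `v` solves a homogeneous
linear equation vanishing at time `s`, hence at all times in between; at time `0` the Jacobian is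
the identity, and so `v = 0`. -/
lemma IsEvolution.det_ne_zero (hξ : IsSuperdilatationFamily ξ T₁ T₂) (hX : IsEvolution ξ X)
    (s : ℝ) {x : Pt} (hx : x ∈ M) :
    (Matrix.of fun a b : Fin 4 => D (some b) (fun s x => X s x a) s x).det ≠ 0 := by
  intro hdet
  obtain ⟨v, hv, hJ⟩ := Matrix.exists_mulVec_eq_zero_iff.2 hdet
  apply hv
  let f : ℝ → Fin 4 → ℝ := fun t a => ∑ b, D (some b) (fun s x => X s x a) (t + s) x * v b
  let B : ℝ → Fin 4 → Fin 4 → ℝ := fun t a c =>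
    compX (D (some c) fun s x => ξ s x a) X (t + s) x
  let f' : ℝ → Fin 4 → ℝ := fun t a => ∑ c, B t a c * f t c
  have hf : ∀ t, HasDerivAt f (f' t) t := by
    refine fun t => hasDerivAt_pi.2 fun a => ?_
    have h1 : HasDerivAt (fun t => f t a)
        (∑ b, D none (D (some b) fun s x => X s x a) (t + s) x * v b) t :=
      HasDerivAt.fun_sum fun b _ => HasDerivAt.mul_const
        (HasDerivAt.comp_add_const t s (((hX.smooth_comp a).D (some b)).hasDerivAt_none (t + s) hx)) _
    have e := fun b => hX.variation hξ a b (t + s) hx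
    have e2 : f' t a = ∑ b, D none (D (some b) fun s x => X s x a) (t + s) x * v b := by
      simp only [e, f', f, B, Finset.mul_sum, Finset.sum_mul]
      rw [Finset.sum_comm]
      exact Finset.sum_congr rfl fun b _ => Finset.sum_congr rfl fun c _ => by ring
    rw [e2]
    exact h1
  have hBc : ∀ a c, Continuous fun t => B t a c := fun a c => by
    have hs : Smooth (compX (D (some c) fun s x => ξ s x a) X) :=
      ((hξ.isO_comp a).smooth.D _).compX hX.smooth_comp hX.mapsTo
    have := ContDiffOn.continuousOn hs
    exact this.comp_continuous (by fun_prop : Continuous fun t : ℝ => (t + s, x))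
      fun t => mem_dom hx
  have hBcc : Continuous B := continuous_pi fun a => continuous_pi fun c => hBc a c
  obtain ⟨K, hK⟩ := (isCompact_Icc (a := -|s|) (b := |s|)).exists_bound_of_continuousOn
    hBcc.continuousOn
  have g := gronwall_symm (T := |s|) (δ := 0) (K := 4 * |K|) (c := 0) hf (by
      have : f 0 = 0 := by
        ext a
        simpa [f, Matrix.mulVec, dotProduct] using congrFun hJ a
      rw [this, norm_zero]) (by positivity) le_rfl (fun t ht => by
        rw [add_zero]
        refine (pi_norm_le_iff_of_nonneg (by positivity)).2 fun a => ?_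
        calc ‖f' t a‖ ≤ ∑ c, ‖B t a c * f t c‖ := norm_sum_le _ _
          _ ≤ ∑ _c : Fin 4, |K| * ‖f t‖ := by
              refine Finset.sum_le_sum fun c _ => ?_
              rw [norm_mul]
              refine mul_le_mul ?_ (norm_le_pi_norm (f t) c) (norm_nonneg _) (abs_nonneg _)
              exact (((norm_le_pi_norm (B t a) c).trans (norm_le_pi_norm (B t) a)).trans
                (hK t (abs_le.1 ht))).trans (le_abs_self K)
          _ = 4 * |K| * ‖f t‖ := by simp [mul_assoc]) (-s) (by rw [abs_neg])
  rw [gronwallBound_ε0_δ0, norm_le_zero_iff] at g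
  ext a
  have h2 := congrFun g a
  simpa [f, hX.D_zero _ _ hx] using h2

/-- The determinant is continuous in the parameter, never zero, and equal to `1` at the start. -/
lemma IsEvolution.det_pos (hξ : IsSuperdilatationFamily ξ T₁ T₂) (hX : IsEvolution ξ X)
    (s : ℝ) {x : Pt} (hx : x ∈ M) :
    0 < (Matrix.of fun a b : Fin 4 => D (some b) (fun s x => X s x a) s x).det := by
  set d : ℝ → ℝ := fun s => (Matrix.of fun a b : Fin 4 => D (some b) (fun s x => X s x a) s x).det
  have hd : Continuous d := by
    refine Continuous.matrix_det (continuous_pi fun a => continuous_pi fun b => ?_)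
    exact (ContDiffOn.continuousOn ((hX.smooth_comp a).D (some b))).comp_continuous
      (by fun_prop : Continuous fun t : ℝ => (t, x)) fun t => mem_dom hx
  have h0 : d 0 = 1 := by
    have : (Matrix.of fun a b : Fin 4 => D (some b) (fun s x => X s x a) 0 x) = 1 := by
      ext a b
      simp [hX.D_zero a b hx, Matrix.one_apply, eq_comm]
    simp [d, this]
  by_contra! hneg
  have : (0 : ℝ) ∈ d '' univ := by
    refine isPreconnected_univ.intermediate_value (mem_univ s) (mem_univ 0) hd.continuousOn
      ⟨hneg, by rw [h0]; exact zero_le_one⟩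
  obtain ⟨t, -, ht⟩ := this
  exact hX.det_ne_zero hξ t hx ht

lemma IsEvolution.horizonMap (hξ : IsSuperdilatationFamily ξ T₁ T₂) (hX : IsEvolution ξ X) :
    HorizonMap X (prim T₁) (primA T₁ T₂) where
  smoothF := contDiff_prim hξ.smooth₁
  smoothA := contDiff_prim (contDiff_velA hξ)
  omap := hX.omap hξ
  comp_τ := hX.comp_τ hξ
  comp_ρ := hX.comp_ρ hξ
  comp_y := hX.comp_yz hξ 2 (Or.inl rfl)
  comp_z := hX.comp_yz hξ 3 (Or.inr rfl)
  det_pos := fun s _ hx => hX.det_pos hξ s hx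

end Rindler
end

noncomputable section

namespace Rindler

/-! ## Leading coefficients -/

/-- A function of `(s, τ, y, z)` as a family. -/
def lf (φ : ℝ → ℝ → ℝ → ℝ → ℝ) : Fam := fun s x => φ s (x 0) (x 2) (x 3)

/-- `f = ρ^k φ(s, τ, y, z) + O(ρ^{k+1})`. -/
structure Lead (k : ℤ) (f : Fam) (φ : ℝ → ℝ → ℝ → ℝ → ℝ) : Prop where
  coeff : IsO 0 (lf φ)
  sub : IsO (k + 1) fun s x => f s x - x 1 ^ k * lf φ s x

lemma Lead.congr {k : ℤ} {f f' : Fam} {φ φ' : ℝ → ℝ → ℝ → ℝ → ℝ} (h : Lead k f φ)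
    (hf : ∀ s, ∀ x ∈ M, f s x = f' s x) (hφ : ∀ s τ y z, φ s τ y z = φ' s τ y z) :
    Lead k f' φ' := by
  obtain rfl : φ = φ' := by
    ext s τ y z
    exact hφ s τ y z
  exact ⟨h.coeff, h.sub.congr fun s x hx => by rw [hf s x hx]⟩

lemma Lead.coeff_rho {k : ℤ} {f : Fam} {φ : ℝ → ℝ → ℝ → ℝ → ℝ} (h : Lead k f φ) :
    IsO k fun s x => x 1 ^ k * lf φ s x := (IsO.rho_zpow k).mul h.coeff (by simp)

lemma Lead.isO {k : ℤ} {f : Fam} {φ : ℝ → ℝ → ℝ → ℝ → ℝ} (h : Lead k f φ) : IsO k f :=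
  ((h.sub.mono (by omega)).add h.coeff_rho).congr fun s x _ => by ring

lemma Lead.of_isO {k l : ℤ} {f : Fam} (h : IsO l f) (hl : k + 1 ≤ l) :
    Lead k f fun _ _ _ _ => 0 :=
  ⟨IsO.zero 0, (h.mono hl).congr fun s x _ => by simp [lf]⟩

lemma Lead.add {k : ℤ} {f g : Fam} {φ ψ : ℝ → ℝ → ℝ → ℝ → ℝ} (hf : Lead k f φ)
    (hg : Lead k g ψ) : Lead k (fun s x => f s x + g s x)
      fun s τ y z => φ s τ y z + ψ s τ y z :=
  ⟨hf.coeff.add hg.coeff, (hf.sub.add hg.sub).congr fun s x _ => by simp only [lf]; ring⟩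

lemma Lead.sub' {k : ℤ} {f g : Fam} {φ ψ : ℝ → ℝ → ℝ → ℝ → ℝ} (hf : Lead k f φ)
    (hg : Lead k g ψ) : Lead k (fun s x => f s x - g s x)
      fun s τ y z => φ s τ y z - ψ s τ y z :=
  ⟨hf.coeff.sub hg.coeff, (hf.sub.sub hg.sub).congr fun s x _ => by simp only [lf]; ring⟩

lemma Lead.mul {k l m : ℤ} {f g : Fam} {φ ψ : ℝ → ℝ → ℝ → ℝ → ℝ} (hf : Lead k f φ)
    (hg : Lead l g ψ) (hm : m = k + l) : Lead m (fun s x => f s x * g s x)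
      fun s τ y z => φ s τ y z * ψ s τ y z := by
  subst hm
  refine ⟨hf.coeff.mul hg.coeff (by simp), ((hf.sub.mul hg.isO (m := k + l + 1) (by omega)).add
    (hf.coeff_rho.mul hg.sub (by omega))).congr fun s x hx => ?_⟩
  rw [zpow_add₀ (rho_ne hx)]
  simp only [lf]
  ring

lemma Lead.const (c : ℝ) : Lead 0 (fun _ _ => c) fun _ _ _ _ => c :=
  ⟨IsO.const c, (IsO.zero _).congr fun s x _ => by simp [lf]⟩

lemma Lead.const_mul {k : ℤ} {f : Fam} {φ : ℝ → ℝ → ℝ → ℝ → ℝ} (c : ℝ) (hf : Lead k f φ) :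
    Lead k (fun s x => c * f s x) fun s τ y z => c * φ s τ y z :=
  (Lead.const c).mul hf (by simp)

lemma Lead.sum_univ {k : ℤ} {ι : Type*} [Fintype ι] {f : ι → Fam}
    {φ : ι → ℝ → ℝ → ℝ → ℝ → ℝ} (h : ∀ i, Lead k (f i) (φ i)) :
    Lead k (fun s x => ∑ i, f i s x) fun s τ y z => ∑ i, φ i s τ y z := by
  refine ⟨IsO.sum Finset.univ fun i _ => (h i).coeff,
    (IsO.sum Finset.univ fun i _ => (h i).sub).congr fun s x _ => ?_⟩
  simp only [lf, Finset.sum_sub_distrib, Finset.mul_sum]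

/-- The indices of `τ` and `ρ`. -/
def nd : Fin 2 → Fin 4 := ![0, 1]

/-- The extra order carried by an upper transverse index. -/
def vt : Fin 4 → ℤ := ![0, 0, 2, 2]

lemma vt_nd (i : Fin 2) : vt (nd i) = 0 := by fin_cases i <;> rfl

lemma vt_bounds (a : Fin 4) : 0 ≤ vt a ∧ vt a ≤ 2 := by
  fin_cases a <;> simp [vt]

lemma wt_of_vt {a : Fin 4} (h : vt a = 2) : wt a = 0 := by
  fin_cases a
  · simp [vt] at h
  · simp [vt] at h
  · rfl
  · rfl

/-- Transverse terms drop out of the leading coefficient of a contraction. -/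
lemma Lead.sum {k : ℤ} {f : Fin 4 → Fam} {φ : Fin 2 → ℝ → ℝ → ℝ → ℝ → ℝ}
    (h : ∀ i, Lead k (f (nd i)) (φ i)) (h' : ∀ a, vt a = 2 → IsO (k + 1) (f a)) :
    Lead k (fun s x => ∑ a, f a s x) fun s τ y z => ∑ i, φ i s τ y z := by
  refine ((((h 0).add (h 1)).add (Lead.of_isO (h' 2 rfl) le_rfl)).add
    (Lead.of_isO (h' 3 rfl) le_rfl)).congr (fun s x _ => ?_) fun s τ y z => ?_
  · rw [Fin.sum_univ_four]; rfl
  · rw [Fin.sum_univ_two]; ring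

lemma D_some_eq_of_hasDerivAt {h : Fam} (hh : Smooth h) (a : Fin 4) {s : ℝ} {x : Pt} (hx : x ∈ M)
    {c : ℝ} (hd : HasDerivAt (fun t => h s (Function.update x a t)) c (x a)) :
    D (some a) h s x = c := by
  have h1 := hh.hasFDerivAt_slice s hx
  have h2 := hasDerivAt_update x a (x a)
  have h3 : HasFDerivAt (h s) ((fderiv ℝ (fun p : ℝ × Pt => h p.1 p.2) (s, x)).comp
      (ContinuousLinearMap.inr ℝ ℝ Pt)) (Function.update x a (x a)) := by
    rwa [Function.update_eq_self]
  exact (h3.comp_hasDerivAt (x a) h2).unique hd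

lemma D_lf_one {φ : ℝ → ℝ → ℝ → ℝ → ℝ} (h : Smooth (lf φ)) (s : ℝ) {x : Pt} (hx : x ∈ M) :
    D (some 1) (lf φ) s x = 0 :=
  D_some_eq_of_hasDerivAt h 1 hx (by simpa [lf] using hasDerivAt_const _ _)

lemma D_lf_zero {φ φ' : ℝ → ℝ → ℝ → ℝ → ℝ} (h : Smooth (lf φ))
    (hφ : ∀ s τ y z, HasDerivAt (fun τ => φ s τ y z) (φ' s τ y z) τ) (s : ℝ) {x : Pt}
    (hx : x ∈ M) : D (some 0) (lf φ) s x = lf φ' s x :=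
  D_some_eq_of_hasDerivAt h 0 hx (by simpa [lf] using hφ s (x 0) (x 2) (x 3))

lemma D_rho_mul {φ : ℝ → ℝ → ℝ → ℝ → ℝ} (h : Smooth (lf φ)) (k : ℤ) (i : Option (Fin 4)) (s : ℝ)
    {x : Pt} (hx : x ∈ M) : D i (fun s x => x 1 ^ k * lf φ s x) s x =
      x 1 ^ k * D i (lf φ) s x + k * x 1 ^ (k - 1) * (dir i).2 1 * lf φ s x := by
  rw [D_mul (IsO.rho_zpow k).smooth h i s hx, D_rho_zpow k i s hx]

lemma Lead.D_tangent {k : ℤ} {f : Fam} {φ φ' : ℝ → ℝ → ℝ → ℝ → ℝ} (hf : Lead k f φ)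
    (i : Option (Fin 4)) (hi : (dir i).2 1 = 0) (hw : wo i = 0)
    (hφ : ∀ s, ∀ x ∈ M, D i (lf φ) s x = lf φ' s x) : Lead k (D i f) φ' := by
  refine ⟨((hf.coeff.D i).mono (by omega)).congr hφ,
    ((hf.sub.D i).mono (by omega)).congr fun s x hx => ?_⟩
  rw [D_sub hf.isO.smooth hf.coeff_rho.smooth i s hx, D_rho_mul hf.coeff.smooth k i s hx, hi,
    hφ s x hx]
  ring

lemma Lead.D_zero {k : ℤ} {f : Fam} {φ φ' : ℝ → ℝ → ℝ → ℝ → ℝ} (hf : Lead k f φ)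
    (hφ : ∀ s τ y z, HasDerivAt (fun τ => φ s τ y z) (φ' s τ y z) τ) :
    Lead k (D (some 0) f) φ' :=
  hf.D_tangent (some 0) (by simp [dir]) rfl fun s _ hx => D_lf_zero hf.coeff.smooth hφ s hx

lemma Lead.D_none {k : ℤ} {f : Fam} {φ φ' : ℝ → ℝ → ℝ → ℝ → ℝ} (hf : Lead k f φ)
    (hφ : ∀ s τ y z, HasDerivAt (fun s => φ s τ y z) (φ' s τ y z) s) :
    Lead k (D none f) φ' :=
  hf.D_tangent none (by simp [dir]) rfl fun s x hx =>
    D_none_eq_of_hasDerivAt hf.coeff.smooth hx (hφ s (x 0) (x 2) (x 3))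

/-- For `k = 0` the new coefficient vanishes, so the `ρ`-derivative of a bounded quantity is one
order better than the general count; the integrability condition depends on this. -/
lemma Lead.D_one {k : ℤ} {f : Fam} {φ : ℝ → ℝ → ℝ → ℝ → ℝ} (hf : Lead k f φ) :
    Lead (k - 1) (D (some 1) f) fun s τ y z => k * φ s τ y z := by
  refine ⟨hf.coeff.const_mul k, ((hf.sub.D (some 1)).mono (by simp [wo, wt])).congr fun s x hx => ?_⟩
  rw [D_sub hf.isO.smooth hf.coeff_rho.smooth _ s hx, D_rho_mul hf.coeff.smooth k _ s hx,
    D_lf_one hf.coeff.smooth s hx, dir_some_apply]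
  simp only [lf, if_true]
  ring

lemma Lead.D_nd {k : ℤ} {f : Fam} {φ φ' : ℝ → ℝ → ℝ → ℝ → ℝ} (hf : Lead k f φ)
    (hφ : ∀ s τ y z, HasDerivAt (fun τ => φ s τ y z) (φ' s τ y z) τ) (i : Fin 2) :
    Lead (k - wt (nd i)) (D (some (nd i)) f)
      fun s τ y z => (![φ' s τ y z, k * φ s τ y z] : Fin 2 → ℝ) i := by
  fin_cases i
  · simpa [nd, wt] using hf.D_zero hφ
  · simpa [nd, wt] using hf.D_one

lemma Lead.of_contDiff_rho {k : ℤ} {f : Fam} {φ : ℝ → ℝ → ℝ → ℝ → ℝ}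
    (hφ : ContDiff ℝ ∞ fun p : ℝ × Pt => lf φ p.1 p.2)
    (h : IsO (k + 1) fun s x => f s x - x 1 ^ k * lf φ s x) : Lead k f φ :=
  ⟨IsO.of_contDiff hφ, h⟩

/-- On a compact box the positive continuous coefficient has a minimum `c > 0`, and close to the
horizon the remainder takes away at most half of it. -/
lemma Lead.bdd_inv {k : ℤ} {f : Fam} {φ : ℝ → ℝ → ℝ → ℝ → ℝ} (h : Lead k f φ)
    (hc : Continuous fun p : ℝ × Pt => lf φ p.1 p.2) (hpos : ∀ s x, 0 < lf φ s x) :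
    Bdd (-k) fun s x => (f s x)⁻¹ := by
  intro R
  by_cases hR : 0 ≤ R
  swap
  · exact ⟨0, 1, one_pos, fun s x _ _ hs => absurd ((abs_nonneg s).trans hs) hR⟩
  have hK : IsCompact (Icc (-R) R ×ˢ (Set.pi univ fun _ : Fin 4 => Icc (-(R + 1)) (R + 1))) :=
    isCompact_Icc.prod (isCompact_univ_pi fun _ => isCompact_Icc)
  have hne : (Icc (-R) R ×ˢ (Set.pi univ fun _ : Fin 4 => Icc (-(R + 1)) (R + 1))).Nonempty :=
    ⟨(0, fun _ => 0), ⟨by linarith, hR⟩, fun i _ => ⟨by linarith, by linarith⟩⟩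
  obtain ⟨p, -, hp⟩ := hK.exists_isMinOn hne hc.continuousOn
  set c := lf φ p.1 p.2
  have hc0 : 0 < c := hpos _ _
  obtain ⟨C, ε, hC, hε, b⟩ := h.sub.bdd.exists_nonneg R
  -- The bound `c / (2(C + 1))` on `ρ` gives `C ρ ≤ c / 2`, and hence `f ≥ ρ^k c / 2`.
  refine ⟨2 / c, min (min ε 1) (c / (2 * (C + 1))), by positivity,
    fun s x hx h1 h2 h3 h4 h5 => ?_⟩
  have hx' : 0 < x 1 := hx
  simp only [lt_min_iff] at h1
  obtain ⟨⟨e1, e2⟩, e3⟩ := h1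
  have hmem : (s, x) ∈ Icc (-R) R ×ˢ (Set.pi univ fun _ : Fin 4 => Icc (-(R + 1)) (R + 1)) := by
    refine ⟨abs_le.1 h2, fun i _ => ?_⟩
    rw [abs_le] at h2 h3 h4 h5
    fin_cases i <;> simp only [Fin.zero_eta, Fin.mk_one, Fin.reduceFinMk, mem_Icc] <;>
      constructor <;> linarith
  have hφ : c ≤ lf φ s x := hp hmem
  have hb := b s x hx e1 h2 h3 h4 h5
  have hpk : 0 < x 1 ^ k := zpow_pos hx' k
  rw [zpow_add₀ hx'.ne', zpow_one] at hb
  have hCx : C * x 1 ≤ c / 2 := by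
    have := (lt_div_iff₀ (by positivity : 0 < 2 * (C + 1))).1 e3
    nlinarith
  have h6 : x 1 ^ k * (c / 2) ≤ f s x := by
    have h7 := (abs_le.1 hb).1
    have h8 : x 1 ^ k * c ≤ x 1 ^ k * lf φ s x := mul_le_mul_of_nonneg_left hφ hpk.le
    have h9 : x 1 ^ k * (C * x 1) ≤ x 1 ^ k * (c / 2) := mul_le_mul_of_nonneg_left hCx hpk.le
    nlinarith
  have h10 : 0 < x 1 ^ k * (c / 2) := by positivity
  rw [abs_of_pos (inv_pos.2 (h10.trans_le h6))]
  refine (inv_anti₀ h10 h6).trans (le_of_eq ?_)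
  rw [zpow_neg]
  field_simp

/-! ## Determinants and inverses -/

lemma IsO.prod {ι : Type*} {k : ι → ℤ} {f : ι → Fam} (S : Finset ι) (h : ∀ i, IsO (k i) (f i)) :
    IsO (∑ i ∈ S, k i) fun s x => ∏ i ∈ S, f i s x := by
  classical
  induction S using Finset.induction_on with
  | empty => simpa using IsO.const 1
  | insert a S ha ih =>
    simp_rw [Finset.prod_insert ha, Finset.sum_insert ha]
    exact (h a).mul ih le_rfl

lemma IsO.prod_sub {ι : Type*} {k : ι → ℤ} {f f' : ι → Fam} (S : Finset ι)
    (h : ∀ i, IsO (k i) (f i)) (h' : ∀ i, IsO (k i) (f' i))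
    (hd : ∀ i, IsO (k i + 1) fun s x => f i s x - f' i s x) :
    IsO (∑ i ∈ S, k i + 1) fun s x => ∏ i ∈ S, f i s x - ∏ i ∈ S, f' i s x := by
  classical
  induction S using Finset.induction_on with
  | empty => simpa using IsO.zero 1
  | insert a S ha ih =>
    simp_rw [Finset.prod_insert ha, Finset.sum_insert ha]
    exact (((h a).mul ih (m := k a + ∑ i ∈ S, k i + 1) (by omega)).add
      ((hd a).mul (IsO.prod S h') (by omega))).congr fun s x _ => by ring

lemma sum_perm_weights (U V : Fin 4 → ℤ) (σ : Equiv.Perm (Fin 4)) :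
    ∑ i, (U (σ i) + V i) = ∑ i, U i + ∑ i, V i := by
  rw [Finset.sum_add_distrib, Equiv.sum_comp σ U]

/-- When the orders of the entries split into a row weight and a column weight, all permutations
contribute at the same total order. -/
lemma IsO.det {U V : Fin 4 → ℤ} {m : ℝ → Pt → Matrix (Fin 4) (Fin 4) ℝ}
    (h : ∀ a b, IsO (U a + V b) fun s x => m s x a b) :
    IsO (∑ i, U i + ∑ i, V i) fun s x => (m s x).det := by
  simp_rw [Matrix.det_apply']
  refine IsO.sum _ fun σ _ => IsO.const_mul _ ?_
  rw [← sum_perm_weights U V σ]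
  exact IsO.prod _ fun i => h (σ i) i

lemma IsO.det_sub {U V : Fin 4 → ℤ} {m m' : ℝ → Pt → Matrix (Fin 4) (Fin 4) ℝ}
    (h : ∀ a b, IsO (U a + V b) fun s x => m s x a b)
    (h' : ∀ a b, IsO (U a + V b) fun s x => m' s x a b)
    (hd : ∀ a b, IsO (U a + V b + 1) fun s x => m s x a b - m' s x a b) :
    IsO (∑ i, U i + ∑ i, V i + 1) fun s x => (m s x).det - (m' s x).det := by
  simp_rw [Matrix.det_apply', ← Finset.sum_sub_distrib, ← mul_sub]
  refine IsO.sum _ fun σ _ => IsO.const_mul _ ?_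
  rw [← sum_perm_weights U V σ]
  exact IsO.prod_sub _ (fun i => h (σ i) i) (fun i => h' (σ i) i) fun i => hd (σ i) i

lemma IsO.adjugate {U V : Fin 4 → ℤ} {m : ℝ → Pt → Matrix (Fin 4) (Fin 4) ℝ}
    (h : ∀ a b, IsO (U a + V b) fun s x => m s x a b) (i j : Fin 4) :
    IsO (∑ a, U a + ∑ a, V a - U j - V i) fun s x => (m s x).adjugate i j := by
  simp_rw [Matrix.adjugate_apply]
  -- Row `j` of the cofactor matrix is a unit vector with its `1` in column `i`; the row weight `-V
  -- i` gives that entry order zero.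
  have := IsO.det (U := Function.update U j (-V i)) (V := V)
    (m := fun s x => (m s x).updateRow j (Pi.single i 1)) fun a b => by
      by_cases ha : a = j
      · subst ha
        simp only [Function.update_self, Matrix.updateRow_self]
        by_cases hb : b = i
        · subst hb
          simpa using IsO.const 1
        · simpa [Pi.single_apply, hb] using IsO.zero _
      · simpa [Function.update_of_ne ha, Matrix.updateRow_ne ha] using h a b
  rw [Finset.sum_update_of_mem (Finset.mem_univ j)] at this
  refine this.mono ?_
  have e := Finset.sum_sdiff (f := U) (Finset.subset_univ {j})
  rw [Finset.sum_singleton] at e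
  omega

lemma IsO.matrix_inv {U V : Fin 4 → ℤ} {m : ℝ → Pt → Matrix (Fin 4) (Fin 4) ℝ}
    (h : ∀ a b, IsO (U a + V b) fun s x => m s x a b)
    (hd : IsO (-(∑ a, U a + ∑ a, V a)) fun s x => ((m s x).det)⁻¹) (i j : Fin 4) :
    IsO (-U j - V i) fun s x => (m s x)⁻¹ i j := by
  refine (hd.mul (IsO.adjugate h i j) (by omega)).congr fun s x _ => ?_
  rw [Matrix.inv_def, Ring.inverse_eq_inv', Matrix.smul_apply, smul_eq_mul]

end Rindler
end

noncomputable section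

namespace Rindler

/-! ## The leading two-dimensional geometry -/

/-- The parameters of the leading geometry at a point: `a = e^F` and `E = e^{A τ}`. -/
structure HData where
  κ : ℝ
  a : ℝ
  A : ℝ
  E : ℝ
  τ : ℝ

namespace HData

variable (p : HData) (t₁ t₂ : ℝ)

/-- The metric in the coordinates `(τ, log ρ)`, up to the conformal factor `ρ² E²`. -/
def c : Fin 2 → Fin 2 → ℝ := ![![p.A ^ 2 - p.κ ^ 2 * p.a ^ 2, p.A], ![p.A, 1]]

/-- Leading coefficient of the metric. -/
def g (i j : Fin 2) : ℝ := p.E ^ 2 * p.c i j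

/-- Leading coefficient of the inverse metric. -/
def gi (i j : Fin 2) : ℝ :=
  (![![-1, p.A], ![p.A, p.κ ^ 2 * p.a ^ 2 - p.A ^ 2]] : Fin 2 → Fin 2 → ℝ) i j /
    (p.κ ^ 2 * p.a ^ 2 * p.E ^ 2)

/-- Leading coefficient of the derivatives of the metric. -/
def dg (k i j : Fin 2) : ℝ :=
  (![p.E ^ 2 * (2 * p.A * p.c i j), ((2 - wt (nd i) - wt (nd j) : ℤ) : ℝ) * p.g i j] :
    Fin 2 → ℝ) k

/-- Leading coefficient of the Christoffel symbols. -/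
def Γ (i j k : Fin 2) : ℝ :=
  1 / 2 * ∑ l, p.gi i l * (p.dg j l k + p.dg k l j - p.dg l j k)

/-- Leading coefficient of a vector field of the algebra. -/
def xi (i : Fin 2) : ℝ := (![p.τ * t₁, p.τ * t₂] : Fin 2 → ℝ) i

/-- Leading coefficient of its derivatives. -/
def dxi (k i : Fin 2) : ℝ :=
  (![(![t₁, t₂] : Fin 2 → ℝ) i, ((wt (nd i) : ℤ) : ℝ) * p.xi t₁ t₂ i] : Fin 2 → ℝ) k

/-- Leading coefficient of `∇_i ξ^j`. -/
def cov (i j : Fin 2) : ℝ := p.dxi t₁ t₂ i j + ∑ k, p.Γ j i k * p.xi t₁ t₂ k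

/-- Leading coefficient of `∇^i ξ^j`. -/
def covUp (i j : Fin 2) : ℝ := ∑ k, p.gi i k * p.cov t₁ t₂ k j

/-- The inhomogeneous part of the variation of `c`. -/
def e : Fin 2 → Fin 2 → ℝ :=
  ![![2 * (p.c 0 0 * t₁ + p.c 0 1 * t₂), p.c 0 1 * t₁ + p.c 1 1 * t₂],
    ![p.c 0 1 * t₁ + p.c 1 1 * t₂, 0]]

/-- Leading coefficient of a variation of the metric. -/
def h (i j : Fin 2) : ℝ :=
  p.E ^ 2 * (2 * (p.A * t₁ + t₂) * p.τ * p.c i j + p.e t₁ t₂ i j)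

/-- Leading coefficient of its derivatives. -/
def dh (k i j : Fin 2) : ℝ :=
  (![2 * p.A * p.h t₁ t₂ i j + p.E ^ 2 * (2 * (p.A * t₁ + t₂) * p.c i j),
    ((2 - wt (nd i) - wt (nd j) : ℤ) : ℝ) * p.h t₁ t₂ i j] : Fin 2 → ℝ) k

/-- Leading coefficient of `∇_k h_{ij}`. -/
def covT (k i j : Fin 2) : ℝ :=
  p.dh t₁ t₂ k i j - ∑ l, p.Γ l k i * p.h t₁ t₂ l j - ∑ l, p.Γ l k j * p.h t₁ t₂ i l

/-- Leading coefficient of the trace. -/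
def tr : ℝ := ∑ i, ∑ j, p.gi i j * p.h t₁ t₂ i j

/-- Leading coefficient of `h^{mn}`. -/
def raiseh (m n : Fin 2) : ℝ := ∑ i, ∑ j, p.gi m i * p.gi n j * p.h t₁ t₂ i j

/-- Leading coefficient of `∇^m h^α_α`. -/
def gradTr (m : Fin 2) : ℝ := ∑ k, ∑ i, ∑ j, p.gi m k * p.gi i j * p.covT t₁ t₂ k i j

/-- Leading coefficient of `∇_α h^{nα}`. -/
def divh (n : Fin 2) : ℝ := ∑ i, ∑ j, ∑ k, p.gi n i * p.gi j k * p.covT t₁ t₂ k i j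

/-- Leading coefficient of `(∇^m h^{nα}) ξ_α`. -/
def gradC (T₁ T₂ : ℝ) (m n : Fin 2) : ℝ :=
  ∑ k, ∑ i, ∑ j, p.gi m k * p.gi n i * p.covT t₁ t₂ k i j * p.xi T₁ T₂ j

end HData

/-- The leading geometry determined by the functions `F, A` of `(s, y, z)`. -/
def point (κ : ℝ) (F A : ℝ → ℝ → ℝ → ℝ) (s τ y z : ℝ) : HData :=
  ⟨κ, Real.exp (F s y z), A s y z, Real.exp (A s y z * τ), τ⟩

/-- The transverse part of the flat metric. -/
def kron (a b : Fin 4) : ℝ := if a = b ∧ vt a = 2 then 1 else 0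

/-- A family of metrics with the asymptotic form of the pullback of the Rindler metric. -/
structure HorizonMetric (κ : ℝ) (g : ℝ → Tensor2) (F A : ℝ → ℝ → ℝ → ℝ) : Prop where
  κ_pos : 0 < κ
  smoothF : ContDiff ℝ ∞ fun p : ℝ × ℝ × ℝ => F p.1 p.2.1 p.2.2
  smoothA : ContDiff ℝ ∞ fun p : ℝ × ℝ × ℝ => A p.1 p.2.1 p.2.2
  symm : ∀ s x a b, g s x a b = g s x b a
  order : ∀ a b, IsO (2 - wt a - wt b) fun s x => g s x a b - kron a b
  lead : ∀ i j, Lead (2 - wt (nd i) - wt (nd j)) (fun s x => g s x (nd i) (nd j))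
    fun s τ y z => (point κ F A s τ y z).g i j
  dens : Lead 1 (fun s x => sqrtNegDet (g s) x)
    fun s τ y z => κ * Real.exp (F s y z) * Real.exp (A s y z * τ) ^ 2
  det_ne : ∀ s, ∀ x ∈ M, (g s x).det ≠ 0
  det_inv : IsO (-2) fun s x => ((g s x).det)⁻¹

/-- A family of vector fields with leading part `(τ t₁, τ ρ t₂, 0, 0)`. -/
structure HorizonVec (ξ : ℝ → VField) (t₁ t₂ : ℝ → ℝ → ℝ → ℝ) : Prop where
  order : ∀ a, IsO (vt a + wt a) fun s x => ξ s x a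
  lead : ∀ i, Lead (wt (nd i)) (fun s x => ξ s x (nd i))
    fun s τ y z => (![τ * t₁ s y z, τ * t₂ s y z] : Fin 2 → ℝ) i

/-- A family of variations of the metric with the leading part of a Lie derivative. -/
structure HorizonVar (κ : ℝ) (h : ℝ → Tensor2) (F A t₁ t₂ : ℝ → ℝ → ℝ → ℝ) : Prop where
  order : ∀ a b, IsO (2 - wt a - wt b) fun s x => h s x a b
  lead : ∀ i j, Lead (2 - wt (nd i) - wt (nd j)) (fun s x => h s x (nd i) (nd j))
    fun s τ y z => (point κ F A s τ y z).h (t₁ s y z) (t₂ s y z) i j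

variable {κ : ℝ} {g h : ℝ → Tensor2} {F A t₁ t₂ T₁ T₂ : ℝ → ℝ → ℝ → ℝ} {ξ : ℝ → VField}

/-! ### Orders and leading terms of the metric and of its inverse -/

namespace HorizonMetric

lemma order_g (H : HorizonMetric κ g F A) (a b : Fin 4) :
    IsO (2 - min (vt a) (vt b) - wt a - wt b) fun s x => g s x a b := by
  have h1 := H.order a b
  have h2 : IsO (2 - min (vt a) (vt b) - wt a - wt b) fun _ _ => kron a b := by
    unfold kron
    split_ifs with hk
    · obtain ⟨rfl, hk⟩ := hk
      rw [wt_of_vt hk, hk]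
      simpa using IsO.const 1
    · exact IsO.zero _
  have hb := vt_bounds a
  have hb' := vt_bounds b
  exact ((h1.mono (by omega)).add h2).congr fun s x _ => by ring

lemma smooth_g (H : HorizonMetric κ g F A) (a b : Fin 4) : Smooth fun s x => g s x a b :=
  (H.order_g a b).smooth

lemma order_D (H : HorizonMetric κ g F A) (i : Option (Fin 4)) (a b : Fin 4) :
    IsO (2 - wt a - wt b - wo i) (D i fun s x => g s x a b) := by
  refine ((H.order a b).D i).congr fun s x hx => ?_
  rw [D_sub (H.smooth_g a b) (IsO.const (kron a b)).smooth i s hx, D_const, sub_zero]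

lemma isUnit_det (H : HorizonMetric κ g F A) (s : ℝ) {x : Pt} (hx : x ∈ M) :
    IsUnit (g s x).det := isUnit_iff_ne_zero.2 (H.det_ne s x hx)

lemma ginv_symm (H : HorizonMetric κ g F A) (s : ℝ) (x : Pt) (a b : Fin 4) :
    ginv (g s) x a b = ginv (g s) x b a := by
  have : (g s x).transpose = g s x := by
    ext a b
    exact H.symm s x b a
  have h2 := Matrix.transpose_nonsing_inv (g s x)
  rw [this] at h2
  exact congrFun (congrFun h2 b) a

/-- Upper transverse indices improve the order by two, which is what makes transverse terms
subleading in contractions. Cramer's rule with split weights sees only one of the two indices;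
symmetry of the inverse supplies the other. -/
lemma order_ginv (H : HorizonMetric κ g F A) (a b : Fin 4) :
    IsO (max (vt a) (vt b) - 2 + wt a + wt b) fun s x => ginv (g s) x a b := by
  have key : ∀ a b, IsO (vt b - 2 + wt a + wt b) fun s x => ginv (g s) x a b := by
    intro a b
    refine (IsO.matrix_inv (U := fun a => 2 - vt a - wt a) (V := fun b => -wt b) (m := g)
      (fun a b => (H.order_g a b).mono ?_) (H.det_inv.mono ?_) a b).mono (by omega)
    · have := min_le_left (vt a) (vt b)
      omega
    · simp [Fin.sum_univ_four, vt, wt]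
  rcases max_choice (vt a) (vt b) with hm | hm
  · rw [hm]
    refine ((key b a).mono (by omega)).congr fun s x _ => H.ginv_symm s x b a
  · rw [hm]
    exact key a b

lemma hasDerivAt_E (A : ℝ → ℝ → ℝ → ℝ) (s τ y z : ℝ) :
    HasDerivAt (fun τ => Real.exp (A s y z * τ) ^ 2)
      (Real.exp (A s y z * τ) ^ 2 * (2 * A s y z)) τ := by
  have h1 : HasDerivAt (fun τ => A s y z * τ) (A s y z) τ := by
    simpa using (hasDerivAt_id τ).const_mul (A s y z)
  refine (h1.exp.pow 2).congr_deriv ?_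
  simp only [Nat.cast_ofNat, Nat.add_one_sub_one, pow_one]
  ring

lemma lead_D (H : HorizonMetric κ g F A) (k i j : Fin 2) :
    Lead (2 - wt (nd i) - wt (nd j) - wt (nd k)) (D (some (nd k)) fun s x => g s x (nd i) (nd j))
      fun s τ y z => (point κ F A s τ y z).dg k i j := by
  refine (H.lead i j).D_nd (φ' := fun s τ y z =>
    Real.exp (A s y z * τ) ^ 2 * (2 * A s y z * (point κ F A s τ y z).c i j)) (fun s τ y z => ?_) k
  refine ((hasDerivAt_E A s τ y z).mul_const ((point κ F A s τ y z).c i j)).congr_deriv ?_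
  ring

lemma E_ne (s τ y z : ℝ) : (point κ F A s τ y z).E ≠ 0 := (Real.exp_pos _).ne'
lemma a_ne (s τ y z : ℝ) : (point κ F A s τ y z).a ≠ 0 := (Real.exp_pos _).ne'

lemma κ_ne (H : HorizonMetric κ g F A) (s τ y z : ℝ) : (point κ F A s τ y z).κ ≠ 0 :=
  H.κ_pos.ne'

end HorizonMetric

lemma HData.g_mul_gi (p : HData) (hκ : p.κ ≠ 0) (ha : p.a ≠ 0) (hE : p.E ≠ 0) (i j : Fin 2) :
    ∑ k, p.g i k * p.gi k j = if i = j then 1 else 0 := by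
  fin_cases i <;> fin_cases j <;>
    simp [Fin.sum_univ_two, HData.g, HData.gi, HData.c] <;> field_simp <;> ring

lemma contDiff_comp_yz (hA : ContDiff ℝ ∞ fun p : ℝ × ℝ × ℝ => A p.1 p.2.1 p.2.2) :
    ContDiff ℝ ∞ fun p : ℝ × Pt => A p.1 (p.2 2) (p.2 3) := contDiff_lift hA

namespace HorizonMetric

lemma coeff_gi (H : HorizonMetric κ g F A) (i j : Fin 2) :
    IsO 0 (lf fun s τ y z => (point κ F A s τ y z).gi i j) := by
  refine IsO.of_contDiff ?_
  have hF := contDiff_comp_yz H.smoothF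
  have hA := contDiff_comp_yz H.smoothA
  have hF' : ContDiff ℝ ∞ fun p : ℝ × Pt => Real.exp (F p.1 (p.2 2) (p.2 3)) :=
    Real.contDiff_exp.comp hF
  have hE : ContDiff ℝ ∞ fun p : ℝ × Pt => Real.exp (A p.1 (p.2 2) (p.2 3) * p.2 0) :=
    Real.contDiff_exp.comp (hA.mul (contDiff_coord 0))
  have hκ := H.κ_pos
  refine ContDiff.div (g := fun p : ℝ × Pt => κ ^ 2 * Real.exp (F p.1 (p.2 2) (p.2 3)) ^ 2 *
    Real.exp (A p.1 (p.2 2) (p.2 3) * p.2 0) ^ 2) ?_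
    ((contDiff_const.mul (hF'.pow 2)).mul (hE.pow 2)) fun p => by positivity
  fin_cases i <;> fin_cases j
  · exact contDiff_const
  · exact hA
  · exact hA
  · have h11 : ContDiff ℝ ∞ fun p : ℝ × Pt => κ ^ 2 * Real.exp (F p.1 (p.2 2) (p.2 3)) ^ 2 -
        A p.1 (p.2 2) (p.2 3) ^ 2 := (contDiff_const.mul (hF'.pow 2)).sub (hA.pow 2)
    exact h11

/-- In the identity `g⁻¹ g = 1` the transverse part of the sum is subleading and `g` may be replaced
by its leading part `G`. Multiplying by the explicit inverse `Gi` of `G` then isolates the leading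
part of `g⁻¹`. -/
lemma lead_ginv (H : HorizonMetric κ g F A) (i j : Fin 2) :
    Lead (-2 + wt (nd i) + wt (nd j)) (fun s x => ginv (g s) x (nd i) (nd j))
      fun s τ y z => (point κ F A s τ y z).gi i j := by
  let G : Fin 2 → Fin 2 → Fam := fun l k s x =>
    x 1 ^ (2 - wt (nd l) - wt (nd k)) * lf (fun s τ y z => (point κ F A s τ y z).g l k) s x
  let Gi : Fin 2 → Fin 2 → Fam := fun l k s x =>
    x 1 ^ (-2 + wt (nd l) + wt (nd k)) * lf (fun s τ y z => (point κ F A s τ y z).gi l k) s x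
  have hGi : ∀ l k, Lead (-2 + wt (nd l) + wt (nd k)) (Gi l k)
      fun s τ y z => (point κ F A s τ y z).gi l k := fun l k =>
    ⟨H.coeff_gi l k, (IsO.zero _).congr fun s x _ => by simp [Gi]⟩
  have hP : ∀ k, Lead (wt (nd i) - wt (nd k)) (fun s x => ∑ l, ginv (g s) x (nd i) (nd l) * G l k s x)
      fun _ _ _ _ => if i = k then 1 else 0 := by
    intro k
    have h1 : Lead (wt (nd i) - wt (nd k)) (fun _ _ => if i = k then (1 : ℝ) else 0)
        fun _ _ _ _ => if i = k then 1 else 0 := by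
      split_ifs with hik
      · subst hik
        simpa using Lead.const 1
      · exact Lead.of_isO (IsO.zero _) le_rfl
    have h2 : IsO (wt (nd i) - wt (nd k) + 1) fun s x =>
        ∑ l, ginv (g s) x (nd i) (nd l) * (g s x (nd l) (nd k) - G l k s x) :=
      IsO.sum _ fun l _ => (H.order_ginv (nd i) (nd l)).mul (H.lead l k).sub (by
        simp only [vt_nd, max_self]; omega)
    have h3 : ∀ b, vt b = 2 → IsO (wt (nd i) - wt (nd k) + 1) fun s x =>
        ginv (g s) x (nd i) b * g s x b (nd k) := fun b hb =>
      (H.order_ginv (nd i) b).mul (H.order_g b (nd k)) (by simp only [vt_nd, hb]; norm_num; omega)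
    refine ((h1.sub' (Lead.of_isO h2 le_rfl)).sub' (Lead.of_isO ((h3 2 rfl).add (h3 3 rfl))
      le_rfl)).congr (fun s x hx => ?_) fun s τ y z => by simp
    have e := congrFun (congrFun (Matrix.nonsing_inv_mul _ (H.isUnit_det s hx)) (nd i)) (nd k)
    rw [Matrix.mul_apply, Fin.sum_univ_four, Matrix.one_apply] at e
    have e2 : (if nd i = nd k then (1 : ℝ) else 0) = if i = k then 1 else 0 := by
      fin_cases i <;> fin_cases k <;> simp [nd]
    rw [e2] at e
    rw [← e, Fin.sum_univ_two, Fin.sum_univ_two]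
    simp only [ginv, nd, Matrix.cons_val_zero, Matrix.cons_val_one]
    ring
  refine (Lead.sum_univ fun k => (hP k).mul (hGi k j) (m := -2 + wt (nd i) + wt (nd j))
    (by omega)).congr (fun s x hx => ?_) fun s τ y z => ?_
  · have e : ∀ l, ∑ k, G l k s x * Gi k j s x = if l = j then 1 else 0 := by
      intro l
      have h4 := HData.g_mul_gi (point κ F A s (x 0) (x 2) (x 3)) (H.κ_ne _ _ _ _)
        (a_ne _ _ _ _) (E_ne _ _ _ _) l j
      have h5 : ∀ k, G l k s x * Gi k j s x = x 1 ^ (wt (nd j) - wt (nd l)) *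
          ((point κ F A s (x 0) (x 2) (x 3)).g l k * (point κ F A s (x 0) (x 2) (x 3)).gi k j) := by
        intro k
        have : x 1 ^ (wt (nd j) - wt (nd l)) =
            x 1 ^ (2 - wt (nd l) - wt (nd k)) * x 1 ^ (-2 + wt (nd k) + wt (nd j)) := by
          rw [← zpow_add₀ (rho_ne hx)]; congr 1; ring
        rw [this]
        simp only [G, Gi, lf]
        ring
      rw [Finset.sum_congr rfl fun k _ => h5 k, ← Finset.mul_sum, h4]
      split_ifs with hlj
      · rw [hlj]; simp
      · simp
    simp only [Finset.sum_mul]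
    rw [Finset.sum_comm]
    simp only [mul_assoc, ← Finset.mul_sum, e]
    simp
  · simp

end HorizonMetric

end Rindler
end

noncomputable section

namespace Rindler

variable {κ : ℝ} {g h : ℝ → Tensor2} {F A t₁ t₂ T₁ T₂ : ℝ → ℝ → ℝ → ℝ} {ξ : ℝ → VField}

/-! ## Asymptotics of the tensor calculus -/

lemma HorizonVec.lead_D (V : HorizonVec ξ T₁ T₂) (κ : ℝ) (F A : ℝ → ℝ → ℝ → ℝ) (k i : Fin 2) :
    Lead (wt (nd i) - wt (nd k)) (D (some (nd k)) fun s x => ξ s x (nd i))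
      fun s τ y z => (point κ F A s τ y z).dxi (T₁ s y z) (T₂ s y z) k i :=
  (V.lead i).D_nd (φ' := fun s _ y z => (![T₁ s y z, T₂ s y z] : Fin 2 → ℝ) i) (fun s τ y z => by
    fin_cases i
    · simpa using (hasDerivAt_id τ).mul_const (T₁ s y z)
    · simpa using (hasDerivAt_id τ).mul_const (T₂ s y z)) k

lemma HorizonVec.order_D (V : HorizonVec ξ T₁ T₂) (i : Option (Fin 4)) (a : Fin 4) :
    IsO (vt a + wt a - wo i) (D i fun s x => ξ s x a) := (V.order a).D i

lemma HorizonVar.lead_D (W : HorizonVar κ h F A t₁ t₂) (k i j : Fin 2) :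
    Lead (2 - wt (nd i) - wt (nd j) - wt (nd k)) (D (some (nd k)) fun s x => h s x (nd i) (nd j))
      fun s τ y z => (point κ F A s τ y z).dh (t₁ s y z) (t₂ s y z) k i j := by
  refine (W.lead i j).D_nd (φ' := fun s τ y z =>
    2 * A s y z * (point κ F A s τ y z).h (t₁ s y z) (t₂ s y z) i j +
      Real.exp (A s y z * τ) ^ 2 * (2 * (A s y z * t₁ s y z + t₂ s y z) *
        (point κ F A s τ y z).c i j)) (fun s τ y z => ?_) k
  have h1 : HasDerivAt (fun τ => 2 * (A s y z * t₁ s y z + t₂ s y z) * τ *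
      (point κ F A s 0 y z).c i j + (point κ F A s 0 y z).e (t₁ s y z) (t₂ s y z) i j)
      (2 * (A s y z * t₁ s y z + t₂ s y z) * (point κ F A s 0 y z).c i j) τ := by
    have := (((hasDerivAt_id τ).const_mul (2 * (A s y z * t₁ s y z + t₂ s y z))).mul_const
      ((point κ F A s 0 y z).c i j)).add_const
      ((point κ F A s 0 y z).e (t₁ s y z) (t₂ s y z) i j)
    simpa using this
  refine ((HorizonMetric.hasDerivAt_E A s τ y z).mul h1).congr_deriv ?_
  simp only [HData.h, HData.c, HData.e, point]
  ring

lemma HorizonVar.order_D (W : HorizonVar κ h F A t₁ t₂) (i : Option (Fin 4)) (a b : Fin 4) :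
    IsO (2 - wt a - wt b - wo i) (D i fun s x => h s x a b) := (W.order a b).D i

namespace HorizonMetric

lemma christoffel_eq (H : HorizonMetric κ g F A) (a b c : Fin 4) (s : ℝ) {x : Pt} (hx : x ∈ M) :
    1 / 2 * ∑ d, ginv (g s) x a d * (D (some b) (fun s x => g s x d c) s x +
      D (some c) (fun s x => g s x d b) s x - D (some d) (fun s x => g s x b c) s x) =
      christoffel (g s) a b c x := by
  have e := fun a b i => D_some (H.smooth_g a b) i s hx
  simp only [christoffel, e]

/-- The constant flat part of the transverse metric disappears under differentiation, so every `∂g`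
has the order of the two-dimensional block. This is why the derivatives lose nothing to the larger
undifferentiated entries. -/
lemma order_christoffel (H : HorizonMetric κ g F A) (a b c : Fin 4) :
    IsO (vt a + wt a - wt b - wt c) fun s x => christoffel (g s) a b c x := by
  refine (IsO.const_mul (1 / 2) (IsO.sum Finset.univ fun d _ => (H.order_ginv a d).mul
    (k := max (vt a) (vt d) - 2 + wt a + wt d) (l := 2 - wt d - wt b - wt c)
    ((((H.order_D (some b) d c).mono ?_).add ((H.order_D (some c) d b).mono ?_)).sub
      ((H.order_D (some d) b c).mono ?_)) ?_)).congr fun s x hx => H.christoffel_eq a b c s hx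
  all_goals try simp only [wo_some]
  all_goals have := le_max_left (vt a) (vt d)
  all_goals omega

lemma lead_christoffel (H : HorizonMetric κ g F A) (i j k : Fin 2) :
    Lead (wt (nd i) - wt (nd j) - wt (nd k))
      (fun s x => christoffel (g s) (nd i) (nd j) (nd k) x)
      fun s τ y z => (point κ F A s τ y z).Γ i j k := by
  refine (Lead.const_mul (1 / 2) (Lead.sum
    (f := fun d s x => ginv (g s) x (nd i) d * (D (some (nd j)) (fun s x => g s x d (nd k)) s x +
      D (some (nd k)) (fun s x => g s x d (nd j)) s x -
      D (some d) (fun s x => g s x (nd j) (nd k)) s x))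
    (φ := fun l s τ y z => (point κ F A s τ y z).gi i l * ((point κ F A s τ y z).dg j l k +
      (point κ F A s τ y z).dg k l j - (point κ F A s τ y z).dg l j k))
    (fun l => ?_) fun d hd => ?_)).congr
    (fun s x hx => H.christoffel_eq _ _ _ s hx) fun s τ y z => rfl
  · have h1 := H.lead_D j l k
    have h2 := H.lead_D k l j
    have h3 := H.lead_D l j k
    rw [show 2 - wt (nd l) - wt (nd j) - wt (nd k) = 2 - wt (nd l) - wt (nd k) - wt (nd j) by ring]
      at h2
    rw [show 2 - wt (nd j) - wt (nd k) - wt (nd l) = 2 - wt (nd l) - wt (nd k) - wt (nd j) by ring]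
      at h3
    exact (H.lead_ginv i l).mul ((h1.add h2).sub' h3) (by ring)
  · refine (H.order_ginv (nd i) d).mul (l := 2 - wt d - wt (nd j) - wt (nd k))
      ((((H.order_D (some (nd j)) d (nd k)).mono ?_).add
        ((H.order_D (some (nd k)) d (nd j)).mono ?_)).sub
        ((H.order_D (some d) (nd j) (nd k)).mono ?_)) ?_
    all_goals simp only [wo_some, vt_nd, hd]
    all_goals try norm_num
    all_goals omega

lemma covDerivVec_eq (V : HorizonVec ξ T₁ T₂) (a b : Fin 4)
    (s : ℝ) {x : Pt} (hx : x ∈ M) :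
    D (some a) (fun s x => ξ s x b) s x + ∑ c, christoffel (g s) b a c x * ξ s x c =
      covDerivVec (g s) (ξ s) a b x := by
  simp only [covDerivVec, D_some (V.order b).smooth _ _ hx]

lemma order_covDerivVec (H : HorizonMetric κ g F A) (V : HorizonVec ξ T₁ T₂) (a b : Fin 4) :
    IsO (vt b + wt b - wt a) fun s x => covDerivVec (g s) (ξ s) a b x := by
  refine ((V.order_D (some a) b).add (IsO.sum Finset.univ fun c _ =>
    (H.order_christoffel b a c).mul (V.order c) ?_)).congr fun s x hx => covDerivVec_eq V a b s hx
  have := vt_bounds c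
  simp only [wo_some]
  omega

lemma lead_covDerivVec (H : HorizonMetric κ g F A) (V : HorizonVec ξ T₁ T₂) (i j : Fin 2) :
    Lead (wt (nd j) - wt (nd i)) (fun s x => covDerivVec (g s) (ξ s) (nd i) (nd j) x)
      fun s τ y z => (point κ F A s τ y z).cov (T₁ s y z) (T₂ s y z) i j := by
  refine ((V.lead_D κ F A i j).add (Lead.sum
    (f := fun c s x => christoffel (g s) (nd j) (nd i) c x * ξ s x c)
    (φ := fun k s τ y z => (point κ F A s τ y z).Γ j i k *
      (point κ F A s τ y z).xi (T₁ s y z) (T₂ s y z) k)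
    (fun k => (H.lead_christoffel j i k).mul (V.lead k) (by ring)) fun c hc =>
      (H.order_christoffel (nd j) (nd i) c).mul (V.order c) ?_)).congr
    (fun s x hx => covDerivVec_eq V _ _ s hx) fun s τ y z => rfl
  simp only [vt_nd, hc]
  omega

lemma order_covDerivVecUp (H : HorizonMetric κ g F A) (V : HorizonVec ξ T₁ T₂) (a b : Fin 4) :
    IsO (vt a + vt b - 2 + wt a + wt b) fun s x => covDerivVecUp (g s) (ξ s) a b x := by
  refine IsO.sum Finset.univ fun c _ => (H.order_ginv a c).mul (H.order_covDerivVec V c b) ?_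
  have := le_max_left (vt a) (vt c)
  omega

lemma lead_covDerivVecUp (H : HorizonMetric κ g F A) (V : HorizonVec ξ T₁ T₂) (i j : Fin 2) :
    Lead (-2 + wt (nd i) + wt (nd j)) (fun s x => covDerivVecUp (g s) (ξ s) (nd i) (nd j) x)
      fun s τ y z => (point κ F A s τ y z).covUp (T₁ s y z) (T₂ s y z) i j := by
  refine Lead.sum (f := fun c s x => ginv (g s) x (nd i) c * covDerivVec (g s) (ξ s) c (nd j) x)
    (fun k => (H.lead_ginv i k).mul (H.lead_covDerivVec V k j) (by ring)) fun c hc =>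
      (H.order_ginv (nd i) c).mul (H.order_covDerivVec V c (nd j)) ?_
  simp only [vt_nd, hc]
  norm_num

lemma covDerivTensor_eq (W : HorizonVar κ h F A t₁ t₂) (a b c : Fin 4)
    (s : ℝ) {x : Pt} (hx : x ∈ M) :
    D (some a) (fun s x => h s x b c) s x - ∑ d, christoffel (g s) d a b x * h s x d c
      - ∑ d, christoffel (g s) d a c x * h s x b d = covDerivTensor (g s) (h s) a b c x := by
  simp only [covDerivTensor, D_some (W.order b c).smooth _ _ hx]

lemma order_covDerivTensor (H : HorizonMetric κ g F A) (W : HorizonVar κ h F A t₁ t₂)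
    (a b c : Fin 4) :
    IsO (2 - wt a - wt b - wt c) fun s x => covDerivTensor (g s) (h s) a b c x := by
  refine ((((W.order_D (some a) b c).mono ?_).sub (IsO.sum Finset.univ fun d _ =>
    (H.order_christoffel d a b).mul (W.order d c) ?_)).sub (IsO.sum Finset.univ fun d _ =>
    (H.order_christoffel d a c).mul (W.order b d) ?_)).congr
    fun s x hx => covDerivTensor_eq W a b c s hx
  · simp only [wo_some]; omega
  all_goals have := vt_bounds d
  all_goals omega

lemma lead_covDerivTensor (H : HorizonMetric κ g F A) (W : HorizonVar κ h F A t₁ t₂)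
    (i j k : Fin 2) : Lead (2 - wt (nd i) - wt (nd j) - wt (nd k))
      (fun s x => covDerivTensor (g s) (h s) (nd i) (nd j) (nd k) x)
      fun s τ y z => (point κ F A s τ y z).covT (t₁ s y z) (t₂ s y z) i j k := by
  have h1 := W.lead_D i j k
  rw [show 2 - wt (nd j) - wt (nd k) - wt (nd i) = 2 - wt (nd i) - wt (nd j) - wt (nd k) by ring]
    at h1
  refine ((h1.sub' (Lead.sum
    (f := fun d s x => christoffel (g s) d (nd i) (nd j) x * h s x d (nd k))
    (φ := fun l s τ y z => (point κ F A s τ y z).Γ l i j *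
      (point κ F A s τ y z).h (t₁ s y z) (t₂ s y z) l k)
    (fun l => (H.lead_christoffel l i j).mul (W.lead l k) (by ring)) fun d hd => ?_)).sub'
    (Lead.sum (f := fun d s x => christoffel (g s) d (nd i) (nd k) x * h s x (nd j) d)
    (φ := fun l s τ y z => (point κ F A s τ y z).Γ l i k *
      (point κ F A s τ y z).h (t₁ s y z) (t₂ s y z) j l)
    (fun l => (H.lead_christoffel l i k).mul (W.lead j l) (by ring)) fun d hd => ?_)).congr
    (fun s x hx => covDerivTensor_eq W _ _ _ s hx) fun s τ y z => rfl
  · exact (H.order_christoffel d _ _).mul (W.order d _) (by rw [hd]; omega)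
  · exact (H.order_christoffel d _ _).mul (W.order _ d) (by rw [hd]; omega)

lemma order_ginv_left (H : HorizonMetric κ g F A) (a b : Fin 4) :
    IsO (vt a - 2 + wt a + wt b) fun s x => ginv (g s) x a b :=
  (H.order_ginv a b).mono (by have := le_max_left (vt a) (vt b); omega)

lemma order_ginv_low (H : HorizonMetric κ g F A) (a b : Fin 4) :
    IsO (-2 + wt a + wt b) fun s x => ginv (g s) x a b :=
  (H.order_ginv_left a b).mono (by have := vt_bounds a; omega)

lemma order_ginv_two (H : HorizonMetric κ g F A) {a b : Fin 4} (hb : vt a = 2 ∨ vt b = 2) :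
    IsO (wt a + wt b) fun s x => ginv (g s) x a b := by
  refine (H.order_ginv a b).mono ?_
  have h1 := le_max_left (vt a) (vt b)
  have h2 := le_max_right (vt a) (vt b)
  rcases hb with hb | hb <;> omega

lemma order_trace (H : HorizonMetric κ g F A) (W : HorizonVar κ h F A t₁ t₂) :
    IsO 0 fun s x => trace (g s) (h s) x :=
  IsO.sum _ fun a _ => IsO.sum _ fun b _ => (H.order_ginv_low a b).mul (W.order a b) (by omega)

lemma lead_trace (H : HorizonMetric κ g F A) (W : HorizonVar κ h F A t₁ t₂) :
    Lead 0 (fun s x => trace (g s) (h s) x)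
      fun s τ y z => (point κ F A s τ y z).tr (t₁ s y z) (t₂ s y z) :=
  Lead.sum (f := fun a s x => ∑ b, ginv (g s) x a b * h s x a b)
    (fun i => Lead.sum (f := fun b s x => ginv (g s) x (nd i) b * h s x (nd i) b)
      (fun j => (H.lead_ginv i j).mul (W.lead i j) (by ring))
      fun b hb => (H.order_ginv_two (Or.inr hb)).mul (W.order _ b) (by omega))
    fun a ha => IsO.sum _ fun b _ => (H.order_ginv_two (Or.inl ha)).mul (W.order a b) (by omega)

lemma order_raise (H : HorizonMetric κ g F A) (W : HorizonVar κ h F A t₁ t₂) (m n : Fin 4) :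
    IsO (vt m + vt n - 2 + wt m + wt n) fun s x => raise (g s) (h s) m n x :=
  IsO.sum _ fun a _ => IsO.sum _ fun b _ => ((H.order_ginv_left m a).mul (H.order_ginv_left n b)
    le_rfl).mul (W.order a b) (by omega)

lemma lead_raise (H : HorizonMetric κ g F A) (W : HorizonVar κ h F A t₁ t₂) (m n : Fin 2) :
    Lead (-2 + wt (nd m) + wt (nd n)) (fun s x => raise (g s) (h s) (nd m) (nd n) x)
      fun s τ y z => (point κ F A s τ y z).raiseh (t₁ s y z) (t₂ s y z) m n :=
  Lead.sum (f := fun a s x => ∑ b, ginv (g s) x (nd m) a * ginv (g s) x (nd n) b * h s x a b)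
    (fun i => Lead.sum
      (f := fun b s x => ginv (g s) x (nd m) (nd i) * ginv (g s) x (nd n) b * h s x (nd i) b)
      (fun j => ((H.lead_ginv m i).mul (H.lead_ginv n j) rfl).mul (W.lead i j) (by ring))
      fun b hb => ((H.order_ginv_low _ _).mul (H.order_ginv_two (Or.inr hb)) le_rfl).mul
        (W.order _ b) (by omega))
    fun a ha => IsO.sum _ fun b _ => ((H.order_ginv_two (Or.inr ha)).mul (H.order_ginv_low _ b)
      le_rfl).mul (W.order a b) (by omega)

lemma order_gradTrace (H : HorizonMetric κ g F A) (W : HorizonVar κ h F A t₁ t₂) (m : Fin 4) :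
    IsO (vt m - 2 + wt m) fun s x => gradTrace (g s) (h s) m x :=
  IsO.sum _ fun c _ => IsO.sum _ fun a _ => IsO.sum _ fun b _ =>
    ((H.order_ginv_left m c).mul (H.order_ginv_low a b) le_rfl).mul
      (H.order_covDerivTensor W c a b) (by omega)

lemma lead_gradTrace (H : HorizonMetric κ g F A) (W : HorizonVar κ h F A t₁ t₂) (m : Fin 2) :
    Lead (-2 + wt (nd m)) (fun s x => gradTrace (g s) (h s) (nd m) x)
      fun s τ y z => (point κ F A s τ y z).gradTr (t₁ s y z) (t₂ s y z) m :=
  Lead.sum (f := fun c s x => ∑ a, ∑ b, ginv (g s) x (nd m) c * ginv (g s) x a b *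
      covDerivTensor (g s) (h s) c a b x)
    (fun k => Lead.sum (f := fun a s x => ∑ b, ginv (g s) x (nd m) (nd k) * ginv (g s) x a b *
        covDerivTensor (g s) (h s) (nd k) a b x)
      (fun i => Lead.sum (f := fun b s x => ginv (g s) x (nd m) (nd k) * ginv (g s) x (nd i) b *
          covDerivTensor (g s) (h s) (nd k) (nd i) b x)
        (fun j => ((H.lead_ginv m k).mul (H.lead_ginv i j) rfl).mul
          (H.lead_covDerivTensor W k i j) (by ring))
        fun b hb => ((H.order_ginv_low _ _).mul (H.order_ginv_two (Or.inr hb)) le_rfl).mul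
          (H.order_covDerivTensor W _ _ b) (by omega))
      fun a ha => IsO.sum _ fun b _ => ((H.order_ginv_low _ _).mul
        (H.order_ginv_two (Or.inl ha)) le_rfl).mul (H.order_covDerivTensor W _ a b) (by omega))
    fun c hc => IsO.sum _ fun a _ => IsO.sum _ fun b _ => ((H.order_ginv_two (Or.inr hc)).mul
      (H.order_ginv_low a b) le_rfl).mul (H.order_covDerivTensor W c a b) (by omega)

lemma order_divergence (H : HorizonMetric κ g F A) (W : HorizonVar κ h F A t₁ t₂) (m : Fin 4) :
    IsO (vt m - 2 + wt m) fun s x => divergence (g s) (h s) m x :=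
  IsO.sum _ fun a _ => IsO.sum _ fun b _ => IsO.sum _ fun c _ =>
    ((H.order_ginv_left m a).mul (H.order_ginv_low b c) le_rfl).mul
      (H.order_covDerivTensor W c a b) (by omega)

lemma lead_divergence (H : HorizonMetric κ g F A) (W : HorizonVar κ h F A t₁ t₂) (m : Fin 2) :
    Lead (-2 + wt (nd m)) (fun s x => divergence (g s) (h s) (nd m) x)
      fun s τ y z => (point κ F A s τ y z).divh (t₁ s y z) (t₂ s y z) m :=
  Lead.sum (f := fun a s x => ∑ b, ∑ c, ginv (g s) x (nd m) a * ginv (g s) x b c *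
      covDerivTensor (g s) (h s) c a b x)
    (fun i => Lead.sum (f := fun b s x => ∑ c, ginv (g s) x (nd m) (nd i) * ginv (g s) x b c *
        covDerivTensor (g s) (h s) c (nd i) b x)
      (fun j => Lead.sum (f := fun c s x => ginv (g s) x (nd m) (nd i) * ginv (g s) x (nd j) c *
          covDerivTensor (g s) (h s) c (nd i) (nd j) x)
        (fun k => ((H.lead_ginv m i).mul (H.lead_ginv j k) rfl).mul
          (H.lead_covDerivTensor W k i j) (by ring))
        fun c hc => ((H.order_ginv_low _ _).mul (H.order_ginv_two (Or.inr hc)) le_rfl).mul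
          (H.order_covDerivTensor W c _ _) (by omega))
      fun b hb => IsO.sum _ fun c _ => ((H.order_ginv_low _ _).mul
        (H.order_ginv_two (Or.inl hb)) le_rfl).mul (H.order_covDerivTensor W c _ b) (by omega))
    fun a ha => IsO.sum _ fun b _ => IsO.sum _ fun c _ => ((H.order_ginv_two (Or.inr ha)).mul
      (H.order_ginv_low b c) le_rfl).mul (H.order_covDerivTensor W c a b) (by omega)

lemma order_gradContract (H : HorizonMetric κ g F A) (W : HorizonVar κ h F A t₁ t₂)
    (V : HorizonVec ξ T₁ T₂) (m n : Fin 4) :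
    IsO (vt m + vt n - 2 + wt m + wt n) fun s x => gradContract (g s) (h s) (ξ s) m n x :=
  IsO.sum _ fun c _ => IsO.sum _ fun a _ => IsO.sum _ fun b _ =>
    (((H.order_ginv_left m c).mul (H.order_ginv_left n a) le_rfl).mul
      (H.order_covDerivTensor W c a b) le_rfl).mul (V.order b) (by have := vt_bounds b; omega)

lemma lead_gradContract (H : HorizonMetric κ g F A) (W : HorizonVar κ h F A t₁ t₂)
    (V : HorizonVec ξ T₁ T₂) (m n : Fin 2) :
    Lead (-2 + wt (nd m) + wt (nd n))
      (fun s x => gradContract (g s) (h s) (ξ s) (nd m) (nd n) x)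
      fun s τ y z => (point κ F A s τ y z).gradC (t₁ s y z) (t₂ s y z) (T₁ s y z) (T₂ s y z) m n :=
  Lead.sum (f := fun c s x => ∑ a, ∑ b, ginv (g s) x (nd m) c * ginv (g s) x (nd n) a *
      covDerivTensor (g s) (h s) c a b x * ξ s x b)
    (fun k => Lead.sum (f := fun a s x => ∑ b, ginv (g s) x (nd m) (nd k) * ginv (g s) x (nd n) a *
        covDerivTensor (g s) (h s) (nd k) a b x * ξ s x b)
      (fun i => Lead.sum
        (f := fun b s x => ginv (g s) x (nd m) (nd k) * ginv (g s) x (nd n) (nd i) *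
          covDerivTensor (g s) (h s) (nd k) (nd i) b x * ξ s x b)
        (fun j => (((H.lead_ginv m k).mul (H.lead_ginv n i) rfl).mul
          (H.lead_covDerivTensor W k i j) rfl).mul (V.lead j) (by ring))
        fun b hb => (((H.order_ginv_low _ _).mul (H.order_ginv_low _ _) le_rfl).mul
          (H.order_covDerivTensor W _ _ b) le_rfl).mul (V.order b) (by rw [hb]; omega))
      fun a ha => IsO.sum _ fun b _ => (((H.order_ginv_low _ _).mul
        (H.order_ginv_two (Or.inr ha)) le_rfl).mul (H.order_covDerivTensor W _ a b) le_rfl).mul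
          (V.order b) (by have := vt_bounds b; omega))
    fun c hc => IsO.sum _ fun a _ => IsO.sum _ fun b _ => (((H.order_ginv_two (Or.inr hc)).mul
      (H.order_ginv_low _ a) le_rfl).mul (H.order_covDerivTensor W c a b) le_rfl).mul
        (V.order b) (by have := vt_bounds b; omega)

end HorizonMetric

end Rindler
end

noncomputable section

namespace Rindler

/-! ### Explicit algebra of the leading two-dimensional geometry -/

namespace HData

variable (p : HData) (t₁ t₂ T₁ T₂ : ℝ)

lemma Γ_eq (hκ : p.κ ≠ 0) (ha : p.a ≠ 0) (hE : p.E ≠ 0) (i j k : Fin 2) : p.Γ i j k =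
    (![![![2 * p.A, 1], ![1, 0]], ![![p.κ ^ 2 * p.a ^ 2 - p.A ^ 2, 0], ![0, 0]]] :
      Fin 2 → Fin 2 → Fin 2 → ℝ) i j k := by
  fin_cases i <;> fin_cases j <;> fin_cases k <;>
    simp [Γ, dg, gi, g, c, Fin.sum_univ_two, nd, wt] <;> field_simp <;> ring

/-- The leading Noether charge, stripped of its density. The factor `E⁻²` is compensated by the `E²`
of the volume density, and the explicit `τ` that remains is later cancelled by the presymplectic
potential. -/
lemma covUp_antisymm (hκ : p.κ ≠ 0) (ha : p.a ≠ 0) (hE : p.E ≠ 0) :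
    p.covUp t₁ t₂ 0 1 - p.covUp t₁ t₂ 1 0 =
      -(t₁ * p.A + 2 * p.κ ^ 2 * p.a ^ 2 * p.τ * t₁ + t₂) / (p.κ ^ 2 * p.a ^ 2 * p.E ^ 2) := by
  simp [covUp, cov, Γ_eq p hκ ha hE, dxi, xi, gi, Fin.sum_univ_two, nd, wt]
  field_simp
  ring

/-- The part of the variation proportional to `τ` cancels on taking the covariant derivative, and
`∇_ρ h` vanishes at leading order; hence the divergence and the gradient of the trace have no
explicit `τ`. -/
lemma covT_eq (hκ : p.κ ≠ 0) (ha : p.a ≠ 0) (hE : p.E ≠ 0) (i j k : Fin 2) :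
    p.covT t₁ t₂ i j k = p.E ^ 2 *
    (![![![-4 * p.κ ^ 2 * p.a ^ 2 * t₂, 2 * p.κ ^ 2 * p.a ^ 2 * t₁],
      ![2 * p.κ ^ 2 * p.a ^ 2 * t₁, 0]],
      ![![0, 0], ![0, 0]]] : Fin 2 → Fin 2 → Fin 2 → ℝ) i j k := by
  fin_cases i <;> fin_cases j <;> fin_cases k <;>
    simp [covT, Γ_eq p hκ ha hE, dh, h, e, c, Fin.sum_univ_two, nd, wt] <;> ring_nf

lemma theta_zero (hκ : p.κ ≠ 0) (ha : p.a ≠ 0) (hE : p.E ≠ 0) :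
    p.divh t₁ t₂ 0 - p.gradTr t₁ t₂ 0 = 0 := by
  simp [divh, gradTr, covT_eq p t₁ t₂ hκ ha hE, gi, Fin.sum_univ_two]
  field_simp
  ring

lemma theta_one (hκ : p.κ ≠ 0) (ha : p.a ≠ 0) (hE : p.E ≠ 0) :
    p.divh t₁ t₂ 1 - p.gradTr t₁ t₂ 1 = -2 * t₁ / p.E ^ 2 := by
  simp [divh, gradTr, covT_eq p t₁ t₂ hκ ha hE, gi, Fin.sum_univ_two]
  field_simp
  ring

/-- Leading coefficient of the surface density before antisymmetrization. -/
def surf (m n : Fin 2) : ℝ :=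
  -(1 / 2) * p.tr t₁ t₂ * p.covUp T₁ T₂ m n
    + ∑ a, p.raiseh t₁ t₂ a m * p.cov T₁ T₂ a n
    - p.gradC t₁ t₂ T₁ T₂ m n
    + p.xi T₁ T₂ m * p.divh t₁ t₂ n
    - p.xi T₁ T₂ m * p.gradTr t₁ t₂ n

/-- All terms with an explicit `τ` cancel, and `E⁻²` is compensated by the density. The leading
surface density is therefore constant in `τ` and `ρ` and, at fixed `y, z`, an alternating form in
the two pairs of coefficients. -/
lemma surf_antisymm (hκ : p.κ ≠ 0) (ha : p.a ≠ 0) (hE : p.E ≠ 0) :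
    p.surf t₁ t₂ T₁ T₂ 0 1 - p.surf t₁ t₂ T₁ T₂ 1 0 =
      (T₁ * t₂ - T₂ * t₁) / (p.κ ^ 2 * p.a ^ 2 * p.E ^ 2) := by
  have h0 := theta_zero p t₁ t₂ hκ ha hE
  have h1 := theta_one p t₁ t₂ hκ ha hE
  have e : p.surf t₁ t₂ T₁ T₂ 0 1 - p.surf t₁ t₂ T₁ T₂ 1 0 =
      -(1 / 2) * p.tr t₁ t₂ * (p.covUp T₁ T₂ 0 1 - p.covUp T₁ T₂ 1 0)
      + (∑ a, p.raiseh t₁ t₂ a 0 * p.cov T₁ T₂ a 1 - ∑ a, p.raiseh t₁ t₂ a 1 * p.cov T₁ T₂ a 0)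
      - (p.gradC t₁ t₂ T₁ T₂ 0 1 - p.gradC t₁ t₂ T₁ T₂ 1 0)
      + p.xi T₁ T₂ 0 * (p.divh t₁ t₂ 1 - p.gradTr t₁ t₂ 1)
      - p.xi T₁ T₂ 1 * (p.divh t₁ t₂ 0 - p.gradTr t₁ t₂ 0) := by
    simp only [surf]
    ring
  have tr_eq : p.tr t₁ t₂ = 4 * (p.A * t₁ + t₂) * p.τ + 2 * t₁ := by
    simp [tr, gi, h, HData.e, c, Fin.sum_univ_two]
    field_simp
    ring
  have gradC_eq : p.gradC t₁ t₂ T₁ T₂ 0 1 - p.gradC t₁ t₂ T₁ T₂ 1 0 =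
      -2 * t₁ * T₁ * p.τ / p.E ^ 2 := by
    simp [gradC, covT_eq p t₁ t₂ hκ ha hE, gi, xi, Fin.sum_univ_two]
    field_simp
    ring
  rw [e, h0, h1, tr_eq, gradC_eq, covUp_antisymm p T₁ T₂ hκ ha hE]
  simp [raiseh, cov, Γ_eq p hκ ha hE, dxi, xi, gi, HData.h, HData.e, HData.c, Fin.sum_univ_two,
    nd, wt]
  field_simp
  ring

end HData

variable {κ : ℝ} {g h : ℝ → Tensor2} {F A t₁ t₂ T₁ T₂ : ℝ → ℝ → ℝ → ℝ} {ξ η ζ : ℝ → VField}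

/-! ## Variations of the metric -/

lemma Lead.isO_succ {k : ℤ} {f : Fam} {φ : ℝ → ℝ → ℝ → ℝ → ℝ} (h : Lead k f φ)
    (h0 : ∀ s τ y z, φ s τ y z = 0) : IsO (k + 1) f :=
  h.sub.congr fun s x _ => by simp [lf, h0]

namespace HorizonMetric

lemma lieDeriv_eq (H : HorizonMetric κ g F A) (V : HorizonVec η t₁ t₂) (a b : Fin 4) (s : ℝ)
    {x : Pt} (hx : x ∈ M) :
    ∑ c, (η s x c * D (some c) (fun s x => g s x a b) s x
      + g s x c b * D (some a) (fun s x => η s x c) s x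
      + g s x a c * D (some b) (fun s x => η s x c) s x) = lieDeriv (η s) (g s) x a b := by
  have e1 := fun a b i => D_some (H.smooth_g a b) i s hx
  have e2 := fun a i => D_some (V.order a).smooth i s hx
  simp only [lieDeriv, Matrix.of_apply, e1, e2]

/-- Derivatives and contractions in transverse directions are subleading, so at leading order this
is the two-dimensional Lie derivative: the conformal factor `E²ρ²` contributes `2(A t₁ + t₂)τ c`,
and differentiation of the coefficients `τ t₁, τ t₂` contributes `e`. -/
lemma lieDeriv_var (H : HorizonMetric κ g F A) (V : HorizonVec η t₁ t₂) :
    HorizonVar κ (fun s => lieDeriv (η s) (g s)) F A t₁ t₂ where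
  order a b := by
    refine (IsO.sum Finset.univ fun c _ => (((V.order c).mul (H.order_D (some c) a b) ?_).add
      ((H.order_g c b).mul (V.order_D (some a) c) ?_)).add
      ((H.order_g a c).mul (V.order_D (some b) c) ?_)).congr
      fun s x hx => H.lieDeriv_eq V a b s hx
    all_goals have := vt_bounds c
    all_goals have := min_le_left (vt c) (vt b)
    all_goals have := min_le_right (vt a) (vt c)
    all_goals simp only [wo_some]
    all_goals omega
  lead i j := by
    refine (Lead.sum
      (f := fun c s x => η s x c * D (some c) (fun s x => g s x (nd i) (nd j)) s x
        + g s x c (nd j) * D (some (nd i)) (fun s x => η s x c) s x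
        + g s x (nd i) c * D (some (nd j)) (fun s x => η s x c) s x)
      (fun k => (((V.lead k).mul (H.lead_D k i j) (by ring)).add
        ((H.lead k j).mul (V.lead_D κ F A i k) (by ring))).add
        ((H.lead i k).mul (V.lead_D κ F A j k) (by ring)))
      fun c hc => (((V.order c).mul (H.order_D (some c) _ _) ?_).add
        ((H.order_g c _).mul (V.order_D (some (nd i)) c) ?_)).add
        ((H.order_g _ c).mul (V.order_D (some (nd j)) c) ?_)).congr
      (fun s x hx => H.lieDeriv_eq V _ _ s hx) fun s τ y z => ?_
    · simp only [wo_some, hc]; omega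
    · simp only [wo_some, hc, vt_nd]; norm_num; omega
    · simp only [wo_some, hc, vt_nd]; norm_num; omega
    · fin_cases i <;> fin_cases j <;>
        simp [HData.dg, HData.g, HData.dxi, HData.h, HData.e, HData.c, HData.xi, point,
          Fin.sum_univ_two, nd, wt] <;> ring

/-- The parameter derivative of the metric is a variation of the same form. -/
lemma deriv_var (H : HorizonMetric κ g F A) {F' A' : ℝ → ℝ → ℝ → ℝ}
    (hF : ∀ s y z, HasDerivAt (fun s => F s y z) (F' s y z) s)
    (hA : ∀ s y z, HasDerivAt (fun s => A s y z) (A' s y z) s) :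
    HorizonVar κ (fun s x => Matrix.of fun i j => deriv (fun t => g t x i j) s) F A F'
      fun s y z => A' s y z - A s y z * F' s y z where
  order a b := (H.order_D none a b).mono (by simp [wo]) |>.congr fun s x hx => by
    simp [D_none (H.smooth_g a b) s hx]
  -- With `t₁ = F'` and `t₂ = A' - A F'` one has `A t₁ + t₂ = A'`, and `e` becomes the derivative of
  -- `c`; this is how the derivative along the path fits the form of a Lie derivative.
  lead i j := by
    refine ((H.lead i j).D_none (φ' := fun s τ y z => (point κ F A s τ y z).h (F' s y z)
      (A' s y z - A s y z * F' s y z) i j) fun s τ y z => ?_).congr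
      (fun s x hx => by simp [Rindler.D_none (H.smooth_g _ _) s hx]) fun _ _ _ _ => rfl
    have h1 := hF s y z
    have h2 := hA s y z
    have hE : HasDerivAt (fun s => Real.exp (A s y z * τ) ^ 2)
        (Real.exp (A s y z * τ) ^ 2 * (2 * A' s y z * τ)) s := by
      refine ((h2.mul_const τ).exp.pow 2).congr_deriv ?_
      simp only [Nat.cast_ofNat, Nat.add_one_sub_one, pow_one]
      ring
    have hc : HasDerivAt (fun s => A s y z ^ 2 - κ ^ 2 * Real.exp (F s y z) ^ 2)
        (2 * A s y z * A' s y z - κ ^ 2 * (Real.exp (F s y z) ^ 2 * (2 * F' s y z))) s := by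
      refine ((h2.pow 2).sub ((h1.exp.pow 2).const_mul (κ ^ 2))).congr_deriv ?_
      simp only [Nat.cast_ofNat, Nat.add_one_sub_one, pow_one]
      ring
    fin_cases i <;> fin_cases j
    · refine (hE.mul hc).congr_deriv ?_
      simp [HData.h, HData.c, HData.e, point]
      ring
    · refine (hE.mul h2).congr_deriv ?_
      simp [HData.h, HData.c, HData.e, point]
      ring
    · refine (hE.mul h2).congr_deriv ?_
      simp [HData.h, HData.c, HData.e, point]
      ring
    · refine (hE.mul_const 1).congr_deriv ?_
      simp [HData.h, HData.c, HData.e, point]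

/-! ## Asymptotics of the phase space quantities -/

variable (G : ℝ)

lemma lead_noetherQ (H : HorizonMetric κ g F A) (V : HorizonVec ξ T₁ T₂) :
    Lead 0 (fun s x => noetherQ G (g s) (ξ s) 0 1 x) fun s τ y z =>
      1 / (16 * Real.pi * G * κ) * (T₁ s y z * A s y z * Real.exp (-F s y z) +
        2 * κ ^ 2 * Real.exp (F s y z) * τ * T₁ s y z + T₂ s y z * Real.exp (-F s y z)) := by
  have h1 := (H.dens.const_mul (-(1 / (16 * Real.pi * G)))).mul
    ((H.lead_covDerivVecUp V 0 1).sub' (H.lead_covDerivVecUp V 1 0)) (m := 0) rfl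
  refine h1.congr (fun s x hx => ?_) fun s τ y z => ?_
  · simp only [noetherQ, antisymm, nd, Matrix.cons_val_zero, Matrix.cons_val_one]
    ring
  · rw [HData.covUp_antisymm _ _ _ (H.κ_ne s τ y z) (a_ne s τ y z) (E_ne s τ y z), Real.exp_neg]
    have hκ := H.κ_pos.ne'
    have ha := (Real.exp_pos (F s y z)).ne'
    have hE := (Real.exp_pos (A s y z * τ)).ne'
    simp only [point]
    field_simp

/-- The vanishing of the leading `Θ^τ` matters: multiplied by `ξ^ρ = O(ρ)` it would otherwise
contribute to the charge at the same order as `ξ^τ Θ^ρ`. -/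
lemma lead_theta (H : HorizonMetric κ g F A) (W : HorizonVar κ h F A t₁ t₂) (m : Fin 2) :
    Lead (-1 + wt (nd m)) (fun s x => presymplecticPotential G (g s) (h s) (nd m) x)
      fun s _ y z => (![0, -(2 * κ ^ 2 * Real.exp (F s y z) * t₁ s y z) /
        (16 * Real.pi * G * κ)] : Fin 2 → ℝ) m := by
  have h1 := (H.dens.const_mul (1 / (16 * Real.pi * G))).mul
    ((H.lead_divergence W m).sub' (H.lead_gradTrace W m)) (m := -1 + wt (nd m)) (by ring)
  refine h1.congr (fun s x hx => ?_) fun s τ y z => ?_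
  · simp only [presymplecticPotential]
    ring
  · have hκ := H.κ_pos.ne'
    have ha := (Real.exp_pos (F s y z)).ne'
    have hE := (Real.exp_pos (A s y z * τ)).ne'
    fin_cases m
    · have := HData.theta_zero (point κ F A s τ y z) (t₁ s y z) (t₂ s y z) (H.κ_ne s τ y z)
        (a_ne s τ y z) (E_ne s τ y z)
      simp [this]
    · have := HData.theta_one (point κ F A s τ y z) (t₁ s y z) (t₂ s y z) (H.κ_ne s τ y z)
        (a_ne s τ y z) (E_ne s τ y z)
      simp [this]
      simp only [point]
      field_simp

lemma order_surfaceS (H : HorizonMetric κ g F A) (W : HorizonVar κ h F A t₁ t₂)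
    (V : HorizonVec ζ T₁ T₂) (m n : Fin 4) :
    IsO (vt m + vt n - 1 + wt m + wt n) fun s x => surfaceS G (g s) (h s) (ζ s) m n x := by
  have key : ∀ m n, IsO (vt m + vt n - 2 + wt m + wt n) fun s x =>
      -(1 / 2) * trace (g s) (h s) x * covDerivVecUp (g s) (ζ s) m n x
      + ∑ a, raise (g s) (h s) a m x * covDerivVec (g s) (ζ s) a n x
      - gradContract (g s) (h s) (ζ s) m n x
      + ζ s x m * divergence (g s) (h s) n x
      - ζ s x m * gradTrace (g s) (h s) n x := by
    intro m n
    have := vt_bounds m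
    exact (((((((H.order_trace W).const_mul (-(1 / 2))).mul (H.order_covDerivVecUp V m n)
      (by omega)).add (IsO.sum _ fun a _ => (H.order_raise W a m).mul (H.order_covDerivVec V a n)
        (by have := vt_bounds a; omega))).sub (H.order_gradContract W V m n)).add
        ((V.order m).mul (H.order_divergence W n) (by omega))).sub
        ((V.order m).mul (H.order_gradTrace W n) (by omega)))
  refine ((H.dens.isO.const_mul (1 / (16 * Real.pi * G))).mul
    ((key m n).sub ((key n m).mono (l := vt m + vt n - 2 + wt m + wt n) (by omega)))
      (by omega)).congr fun s x hx => ?_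
  simp only [surfaceS, antisymm]
  ring

lemma lead_surfaceS (H : HorizonMetric κ g F A) (W : HorizonVar κ h F A t₁ t₂)
    (V : HorizonVec ζ T₁ T₂) :
    Lead 0 (fun s x => surfaceS G (g s) (h s) (ζ s) 0 1 x) fun s _ y z =>
      1 / (16 * Real.pi * G * κ) * ((T₁ s y z * t₂ s y z - T₂ s y z * t₁ s y z) *
        Real.exp (-F s y z)) := by
  have key : ∀ m n : Fin 2, Lead (-2 + wt (nd m) + wt (nd n)) (fun s x =>
      -(1 / 2) * trace (g s) (h s) x * covDerivVecUp (g s) (ζ s) (nd m) (nd n) x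
      + ∑ a, raise (g s) (h s) a (nd m) x * covDerivVec (g s) (ζ s) a (nd n) x
      - gradContract (g s) (h s) (ζ s) (nd m) (nd n) x
      + ζ s x (nd m) * divergence (g s) (h s) (nd n) x
      - ζ s x (nd m) * gradTrace (g s) (h s) (nd n) x) fun s τ y z =>
      (point κ F A s τ y z).surf (t₁ s y z) (t₂ s y z) (T₁ s y z) (T₂ s y z) m n := by
    intro m n
    refine (((((((H.lead_trace W).const_mul (-(1 / 2))).mul (H.lead_covDerivVecUp V m n)
      (by ring)).add (Lead.sum
        (f := fun a s x => raise (g s) (h s) a (nd m) x * covDerivVec (g s) (ζ s) a (nd n) x)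
        (fun i => (H.lead_raise W i m).mul (H.lead_covDerivVec V i n) (by ring)) fun a ha =>
          (H.order_raise W a (nd m)).mul (H.order_covDerivVec V a (nd n)) ?_)).sub'
        (H.lead_gradContract W V m n)).add
        ((V.lead m).mul (H.lead_divergence W n) (by ring))).sub'
        ((V.lead m).mul (H.lead_gradTrace W n) (by ring)))
    simp only [ha, vt_nd]
    omega
  refine ((H.dens.const_mul (1 / (16 * Real.pi * G))).mul ((key 0 1).sub' (key 1 0)) (m := 0)
    rfl).congr (fun s x hx => ?_) fun s τ y z => ?_
  · simp only [surfaceS, antisymm, nd, Matrix.cons_val_zero, Matrix.cons_val_one]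
    ring
  · rw [HData.surf_antisymm _ _ _ _ _ (H.κ_ne s τ y z) (a_ne s τ y z) (E_ne s τ y z),
      Real.exp_neg]
    have hκ := H.κ_pos.ne'
    have ha := (Real.exp_pos (F s y z)).ne'
    have hE := (Real.exp_pos (A s y z * τ)).ne'
    simp only [point]
    field_simp

/-- Since `ξ^τ = O(1)` and `ξ^ρ = O(ρ)`, it is enough that `∂_α S^{ρα} = O(ρ)` and `∂_α S^{τα} =
O(1)`. Naive counting fails by one order precisely in the terms `∂_τ S^{ρτ}` and `∂_ρ S^{τρ}`, and
these gain an order because the leading coefficient is independent of `τ` and `ρ`; transverse terms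
gain enough from their index. -/
lemma order_integrabilityIntegrand (H : HorizonMetric κ g F A) {a₁ a₂ b₁ b₂ c₁ c₂ :
    ℝ → ℝ → ℝ → ℝ} (U : HorizonVec ξ a₁ a₂) (V : HorizonVec η b₁ b₂) (W : HorizonVec ζ c₁ c₂) :
    IsO 1 fun s x => integrabilityIntegrand G (g s) (ξ s) (η s) (ζ s) x := by
  have hV := H.lieDeriv_var V
  let S : Fin 4 → Fin 4 → Fam := fun m n s x =>
    surfaceS G (g s) (lieDeriv (η s) (g s)) (ζ s) m n x
  have hS : ∀ m n, IsO (vt m + vt n - 1 + wt m + wt n) (S m n) := H.order_surfaceS G hV W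
  have hl : Lead 0 (S 0 1) _ := H.lead_surfaceS G hV W
  have hanti : ∀ s x, S 1 0 s x = -S 0 1 s x := fun s x => by
    simp only [S, surfaceS, antisymm]; ring
  have hdiag : ∀ m i, IsO 5 (D i (S m m)) := fun m i =>
    ((IsO.zero (5 + wo i)).D i).congr (fun s x hx => D_congr (fun s x _ => by
      simp only [S, surfaceS, antisymm]; ring) i s hx) |>.mono (by omega)
  have h01 : IsO 1 (D (some 0) (S 0 1)) :=
    (hl.D_zero (φ' := fun _ _ _ _ => 0) fun s τ y z => hasDerivAt_const _ _).isO_succ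
      fun _ _ _ _ => rfl
  have h10 : IsO 1 (D (some 0) (S 1 0)) := h01.neg.congr fun s x hx => by
    rw [← D_neg]
    exact D_congr (fun s x _ => (hanti s x).symm) _ s hx
  have h1 : IsO 0 (D (some 1) (S 0 1)) :=
    (hl.D_one.isO_succ fun _ _ _ _ => by simp).mono (by norm_num)
  have ht : ∀ m b, vt b = 2 → IsO 1 (D (some b) (S m b)) := fun m b hb => by
    have := (vt_bounds m).1
    have h2 : 0 ≤ wt m := by simp only [wt]; split <;> norm_num
    refine ((hS m b).D (some b)).mono ?_
    simp only [wo_some, hb]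
    omega
  have A1 : IsO 1 fun s x => ∑ a, D (some a) (S 1 a) s x := by
    refine IsO.sum _ fun a _ => ?_
    fin_cases a
    · exact h10
    · exact (hdiag 1 _).mono (by norm_num)
    · exact ht 1 2 rfl
    · exact ht 1 3 rfl
  have A0 : IsO 0 fun s x => ∑ a, D (some a) (S 0 a) s x := by
    refine IsO.sum _ fun a _ => ?_
    fin_cases a
    · exact (hdiag 0 _).mono (by norm_num)
    · exact h1
    · exact (ht 0 2 rfl).mono (by norm_num)
    · exact (ht 0 3 rfl).mono (by norm_num)
  refine ((((U.order 0).mul A1 (m := 1) (by simp [vt, wt])).sub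
    ((U.order 1).mul A0 (m := 1) (by simp [vt, wt]))).const_mul (1 / 2)).congr fun s x hx => ?_
  have e := fun n a => D_some (hS n a).smooth a s hx
  simp only [e]
  simp only [integrabilityIntegrand, corner, antisymm, S]
  ring

/-- The integrand of the charge along a family of metrics converges at the horizon. -/
lemma lead_chargeIntegrand (H : HorizonMetric κ g F A) {V : VField} {T₁ T₂ : ℝ → ℝ → ℝ}
    (hV : HorizonVec (fun _ => V) (fun _ => T₁) fun _ => T₂) {F' A' : ℝ → ℝ → ℝ → ℝ}
    (hF : ∀ s y z, HasDerivAt (fun s => F s y z) (F' s y z) s)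
    (hA : ∀ s y z, HasDerivAt (fun s => A s y z) (A' s y z) s) :
    Lead 0 (fun s x => chargeIntegrand G g V s x) fun s _ y z =>
      1 / (16 * Real.pi * G * κ) * ((T₁ y z * (A' s y z - A s y z * F' s y z) -
        T₂ y z * F' s y z) * Real.exp (-F s y z)) := by
  have hQ := H.lead_noetherQ G hV
  have hW := H.deriv_var hF hA
  have hQ' := hQ.D_none (φ' := fun s τ y z =>
    1 / (16 * Real.pi * G * κ) * (T₁ y z * (A' s y z - A s y z * F' s y z) * Real.exp (-F s y z) +
      2 * κ ^ 2 * (Real.exp (F s y z) * F' s y z) * τ * T₁ y z -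
      T₂ y z * F' s y z * Real.exp (-F s y z))) fun s τ y z => by
    have h1 := hF s y z
    have h2 := hA s y z
    have h3 : HasDerivAt (fun s => Real.exp (-F s y z)) (Real.exp (-F s y z) * -F' s y z) s :=
      h1.fun_neg.exp
    refine ((((h2.const_mul (T₁ y z)).mul h3).add
      (((h1.exp.const_mul (2 * κ ^ 2)).mul_const τ).mul_const (T₁ y z))).add
      (h3.const_mul (T₂ y z))).const_mul (1 / (16 * Real.pi * G * κ)) |>.congr_deriv ?_
    ring
  -- The term `2κ² e^F F' τ T₁` of `∂_s Q` is cancelled by `ξ^τ Θ^ρ`, and `ξ^ρ Θ^τ` has zero leading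
  -- coefficient; what remains is independent of `τ`.
  refine ((hQ'.add ((hV.lead 0).mul (H.lead_theta G hW 1) (m := 0) rfl)).sub'
    ((hV.lead 1).mul (H.lead_theta G hW 0) (m := 0) rfl)).congr (fun s x hx => ?_)
    fun s τ y z => ?_
  · rw [Rindler.D_none hQ.isO.smooth s hx]
    have e : (fun t => noetherQ G (g t) V 1 0 x) = fun t => -noetherQ G (g t) V 0 1 x := by
      ext t
      simp only [noetherQ, antisymm]
      ring
    simp only [chargeIntegrand, corner, antisymm, nd, Matrix.cons_val_zero, Matrix.cons_val_one]
    rw [e, deriv.fun_neg]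
    ring
  · simp only [Matrix.cons_val_zero, Matrix.cons_val_one]
    ring

end HorizonMetric

end Rindler
end

noncomputable section

namespace Rindler

/-! ## The pullback of the Rindler metric -/

lemma IsSuperdilatationFamily.horizonVec {ξ : ℝ → VField} {T₁ T₂ : ℝ → ℝ → ℝ → ℝ}
    (h : IsSuperdilatationFamily ξ T₁ T₂) : HorizonVec ξ T₁ T₂ where
  order a := by
    fin_cases a
    · exact h.isO_comp 0
    · exact h.isO_comp 1
    · exact h.comp_y.isO
    · exact h.comp_z.isO
  lead i := by
    have h1 := contDiff_lift h.smooth₁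
    have h2 := contDiff_lift h.smooth₂
    fin_cases i
    · exact Lead.of_contDiff_rho ((contDiff_coord 0).mul h1)
        ((h.comp_τ.isO.mono (by simp [nd, wt])).congr fun s x _ => by simp [nd, wt, lf])
    · exact Lead.of_contDiff_rho ((contDiff_coord 0).mul h2)
        ((h.comp_ρ.isO.mono (by simp [nd, wt])).congr fun s x _ => by simp [nd, wt, lf]; ring)

lemma pullback_rindler (κ : ℝ) (χ : Pt → Pt) (x : Pt) (a b : Fin 4) :
    pullback χ (rindlerMetric κ) x a b =
      -(κ ^ 2 * χ x 1 ^ 2) * (pd a (fun y => χ y 0) x * pd b (fun y => χ y 0) x) +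
      pd a (fun y => χ y 1) x * pd b (fun y => χ y 1) x +
      (pd a (fun y => χ y 2) x * pd b (fun y => χ y 2) x +
        pd a (fun y => χ y 3) x * pd b (fun y => χ y 3) x) := by
  simp [pullback, rindlerMetric, Fin.sum_univ_four, Matrix.diagonal_apply]
  ring

namespace HorizonMap

variable {X : ℝ → Pt → Pt} {F A : ℝ → ℝ → ℝ → ℝ} {κ : ℝ}

lemma isO (h : HorizonMap X F A) (a : Fin 4) : IsO (wt a) fun s x => X s x a :=
  OMap.isO h.omap a

lemma contDiff_exp_F (h : HorizonMap X F A) :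
    ContDiff ℝ ∞ fun p : ℝ × Pt => lf (fun s _ y z => Real.exp (F s y z)) p.1 p.2 :=
  Real.contDiff_exp.comp (contDiff_lift h.smoothF)

lemma contDiff_exp_A (h : HorizonMap X F A) :
    ContDiff ℝ ∞ fun p : ℝ × Pt => lf (fun s τ y z => Real.exp (A s y z * τ)) p.1 p.2 :=
  Real.contDiff_exp.comp ((contDiff_lift h.smoothA).mul (contDiff_coord 0))

/-- The Jacobian matrix. -/
def jac (X : ℝ → Pt → Pt) (s : ℝ) (x : Pt) : Matrix (Fin 4) (Fin 4) ℝ :=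
  Matrix.of fun a b => D (some b) (fun s x => X s x a) s x

lemma pullback_eq (h : HorizonMap X F A) (s : ℝ) {x : Pt} (hx : x ∈ M) (a b : Fin 4) :
    pullback (X s) (rindlerMetric κ) x a b =
      -(κ ^ 2 * X s x 1 ^ 2) * (jac X s x 0 a * jac X s x 0 b) + jac X s x 1 a * jac X s x 1 b +
      (jac X s x 2 a * jac X s x 2 b + jac X s x 3 a * jac X s x 3 b) := by
  rw [pullback_rindler]
  have e := fun a i => D_some (h.isO a).smooth i s hx
  simp only [jac, Matrix.of_apply, e]

lemma order_jac (h : HorizonMap X F A) (a b : Fin 4) :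
    IsO (wt a - wt b) fun s x => jac X s x a b := (h.isO a).D (some b)

lemma order_jac_sub (h : HorizonMap X F A) {a : Fin 4} (ha : vt a = 2) (b : Fin 4) :
    IsO (2 - wt b) fun s x => jac X s x a b - if b = a then 1 else 0 := by
  have h1 : IsO 2 fun s x => X s x a - x a := by
    fin_cases a
    · simp [vt] at ha
    · simp [vt] at ha
    · exact h.comp_y
    · exact h.comp_z
  refine (h1.D (some b)).congr fun s x hx => ?_
  rw [D_sub (h.isO a).smooth (IsO.coord a).smooth _ s hx, D_coord, dir_some_apply]
  rfl

lemma lead_τ (h : HorizonMap X F A) :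
    Lead 0 (fun s x => X s x 0) fun s τ y z => τ * Real.exp (F s y z) :=
  Lead.of_contDiff_rho ((contDiff_coord 0).mul h.contDiff_exp_F)
    ((h.comp_τ.mono (by norm_num)).congr fun s x _ => by simp [lf])

lemma lead_ρ (h : HorizonMap X F A) :
    Lead 1 (fun s x => X s x 1) fun s τ y z => Real.exp (A s y z * τ) :=
  Lead.of_contDiff_rho h.contDiff_exp_A ((h.comp_ρ.mono (by norm_num)).congr fun s x _ => by
    simp [lf])

lemma lead_jac_zero (h : HorizonMap X F A) (i : Fin 2) :
    Lead (-wt (nd i)) (fun s x => jac X s x 0 (nd i))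
      fun s _ y z => (![Real.exp (F s y z), 0] : Fin 2 → ℝ) i := by
  have h1 := h.lead_τ.D_nd (φ' := fun s _ y z => Real.exp (F s y z))
    (fun s τ y z => by simpa using (hasDerivAt_id τ).mul_const (Real.exp (F s y z))) i
  rw [zero_sub] at h1
  refine h1.congr (fun s x _ => rfl) fun s τ y z => ?_
  fin_cases i <;> simp

lemma lead_jac_one (h : HorizonMap X F A) (i : Fin 2) :
    Lead (1 - wt (nd i)) (fun s x => jac X s x 1 (nd i))
      fun s τ y z => (![A s y z * Real.exp (A s y z * τ), Real.exp (A s y z * τ)] :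
        Fin 2 → ℝ) i := by
  have h1 := h.lead_ρ.D_nd (φ' := fun s τ y z => A s y z * Real.exp (A s y z * τ))
    (fun s τ y z => by
      simpa [mul_comm] using ((hasDerivAt_id τ).const_mul (A s y z)).exp) i
  refine h1.congr (fun s x _ => rfl) fun s τ y z => ?_
  fin_cases i <;> simp

/-- Only entries that affect the leading determinant are replaced in the comparison matrix `m`. The
entry `∂_ρ X^τ` becomes zero and the transverse rows become those of the identity, so the retained
entries drop out and `det m` is exactly `e^F e^{Aτ}`. -/
lemma lead_det_jac (h : HorizonMap X F A) : Lead 0 (fun s x => (jac X s x).det)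
    fun s τ y z => Real.exp (F s y z) * Real.exp (A s y z * τ) := by
  let m : ℝ → Pt → Matrix (Fin 4) (Fin 4) ℝ := fun s x =>
    !![Real.exp (F s (x 2) (x 3)), 0, jac X s x 0 2, jac X s x 0 3;
      jac X s x 1 0, Real.exp (A s (x 2) (x 3) * x 0), jac X s x 1 2, jac X s x 1 3;
      0, 0, 1, 0; 0, 0, 0, 1]
  have e : ∀ s x, (m s x).det = x 1 ^ (0 : ℤ) *
      lf (fun s τ y z => Real.exp (F s y z) * Real.exp (A s y z * τ)) s x := by
    intro s x
    simp [m, Matrix.det_succ_row_zero, Fin.sum_univ_succ, lf, Fin.succAbove]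
  refine Lead.of_contDiff_rho (h.contDiff_exp_F.mul h.contDiff_exp_A) ?_
  have hd : ∀ a b, IsO (wt a + -wt b + 1) fun s x => jac X s x a b - m s x a b := by
    have ht : ∀ (k : ℤ) (f : Fam), IsO k fun s x => f s x - f s x := fun k f =>
      (IsO.zero k).congr fun s x _ => (sub_self _).symm
    have h0 := fun i => (h.lead_jac_zero i).sub
    have h1 := fun i => (h.lead_jac_one i).sub
    intro a b
    have h2 := fun ha => h.order_jac_sub (a := a) ha b
    fin_cases a
    · fin_cases b
      · simpa [m, lf, nd, wt] using h0 0
      · simpa [m, lf, nd, wt] using h0 1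
      · exact ht _ _
      · exact ht _ _
    · fin_cases b
      · exact ht _ _
      · simpa [m, lf, nd, wt] using h1 1
      · exact ht _ _
      · exact ht _ _
    · refine ((h2 rfl).mono (by simp [wt])).congr fun s x _ => ?_
      fin_cases b <;> rfl
    · refine ((h2 rfl).mono (by simp [wt])).congr fun s x _ => ?_
      fin_cases b <;> rfl
  have hj : ∀ a b, IsO (wt a + -wt b) fun s x => jac X s x a b := h.order_jac
  have := IsO.det_sub hj (fun a b => ((hj a b).sub ((hd a b).mono (by omega))).congr
    fun s x _ => by ring) hd
  refine (this.mono (by simp [wt])).congr fun s x _ => by rw [e]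

lemma pullback_eq_mul (h : HorizonMap X F A) (s : ℝ) {x : Pt} (hx : x ∈ M) :
    pullback (X s) (rindlerMetric κ) x =
      (jac X s x).transpose * rindlerMetric κ (X s x) * jac X s x := by
  ext a b
  rw [h.pullback_eq s hx]
  simp [Matrix.mul_apply, rindlerMetric, Fin.sum_univ_four, Matrix.diagonal_apply]
  ring

lemma det_pullback (h : HorizonMap X F A) (s : ℝ) {x : Pt} (hx : x ∈ M) :
    (pullback (X s) (rindlerMetric κ) x).det = -(κ * X s x 1 * (jac X s x).det) ^ 2 := by
  rw [h.pullback_eq_mul s hx, Matrix.det_mul, Matrix.det_mul, Matrix.det_transpose]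
  simp [rindlerMetric, Matrix.det_diagonal, Fin.prod_univ_four]
  ring

lemma density_pos (h : HorizonMap X F A) (hκ : 0 < κ) (s : ℝ) {x : Pt} (hx : x ∈ M) :
    0 < κ * X s x 1 * (jac X s x).det :=
  mul_pos (mul_pos hκ ((h.omap 0).mapsTo s hx)) (h.det_pos s x hx)

/-- The first two components of the map contribute terms of the order of the two-dimensional block.
The last two differ from `y, z` by `O(ρ²)`, so their contribution is the flat transverse metric up
to the same order. -/
lemma order_pullback (h : HorizonMap X F A) (κ : ℝ) (a b : Fin 4) :
    IsO (2 - wt a - wt b) fun s x => pullback (X s) (rindlerMetric κ) x a b - kron a b := by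
  have t0 : IsO (2 - wt a - wt b) fun s x =>
      -κ ^ 2 * (X s x 1 * X s x 1 * (jac X s x 0 a * jac X s x 0 b)) :=
    (((h.isO 1).mul (h.isO 1) (m := 2) (by simp [wt])).mul
      ((h.order_jac 0 a).mul (h.order_jac 0 b) le_rfl) (by simp [wt]; omega)).const_mul _
  have t1 : IsO (2 - wt a - wt b) fun s x => jac X s x 1 a * jac X s x 1 b :=
    (h.order_jac 1 a).mul (h.order_jac 1 b) (by simp [wt]; omega)
  have t2 : ∀ c, vt c = 2 → IsO (2 - wt a - wt b) fun s x =>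
      jac X s x c a * jac X s x c b - (if a = c then 1 else 0) * if b = c then 1 else 0 := by
    intro c hc
    have hw := wt_of_vt hc
    have := wo_nonneg (some a)
    rw [wo_some] at this
    refine (((h.order_jac_sub hc a).mul (h.order_jac c b) (m := 2 - wt a - wt b) (by omega)).add
      ((IsO.const (if a = c then 1 else 0)).mul (h.order_jac_sub hc b) (by omega))).congr
      fun s x _ => by ring
  refine ((t0.add t1).add ((t2 2 rfl).add (t2 3 rfl))).congr fun s x hx => ?_
  have e : kron a b = (if a = 2 then 1 else 0) * (if b = 2 then 1 else 0) +
      (if a = 3 then 1 else 0) * if b = 3 then 1 else 0 := by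
    fin_cases a <;> fin_cases b <;> simp [kron, vt]
  rw [h.pullback_eq s hx, e]
  ring

lemma lead_pullback (h : HorizonMap X F A) (κ : ℝ) (i j : Fin 2) :
    Lead (2 - wt (nd i) - wt (nd j))
      (fun s x => pullback (X s) (rindlerMetric κ) x (nd i) (nd j))
      fun s τ y z => (point κ F A s τ y z).g i j := by
  have t0 := ((h.lead_ρ.mul h.lead_ρ (m := 2) rfl).mul
    ((h.lead_jac_zero i).mul (h.lead_jac_zero j) rfl)
    (m := 2 - wt (nd i) - wt (nd j)) (by omega)).const_mul (-κ ^ 2)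
  have t1 := (h.lead_jac_one i).mul (h.lead_jac_one j) (m := 2 - wt (nd i) - wt (nd j))
    (by omega)
  have t2 : ∀ c, vt c = 2 → Lead (2 - wt (nd i) - wt (nd j))
      (fun s x => jac X s x c (nd i) * jac X s x c (nd j)) fun _ _ _ _ => 0 := by
    intro c hc
    have hj : ∀ i, IsO (2 - wt (nd i)) fun s x => jac X s x c (nd i) := by
      intro i
      refine (h.order_jac_sub hc (nd i)).congr fun s x _ => ?_
      have : nd i ≠ c := by
        rintro rfl
        rw [vt_nd] at hc
        omega
      simp [this]
    exact Lead.of_isO ((hj i).mul (hj j) le_rfl) (by omega)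
  refine ((t0.add t1).add ((t2 2 rfl).add (t2 3 rfl))).congr (fun s x hx => ?_)
    fun s τ y z => ?_
  · rw [h.pullback_eq s hx]
    ring
  · fin_cases i <;> fin_cases j <;> simp [HData.g, HData.c, point] <;> ring

lemma horizonMetric (h : HorizonMap X F A) (hκ : 0 < κ) :
    HorizonMetric κ (fun s => pullback (X s) (rindlerMetric κ)) F A where
  κ_pos := hκ
  smoothF := h.smoothF
  smoothA := h.smoothA
  symm s x a b := by
    rw [pullback_rindler, pullback_rindler]
    ring
  order := h.order_pullback κ
  lead := h.lead_pullback κ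
  dens := by
    refine ((h.lead_ρ.const_mul κ).mul h.lead_det_jac (m := 1) rfl).congr (fun s x hx => ?_)
      fun s τ y z => by ring
    rw [sqrtNegDet, h.det_pullback s hx, neg_neg, Real.sqrt_sq (h.density_pos hκ s hx).le]
  det_ne s x hx := by
    rw [h.det_pullback s hx]
    exact neg_ne_zero.2 (pow_ne_zero 2 (h.density_pos hκ s hx).ne')
  det_inv := by
    have h1 := (h.lead_ρ.const_mul κ).mul h.lead_det_jac (m := 1) rfl
    have h2 := h1.mul h1 (m := 2) rfl
    have h3 : ContDiff ℝ ∞ fun p : ℝ × Pt => lf (fun s τ y z => κ * Real.exp (A s y z * τ) *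
        (Real.exp (F s y z) * Real.exp (A s y z * τ))) p.1 p.2 :=
      (contDiff_const.mul h.contDiff_exp_A).mul (h.contDiff_exp_F.mul h.contDiff_exp_A)
    have h4 := h2.isO.inv
      (fun s x hx => mul_ne_zero (h.density_pos hκ s hx).ne' (h.density_pos hκ s hx).ne')
      (h2.bdd_inv (h3.mul h3).continuous fun s x => by simp only [lf]; positivity)
    refine h4.neg.congr fun s x hx => ?_
    rw [h.det_pullback s hx, inv_neg, sq]

end HorizonMap

end Rindler
end

noncomputable section

namespace Rindler

/-! ## Reparametrized families -/

lemma Smooth.reparam {h : Fam} (hh : Smooth h) {β : ℝ → ℝ} (hβ : ContDiff ℝ ∞ β) :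
    Smooth fun s x => h (β s) x :=
  ContDiffOn.comp (g := fun p : ℝ × Pt => h p.1 p.2) (f := fun p : ℝ × Pt => (β p.1, p.2)) hh
    ((hβ.comp contDiff_fst).prodMk contDiff_snd).contDiffOn fun _ hp => ⟨trivial, hp.2⟩

lemma exists_abs_le_of_continuous {β : ℝ → ℝ} (hβ : Continuous β) (S : ℝ) :
    ∃ B, ∀ s, |s| ≤ S → |β s| ≤ B := by
  obtain ⟨B, hB⟩ := (isCompact_Icc (a := -S) (b := S)).exists_bound_of_continuousOn hβ.continuousOn
  exact ⟨B, fun s hs => hB s (abs_le.1 hs)⟩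

lemma OO.reparam {n : ℕ} {k : ℤ} {h : Fam} (hh : OO n k h) {β : ℝ → ℝ} (hβ : ContDiff ℝ ∞ β) :
    OO n k fun s x => h (β s) x := by
  induction n generalizing k h with
  | zero =>
    refine ⟨hh.smooth.reparam hβ, fun R => ?_⟩
    obtain ⟨B, hB⟩ := exists_abs_le_of_continuous hβ.continuous R
    obtain ⟨C, ε, hC, hε, H⟩ := hh.bdd.exists_nonneg (max R B)
    exact ⟨C, ε, hε, fun s x hx h1 h2 h3 h4 h5 => H (β s) x hx h1
      ((hB s h2).trans (le_max_right _ _)) (h3.trans (le_max_left _ _))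
      (h4.trans (le_max_left _ _)) (h5.trans (le_max_left _ _))⟩
  | succ n ih =>
    refine ⟨hh.smooth.reparam hβ, (ih hh.pred).bdd, fun i => ?_⟩
    cases i with
    | none =>
      have hβ' : ContDiff ℝ ∞ (deriv β) := ((contDiff_infty_iff_deriv).1 hβ).2
      have hc : ContDiff ℝ ∞ fun p : ℝ × Pt => deriv β p.1 := hβ'.comp contDiff_fst
      refine ((IsO.of_contDiff (h := fun s _ => deriv β s) hc n).mul (ih (hh.2.2 none))
        (by ring)).congr fun s x hx => ?_
      refine (D_none_eq_of_hasDerivAt (hh.smooth.reparam hβ) hx ?_).symm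
      rw [mul_comm]
      exact (hh.smooth.hasDerivAt_none (β s) hx).comp s
        ((hβ.differentiable (by simp)).differentiableAt.hasDerivAt)
    | some a =>
      refine (ih (hh.2.2 (some a))).congr fun s x hx => ?_
      rw [D_some hh.smooth a (β s) hx, D_some (hh.smooth.reparam hβ) a s hx]

lemma IsO.reparam {k : ℤ} {h : Fam} (hh : IsO k h) {β : ℝ → ℝ} (hβ : ContDiff ℝ ∞ β) :
    IsO k fun s x => h (β s) x := fun n => (hh n).reparam hβ

lemma IsO.smul_reparam {k : ℤ} {h : Fam} (hh : IsO k h) {c β : ℝ → ℝ} (hc : ContDiff ℝ ∞ c)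
    (hβ : ContDiff ℝ ∞ β) : IsO k fun s x => c s * h (β s) x := by
  have hc' : ContDiff ℝ ∞ fun p : ℝ × Pt => c p.1 := hc.comp contDiff_fst
  exact (IsO.of_contDiff (h := fun s _ => c s) hc').mul (hh.reparam hβ) (by simp)

namespace IsSuperdilatationFamily

lemma zero : IsSuperdilatationFamily (fun _ _ => 0) (fun _ _ _ => 0) fun _ _ _ => 0 where
  smooth₁ := contDiff_const
  smooth₂ := contDiff_const
  comp_τ := ((IsO.zero 2).congr fun s x _ => by simp).familyBigO (k := 2)
  comp_ρ := ((IsO.zero 2).congr fun s x _ => by simp).familyBigO (k := 2)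
  comp_y := (IsO.zero 2).familyBigO (k := 2)
  comp_z := (IsO.zero 2).familyBigO (k := 2)
  support _ := ⟨0, fun _ _ _ _ h => absurd rfl h⟩

variable {ξ η : ℝ → VField} {T₁ T₂ S₁ S₂ : ℝ → ℝ → ℝ → ℝ}

lemma smul_reparam (h : IsSuperdilatationFamily ξ T₁ T₂) {c β : ℝ → ℝ} (hc : ContDiff ℝ ∞ c)
    (hβ : ContDiff ℝ ∞ β) : IsSuperdilatationFamily (fun s x => c s • ξ (β s) x)
      (fun s y z => c s * T₁ (β s) y z) fun s y z => c s * T₂ (β s) y z where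
  smooth₁ := (hc.comp contDiff_fst).mul
    (h.smooth₁.comp ((hβ.comp contDiff_fst).prodMk contDiff_snd))
  smooth₂ := (hc.comp contDiff_fst).mul
    (h.smooth₂.comp ((hβ.comp contDiff_fst).prodMk contDiff_snd))
  comp_τ := ((h.comp_τ.isO.smul_reparam hc hβ).congr fun s x _ => by
    simp only [Pi.smul_apply, smul_eq_mul]; ring).familyBigO
  comp_ρ := ((h.comp_ρ.isO.smul_reparam hc hβ).congr fun s x _ => by
    simp only [Pi.smul_apply, smul_eq_mul]; ring).familyBigO
  comp_y := (h.comp_y.isO.smul_reparam hc hβ).familyBigO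
  comp_z := (h.comp_z.isO.smul_reparam hc hβ).familyBigO
  support S := by
    obtain ⟨B, hB⟩ := exists_abs_le_of_continuous hβ.continuous S
    obtain ⟨R, hR⟩ := h.support B
    refine ⟨R, fun s hs x hx hne => hR (β s) (hB s hs) x hx fun h0 => hne ?_⟩
    simp [h0]

lemma add (h : IsSuperdilatationFamily ξ T₁ T₂) (h' : IsSuperdilatationFamily η S₁ S₂) :
    IsSuperdilatationFamily (fun s x => ξ s x + η s x)
      (fun s y z => T₁ s y z + S₁ s y z) fun s y z => T₂ s y z + S₂ s y z where
  smooth₁ := h.smooth₁.add h'.smooth₁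
  smooth₂ := h.smooth₂.add h'.smooth₂
  comp_τ := ((h.comp_τ.isO.add h'.comp_τ.isO).congr fun s x _ => by
    simp only [Pi.add_apply]; ring).familyBigO
  comp_ρ := ((h.comp_ρ.isO.add h'.comp_ρ.isO).congr fun s x _ => by
    simp only [Pi.add_apply]; ring).familyBigO
  comp_y := (h.comp_y.isO.add h'.comp_y.isO).familyBigO
  comp_z := (h.comp_z.isO.add h'.comp_z.isO).familyBigO
  support S := by
    obtain ⟨R, hR⟩ := h.support S
    obtain ⟨R', hR'⟩ := h'.support S
    refine ⟨max R R', fun s hs x hx hne => ?_⟩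
    simp only [le_max_iff]
    by_cases h0 : ξ s x = 0
    · obtain ⟨h1, h2, h3⟩ := hR' s hs x hx fun h0' => hne (by simp [h0, h0'])
      exact ⟨Or.inr h1, Or.inr h2, Or.inr h3⟩
    · obtain ⟨h1, h2, h3⟩ := hR s hs x hx h0
      exact ⟨Or.inl h1, Or.inl h2, Or.inl h3⟩

end IsSuperdilatationFamily

/-! ## Smooth paths of diffeomorphisms -/

/-- The time `c` map of the flow of `ξ` is the time-one map of the flow of `c ξ`, so intermediate
points of a path are generated too. -/
lemma Generated.flow {ξ : VField} (hξ : ξ ∈ superdilatations) {Φ : ℝ → Pt → Pt}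
    (hΦ : IsEvolution (fun _ => ξ) Φ) (c : ℝ) {χ : Pt → Pt} (hχ : Generated χ) :
    Generated (Φ c ∘ χ) := by
  obtain ⟨T₁, T₂, h⟩ := hξ
  have h1 : (fun x => c • ξ x) ∈ superdilatations :=
    ⟨_, _, IsSuperdilatationFamily.smul_reparam h (c := fun _ => c) (β := _root_.id) contDiff_const
      contDiff_id⟩
  have h2 : IsEvolution (fun _ x => c • ξ x) fun t => Φ (c * t) :=
    { smooth := ContDiffOn.comp (g := fun p : ℝ × Pt => Φ p.1 p.2)
        (f := fun p : ℝ × Pt => (c * p.1, p.2)) hΦ.smooth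
        ((contDiff_const.mul contDiff_fst).prodMk contDiff_snd).contDiffOn
        fun _ hp => ⟨trivial, hp.2⟩
      mapsTo := fun s => hΦ.mapsTo _
      zero := fun x hx => by rw [mul_zero, hΦ.zero x hx]
      hasDerivAt := fun x hx s => (hΦ.hasDerivAt x hx (c * s)).scomp s
        (by simpa using (hasDerivAt_id s).const_mul c) }
  have := Generated.comp h1 h2 hχ
  simpa using this

/-- Concatenation of an evolution with a flow, each run through in a disjoint time interval. -/
lemma IsEvolution.concat {ξ : VField} {η : ℝ → VField} {Φ X : ℝ → Pt → Pt}
    (hΦ : IsEvolution (fun _ => ξ) Φ) (hX : IsEvolution η X) {β γ : ℝ → ℝ}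
    (hβ : ContDiff ℝ ∞ β) (hγ : ContDiff ℝ ∞ γ) (hβ0 : β 0 = 0) {a b : ℝ} (ha : 0 < a)
    (hab : b < a) (hγ0 : ∀ s < a, γ s = 0) (hβ1 : ∀ s, b < s → β s = 1) :
    IsEvolution (fun s x => deriv γ s • ξ x + deriv β s • η (β s) x)
      fun s => Φ (γ s) ∘ X (β s) where
  smooth := ContDiffOn.comp (g := fun p : ℝ × Pt => Φ p.1 p.2)
    (f := fun p : ℝ × Pt => (γ p.1, X (β p.1) p.2)) hΦ.smooth
    ((hγ.comp contDiff_fst).contDiffOn.prodMk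
      (ContDiffOn.comp (g := fun p : ℝ × Pt => X p.1 p.2) (f := fun p : ℝ × Pt => (β p.1, p.2))
        hX.smooth ((hβ.comp contDiff_fst).prodMk contDiff_snd).contDiffOn
        fun _ hp => ⟨trivial, hp.2⟩)) fun p hp => ⟨trivial, hX.mapsTo _ hp.2⟩
  mapsTo s := (hΦ.mapsTo _).comp (hX.mapsTo _)
  zero x hx := by
    rw [hβ0, hγ0 0 ha, Function.comp_apply, hX.zero x hx, hΦ.zero x hx]
  hasDerivAt x hx s := by
    have dβ : HasDerivAt β (deriv β s) s :=
      ((hβ.differentiable (by simp)) s).hasDerivAt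
    have dγ : HasDerivAt γ (deriv γ s) s :=
      ((hγ.differentiable (by simp)) s).hasDerivAt
    -- At each time only one factor moves: before `a` the outer flow is the identity, and from `a`
    -- on the inner factor is frozen at its end. No push-forward of the inner velocity by the outer
    -- map ever appears, so the velocity visibly stays in the algebra.
    rcases lt_or_ge s a with hs | hs
    · have e : γ =ᶠ[𝓝 s] fun _ => 0 := by
        filter_upwards [Iio_mem_nhds hs] with t ht using hγ0 t ht
      have e0 : deriv γ s = 0 := by rw [e.deriv_eq, deriv_const]
      have e1 : (fun t => (Φ (γ t) ∘ X (β t)) x) =ᶠ[𝓝 s] fun t => X (β t) x := by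
        filter_upwards [e] with t ht
        rw [Function.comp_apply, ht, hΦ.zero _ (hX.mapsTo _ hx)]
      refine HasDerivAt.congr_of_eventuallyEq ?_ e1
      rw [e0, zero_smul, zero_add, e1.eq_of_nhds]
      exact (hX.hasDerivAt x hx (β s)).scomp s dβ
    · have e : β =ᶠ[𝓝 s] fun _ => 1 := by
        filter_upwards [Ioi_mem_nhds (hab.trans_le hs)] with t ht using hβ1 t ht
      have e0 : deriv β s = 0 := by rw [e.deriv_eq, deriv_const]
      have e1 : (fun t => (Φ (γ t) ∘ X (β t)) x) =ᶠ[𝓝 s] fun t => Φ (γ t) (X 1 x) := by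
        filter_upwards [e] with t ht
        rw [Function.comp_apply, ht]
      refine HasDerivAt.congr_of_eventuallyEq ?_ e1
      rw [e0, zero_smul, add_zero, e1.eq_of_nhds]
      exact (hΦ.hasDerivAt (X 1 x) (hX.mapsTo _ hx) (γ s)).scomp s dγ

/-- Every generated diffeomorphism is the end point of a smooth path. -/
theorem Generated.exists_isPath {χ : Pt → Pt} (h : Generated χ) :
    ∃ X, IsPath X χ ∧ X 1 = χ := by
  induction h with
  | id =>
    refine ⟨fun _ => _root_.id, ⟨fun _ _ => Generated.id, ⟨_, _, _, IsSuperdilatationFamily.zero,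
      ?_⟩, fun _ _ => rfl⟩, rfl⟩
    exact ⟨contDiff_snd.contDiffOn, fun _ => mapsTo_id _, fun _ _ => rfl,
      fun x _ s => hasDerivAt_const s x⟩
  | @comp ξ Φ χ hξ hΦ hχ ih =>
    obtain ⟨X, ⟨hX1, ⟨η, S₁, S₂, hη, hX⟩, -⟩, hX3⟩ := ih
    obtain ⟨T₁, T₂, hT⟩ := hξ
    -- The inner path runs during `[0, 1/3]` and the outer flow during `[2/3, 1]`; the gap between
    -- them keeps the concatenation smooth for all real parameters.
    let β : ℝ → ℝ := fun s => Real.smoothTransition (3 * s)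
    let γ : ℝ → ℝ := fun s => Real.smoothTransition (3 * s - 2)
    have hβ : ContDiff ℝ ∞ β := Real.smoothTransition.contDiff.comp (by fun_prop)
    have hγ : ContDiff ℝ ∞ γ := Real.smoothTransition.contDiff.comp (by fun_prop)
    have hβ' : ContDiff ℝ ∞ (deriv β) := (contDiff_infty_iff_deriv.1 hβ).2
    have hγ' : ContDiff ℝ ∞ (deriv γ) := (contDiff_infty_iff_deriv.1 hγ).2
    have e1 : (fun s => Φ (γ s) ∘ X (β s)) 1 = Φ 1 ∘ χ := by
      have h1 : β 1 = 1 := Real.smoothTransition.one_of_one_le (by norm_num)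
      have h2 : γ 1 = 1 := Real.smoothTransition.one_of_one_le (by norm_num)
      simp only [h1, h2, hX3]
    refine ⟨fun s => Φ (γ s) ∘ X (β s), ⟨fun s _ => ?_, ⟨_, _, _,
      (IsSuperdilatationFamily.smul_reparam hT hγ' contDiff_id).add (hη.smul_reparam hβ' hβ),
      hΦ.concat hX (a := 2 / 3) (b := 1 / 3) hβ hγ ?_ (by norm_num) (by norm_num)
        (fun s hs => ?_) fun s hs => ?_⟩, fun x _ => congrFun e1 x⟩, e1⟩
    · exact Generated.flow ⟨T₁, T₂, hT⟩ hΦ _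
        (hX1 _ ⟨Real.smoothTransition.nonneg _, Real.smoothTransition.le_one _⟩)
    · exact Real.smoothTransition.zero_of_nonpos (by norm_num)
    · exact Real.smoothTransition.zero_of_nonpos (by linarith)
    · exact Real.smoothTransition.one_of_one_le (by linarith)

end Rindler
end

noncomputable section

namespace Rindler

/-! ## Labels -/

lemma expQuot_mul (a : ℝ) : expQuot a * a = Real.exp a - 1 := by
  unfold expQuot
  split_ifs with h
  · simp [h]
  · field_simp

/-- Removes the case distinction at `a = 0`: smoothness of the quotient follows from that of the
integrand. -/
lemma expQuot_eq_integral (a : ℝ) : expQuot a = ∫ t in (0 : ℝ)..1, Real.exp (t * a) := by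
  unfold expQuot
  split_ifs with h
  · simp [h]
  · have h1 : ∀ t ∈ uIcc (0 : ℝ) 1, HasDerivAt (fun t => Real.exp (t * a) / a)
        (Real.exp (t * a)) t := fun t _ => by
      refine ((((hasDerivAt_id t).mul_const a).exp).div_const a).congr_deriv ?_
      simp [h]
    rw [intervalIntegral.integral_eq_sub_of_hasDerivAt h1
      ((by fun_prop : Continuous fun t => Real.exp (t * a)).intervalIntegrable _ _)]
    simp [sub_div]

lemma contDiff_expQuot : ContDiff ℝ ∞ expQuot := by
  have h : ContDiff ℝ ∞ fun p : ℝ × ℝ => Real.exp (p.1 * p.2) := by fun_prop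
  rw [show expQuot = fun a => ∫ t in (0 : ℝ)..1, Real.exp (t * a) from
    funext expQuot_eq_integral, contDiff_infty]
  exact fun n => contDiff_integral_unit n (fun p : ℝ × ℝ => Real.exp (p.1 * p.2)) h

lemma expQuot_pos (a : ℝ) : 0 < expQuot a := by
  rcases lt_trichotomy a 0 with h | rfl | h
  · have : Real.exp a < 1 := by simpa using h
    have h1 := expQuot_mul a
    nlinarith
  · simp [expQuot]
  · have := Real.one_lt_exp_iff.2 h
    have h1 := expQuot_mul a
    nlinarith

lemma expQuot_neg (a : ℝ) : expQuot (-a) = expQuot a * Real.exp (-a) := by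
  unfold expQuot
  by_cases h : a = 0
  · simp [h]
  · rw [if_neg h, if_neg (neg_ne_zero.2 h), Real.exp_neg]
    have := (Real.exp_pos a).ne'
    field_simp
    ring

variable {X : ℝ → Pt → Pt} {F A : ℝ → ℝ → ℝ → ℝ} {χ : Pt → Pt} {F₁ F₂ : ℝ → ℝ → ℝ}

namespace HorizonMap

/-- The end point of a family of horizon maps has labels. -/
lemma hasLabels (h : HorizonMap X F A) :
    HasLabels (X 1) (F 1) fun y z => A 1 y z / expQuot (F 1 y z) := by
  have hs : ContDiff ℝ ∞ fun p : ℝ × ℝ => ((1 : ℝ), p.1, p.2) := by fun_prop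
  have hF : ContDiff ℝ ∞ fun p : ℝ × ℝ => F 1 p.1 p.2 := h.smoothF.comp hs
  have h1 : ∀ {f : Fam}, IsO 2 f → BigO 2 (f 1) := fun hf =>
    (hf.reparam (β := fun _ => 1) contDiff_const).familyBigO
  refine ⟨hF, (h.smoothA.comp hs).div (contDiff_expQuot.comp hF) fun p => (expQuot_pos _).ne',
    h1 h.comp_τ, ?_, h1 h.comp_y, h1 h.comp_z⟩
  refine (IsO.congr (h1 h.comp_ρ).isO fun s x _ => ?_).familyBigO
  rw [div_mul_cancel₀ _ (expQuot_pos _).ne']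

/-- The labels of the end point are unique. -/
lemma labels_unique (h : HorizonMap X F A) (hX : EqOn (X 1) χ M) (hχ : HasLabels χ F₁ F₂)
    (y z : ℝ) : F 1 y z = F₁ y z ∧ A 1 y z = F₂ y z * expQuot (F₁ y z) := by
  have h1 : ∀ {f : Fam}, IsO 2 f → IsO 2 fun _ => f 1 := fun hf =>
    hf.reparam (β := fun _ => 1) contDiff_const
  have hτ := bdd_mul_rho_eq_zero (k := 0)
    (((h1 h.comp_τ).sub hχ.comp_τ.isO).mono (by norm_num)).bdd 1 1 y z
    (Real.exp (F 1 y z) - Real.exp (F₁ y z)) fun ρ hρ => by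
      rw [hX (show ![1, ρ, y, z] ∈ M from hρ), ← abs_neg]
      simp
  have hρ := bdd_mul_rho_eq_zero (k := 1) (((h1 h.comp_ρ).sub hχ.comp_ρ.isO).mono
    (by norm_num)).bdd 1 1 y z
    (Real.exp (A 1 y z) - Real.exp (F₂ y z * expQuot (F₁ y z))) fun ρ hρ => by
      rw [hX (show ![1, ρ, y, z] ∈ M from hρ), ← abs_neg, zpow_one,
        ← abs_of_pos hρ, ← abs_mul, abs_of_pos hρ]
      congr 1
      simp
      ring
  exact ⟨Real.exp_injective (sub_eq_zero.1 hτ), Real.exp_injective (sub_eq_zero.1 hρ)⟩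

/-- Translates the outcome `A e^{-F}` of the charge computation into the labels, through `(1 -
e^{-F₁}) / F₁ = e^{-F₁} (e^{F₁} - 1) / F₁`. -/
lemma mul_expQuot_neg (h : HorizonMap X F A) (hX : EqOn (X 1) χ M) (hχ : HasLabels χ F₁ F₂)
    (y z : ℝ) : F₂ y z * expQuot (-F₁ y z) = A 1 y z * Real.exp (-F 1 y z) := by
  obtain ⟨h1, h2⟩ := h.labels_unique hX hχ y z
  rw [expQuot_neg, h1, h2]
  ring

end HorizonMap

/-! ## Integrals over the horizon -/

lemma continuous_slice {f : Fam} (hf : Smooth f) (s τ : ℝ) {ρ : ℝ} (hρ : 0 < ρ) :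
    Continuous fun p : ℝ × ℝ => f s ![τ, ρ, p.1, p.2] := by
  have h1 : Continuous fun p : ℝ × ℝ => ((s, ![τ, ρ, p.1, p.2]) : ℝ × Pt) := by
    refine continuous_const.prodMk (continuous_pi fun i => ?_)
    fin_cases i
    · exact continuous_const
    · exact continuous_const
    · exact continuous_fst
    · exact continuous_snd
  exact (ContDiffOn.continuousOn hf).comp_continuous h1 fun p => mem_dom hρ

lemma integrable_of_continuous_of_eq_zero {f : ℝ × ℝ → ℝ} (hf : Continuous f) {R : ℝ}
    (h0 : ∀ y z, R < |y| ∨ R < |z| → f (y, z) = 0) : Integrable f := by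
  refine hf.integrable_of_hasCompactSupport (HasCompactSupport.intro
    (isCompact_closedBall (0 : ℝ × ℝ) R) fun p hp => h0 p.1 p.2 ?_)
  rw [mem_closedBall_zero_iff, Prod.norm_def, sup_le_iff, not_and_or, not_le, not_le] at hp
  exact hp

/-- The limit at the horizon of the integral of a family supported in a bounded region. -/
lemma Lead.tendsto_integral {f : Fam} {φ : ℝ → ℝ → ℝ → ℝ → ℝ} (h : Lead 0 f φ) (s : ℝ) {R : ℝ}
    (h0 : ∀ x ∈ M, R < |x 2| ∨ R < |x 3| → f s x = 0) (τ : ℝ) :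
    (∀ ρ : ℝ, 0 < ρ → Integrable fun p : ℝ × ℝ => f s ![τ, ρ, p.1, p.2]) ∧
    Tendsto (fun ρ => ∫ p : ℝ × ℝ, f s ![τ, ρ, p.1, p.2]) (𝓝[>] 0)
      (𝓝 (∫ p : ℝ × ℝ, φ s τ p.1 p.2)) := by
  have hint : ∀ ρ : ℝ, 0 < ρ → Integrable fun p : ℝ × ℝ => f s ![τ, ρ, p.1, p.2] :=
    fun ρ hρ => integrable_of_continuous_of_eq_zero (continuous_slice h.isO.smooth s τ hρ)
      fun y z hyz => h0 ![τ, ρ, y, z] hρ hyz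
  refine ⟨hint, ?_⟩
  obtain ⟨C, ε, hC, hε, b⟩ := h.isO.bdd.exists_nonneg (max (max |s| |τ|) R)
  -- The dominating function is a constant on the ball that carries the support. Only pointwise
  -- convergence remains, and it is the remainder estimate `O(ρ)` on the ray through a fixed `(τ, y,
  -- z)`.
  refine tendsto_integral_filter_of_dominated_convergence
    ((Metric.closedBall (0 : ℝ × ℝ) R).indicator fun _ => C) ?_ ?_ ?_ ?_
  · filter_upwards [self_mem_nhdsWithin] with ρ hρ using (hint ρ hρ).aestronglyMeasurable
  · filter_upwards [self_mem_nhdsWithin, nhdsWithin_le_nhds (Iio_mem_nhds hε)] with ρ hρ hρ'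
    refine Eventually.of_forall fun p => ?_
    by_cases hp : p ∈ Metric.closedBall (0 : ℝ × ℝ) R
    · rw [indicator_of_mem hp]
      rw [mem_closedBall_zero_iff, Prod.norm_def, sup_le_iff, Real.norm_eq_abs, Real.norm_eq_abs] at hp
      simpa using b s ![τ, ρ, p.1, p.2] hρ hρ' (by simp) (by simp) (by simp [hp.1])
        (by simp [hp.2])
    · rw [indicator_of_notMem hp]
      rw [mem_closedBall_zero_iff, Prod.norm_def, sup_le_iff, not_and_or, not_le, not_le] at hp
      rw [h0 ![τ, ρ, p.1, p.2] hρ hp, norm_zero]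
  · exact (integrable_indicator_iff Metric.isClosed_closedBall.measurableSet).2
      (integrableOn_const (isCompact_closedBall _ _).measure_lt_top.ne)
  · refine Eventually.of_forall fun p => ?_
    obtain ⟨C', ε', hε', b'⟩ := h.sub.bdd (max (max |s| |τ|) (max |p.1| |p.2|))
    rw [tendsto_iff_dist_tendsto_zero]
    have h1 : Tendsto (fun ρ : ℝ => C' * ρ) (𝓝[>] 0) (𝓝 0) := by
      have : Tendsto (fun ρ : ℝ => C' * ρ) (𝓝 0) (𝓝 (C' * 0)) := tendsto_id.const_mul C'
      rw [mul_zero] at this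
      exact this.mono_left nhdsWithin_le_nhds
    refine squeeze_zero' (Eventually.of_forall fun _ => dist_nonneg) ?_ h1
    filter_upwards [self_mem_nhdsWithin, nhdsWithin_le_nhds (Iio_mem_nhds hε')] with ρ hρ hρ'
    simpa [lf, Real.dist_eq] using b' s ![τ, ρ, p.1, p.2] hρ hρ' (by simp) (by simp) (by simp)
      (by simp)

variable {κ : ℝ} {g : ℝ → Tensor2} {ξ η ζ : VField}

/-- The integrability condition. -/
lemma HorizonMetric.integrableAtHorizon (H : HorizonMetric κ g F A) (G s : ℝ)
    (hξ : ξ ∈ superdilatations) (hη : η ∈ superdilatations) (hζ : ζ ∈ superdilatations) :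
    IntegrableAtHorizon G (g s) ξ η ζ := by
  obtain ⟨T₁, T₂, hξ⟩ := hξ
  obtain ⟨_, _, hη⟩ := hη
  obtain ⟨_, _, hζ⟩ := hζ
  have hI := H.order_integrabilityIntegrand G (IsSuperdilatationFamily.horizonVec hξ)
    (IsSuperdilatationFamily.horizonVec hη) (IsSuperdilatationFamily.horizonVec hζ)
  obtain ⟨R, hR, hξ0, -⟩ := IsSuperdilatationFamily.coeff_support hξ 0
  have h0 : ∀ x ∈ M, R < |x 2| ∨ R < |x 3| →
      integrabilityIntegrand G (g s) ξ η ζ x = 0 := fun x hx h => by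
    simp [integrabilityIntegrand, corner, antisymm, hξ0 0 (by simp) x hx h]
  refine ⟨fun R' => ?_, fun τ => ?_⟩
  · obtain ⟨C, ε, hC, hε, b⟩ := hI.bdd.exists_nonneg (max (max |s| R') R)
    refine ⟨C, ε, hε, fun x hx h1 h2 => ?_⟩
    by_cases h : R < |x 2| ∨ R < |x 3|
    · rw [h0 x hx h, abs_zero]
      exact mul_nonneg hC (show 0 < x 1 from hx).le
    · rw [not_or, not_lt, not_lt] at h
      simpa using b s x hx h1 (by simp) (by simp [h2]) (by simp [h.1]) (by simp [h.2])
  · simpa using (Lead.of_isO hI (k := 0) (by norm_num)).tendsto_integral s h0 τ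

end Rindler
end

noncomputable section

namespace Rindler

/-! ## Charges -/

lemma pd_eq_zero_of_eventuallyEq {f : Pt → ℝ} {x : Pt} (h : f =ᶠ[𝓝 x] fun _ => 0) (a : Fin 4) :
    pd a f x = 0 := by
  simp [pd, h.fderiv_eq]

/-- The integrand depends on `V` through its value and first derivatives at the point, so its
support is contained in that of `V` even where the metric varies. -/
lemma chargeIntegrand_eq_zero (G : ℝ) (g : ℝ → Tensor2) {V : VField} {x : Pt}
    (h : V =ᶠ[𝓝 x] fun _ => 0) (s : ℝ) : chargeIntegrand G g V s x = 0 := by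
  have h0 : V x = 0 := h.eq_of_nhds
  have h1 : ∀ a b, pd a (fun y => V y b) x = 0 := fun a b =>
    pd_eq_zero_of_eventuallyEq (h.mono fun y hy => by simp [hy]) a
  simp [chargeIntegrand, noetherQ, covDerivVecUp, covDerivVec, antisymm, corner, h0, h1]

/-- Integration of a total derivative in the parameter over a strip. -/
lemma intervalIntegral_integral_deriv {ψ P : ℝ → ℝ × ℝ → ℝ}
    (hψ : Continuous fun q : ℝ × ℝ × ℝ => ψ q.1 q.2)
    (hP : ∀ p s, HasDerivAt (fun s => P s p) (ψ s p) s) {R : ℝ}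
    (h0 : ∀ s y z, R < |y| ∨ R < |z| → ψ s (y, z) = 0) :
    IntervalIntegrable (fun s => ∫ p, ψ s p) volume 0 1 ∧
      ∫ s in (0 : ℝ)..1, ∫ p, ψ s p = ∫ p, (P 1 p - P 0 p) := by
  -- Integrability on the strip reduces to a compact product, where continuity suffices; it permits
  -- the `s`-integration to be done first, at fixed `(y, z)`.
  have hint : Integrable (Function.uncurry ψ) ((volume.restrict (Ioc (0 : ℝ) 1)).prod volume) := by
    have h1 : IntegrableOn (Function.uncurry ψ) (Icc (0 : ℝ) 1 ×ˢ Metric.closedBall (0 : ℝ × ℝ) R)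
        (volume.prod volume) :=
      ContinuousOn.integrableOn_compact (isCompact_Icc.prod (isCompact_closedBall _ _))
        hψ.continuousOn
    have h2 : IntegrableOn (Function.uncurry ψ) (Ioc (0 : ℝ) 1 ×ˢ (univ : Set (ℝ × ℝ)))
        (volume.prod volume) := by
      refine h1.of_forall_sdiff_eq_zero (measurableSet_Ioc.prod MeasurableSet.univ) ?_
      rintro ⟨s, p⟩ ⟨⟨hs, -⟩, hp⟩
      refine h0 s p.1 p.2 ?_
      have hp' : p ∉ Metric.closedBall (0 : ℝ × ℝ) R := fun hp' =>
        hp ⟨Ioc_subset_Icc_self hs, hp'⟩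
      rwa [mem_closedBall_zero_iff, Prod.norm_def, sup_le_iff, not_and_or, not_le, not_le] at hp'
    rwa [IntegrableOn, ← Measure.prod_restrict, Measure.restrict_univ] at h2
  constructor
  · rw [intervalIntegrable_iff_integrableOn_Ioc_of_le zero_le_one]
    exact hint.integral_prod_left
  · rw [intervalIntegral.integral_of_le zero_le_one, integral_integral_swap hint]
    refine integral_congr_ae (Eventually.of_forall fun p => ?_)
    have hc : Continuous fun s => ψ s p := hψ.comp (Continuous.prodMk_left p)
    change ∫ s in Ioc (0 : ℝ) 1, ψ s p = _
    rw [← intervalIntegral.integral_of_le zero_le_one,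
      intervalIntegral.integral_eq_sub_of_hasDerivAt (fun s _ => hP p s)
        (hc.intervalIntegrable _ _)]

variable {ξ : ℝ → VField} {X : ℝ → Pt → Pt} {T₁ T₂ : ℝ → ℝ → ℝ → ℝ} {κ : ℝ} {V : VField}
  {S₁ S₂ : ℝ → ℝ → ℝ}

/-- The charges along a path of diffeomorphisms. -/
theorem IsEvolution.isCharge (hξ : IsSuperdilatationFamily ξ T₁ T₂) (hX : IsEvolution ξ X)
    (hκ : 0 < κ) (G τ : ℝ) (hV : IsSuperdilatation V S₁ S₂) :
    Integrable (fun p : ℝ × ℝ => S₁ p.1 p.2 * (primA T₁ T₂ 1 p.1 p.2 *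
        Real.exp (-prim T₁ 1 p.1 p.2)) + S₂ p.1 p.2 * (Real.exp (-prim T₁ 1 p.1 p.2) - 1)) ∧
      IsCharge G (fun s => pullback (X s) (rindlerMetric κ)) V τ (1 / (16 * Real.pi * G * κ) *
        ∫ p : ℝ × ℝ, (S₁ p.1 p.2 * (primA T₁ T₂ 1 p.1 p.2 * Real.exp (-prim T₁ 1 p.1 p.2)) +
          S₂ p.1 p.2 * (Real.exp (-prim T₁ 1 p.1 p.2) - 1))) := by
  have h := hX.horizonMap hξ
  have hT := contDiff_velA hξ
  obtain ⟨R, hR, hV0, hS0⟩ := IsSuperdilatationFamily.coeff_support hV 0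
  replace hS0 := hS0 0 (by simp)
  have hS : ∀ y z, R < |y| ∨ R < |z| → S₁ y z = 0 ∧ S₂ y z = 0 := hS0
  have hL := (h.horizonMetric hκ).lead_chargeIntegrand G
    (IsSuperdilatationFamily.horizonVec hV) (hasDerivAt_prim hξ.smooth₁) (hasDerivAt_prim hT)
  have hopen : IsOpen {x : Pt | x ∈ M ∧ (R < |x 2| ∨ R < |x 3|)} :=
    isOpen_M.inter ((isOpen_lt continuous_const (continuous_apply 2).abs).union
      (isOpen_lt continuous_const (continuous_apply 3).abs))
  have h0 : ∀ s, ∀ x ∈ M, R < |x 2| ∨ R < |x 3| →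
      chargeIntegrand G (fun s => pullback (X s) (rindlerMetric κ)) V s x = 0 :=
    fun s x hx hx' => chargeIntegrand_eq_zero G _ (by
      filter_upwards [hopen.mem_nhds ⟨hx, hx'⟩] with y hy using hV0 0 (by simp) y hy.1 hy.2) s
  set c := 1 / (16 * Real.pi * G * κ)
  have cS₁ : Continuous fun p : ℝ × ℝ => S₁ p.1 p.2 :=
    hV.smooth₁.continuous.comp (Continuous.prodMk_right (0 : ℝ))
  have cS₂ : Continuous fun p : ℝ × ℝ => S₂ p.1 p.2 :=
    hV.smooth₂.continuous.comp (Continuous.prodMk_right (0 : ℝ))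
  have cF : Continuous fun q : ℝ × ℝ × ℝ => prim T₁ q.1 q.2.1 q.2.2 := h.smoothF.continuous
  have cA : Continuous fun q : ℝ × ℝ × ℝ => primA T₁ T₂ q.1 q.2.1 q.2.2 := h.smoothA.continuous
  have cF' : Continuous fun q : ℝ × ℝ × ℝ => T₁ q.1 q.2.1 q.2.2 := hξ.smooth₁.continuous
  have cA' : Continuous fun q : ℝ × ℝ × ℝ => velA T₁ T₂ q.1 q.2.1 q.2.2 := hT.continuous
  have cF1 : Continuous fun p : ℝ × ℝ => prim T₁ 1 p.1 p.2 :=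
    cF.comp (Continuous.prodMk_right (1 : ℝ))
  have cA1 : Continuous fun p : ℝ × ℝ => primA T₁ T₂ 1 p.1 p.2 :=
    cA.comp (Continuous.prodMk_right (1 : ℝ))
  refine ⟨integrable_of_continuous_of_eq_zero (R := R) ?_ fun y z hyz => ?_, ?_⟩
  · exact (cS₁.mul (cA1.mul cF1.neg.rexp)).add (cS₂.mul (cF1.neg.rexp.sub continuous_const))
  · simp [hS y z hyz]
  · let ψ : ℝ → ℝ × ℝ → ℝ := fun s p => c * ((S₁ p.1 p.2 * (velA T₁ T₂ s p.1 p.2 -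
      primA T₁ T₂ s p.1 p.2 * T₁ s p.1 p.2) - S₂ p.1 p.2 * T₁ s p.1 p.2) *
        Real.exp (-prim T₁ s p.1 p.2))
    -- A primitive in `s` of the limiting charge density. At `s = 0`, where `F = A = 0`, it equals
    -- `c S₂`; this accounts for the `-1` in the second charge, and its dependence on the end points
    -- only is the path independence.
    let P : ℝ → ℝ × ℝ → ℝ := fun s p => c * ((S₁ p.1 p.2 * primA T₁ T₂ s p.1 p.2 + S₂ p.1 p.2) *
      Real.exp (-prim T₁ s p.1 p.2))
    have hψ : Continuous fun q : ℝ × ℝ × ℝ => ψ q.1 q.2 :=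
      continuous_const.mul (((((cS₁.comp continuous_snd).mul (cA'.sub (cA.mul cF'))).sub
        ((cS₂.comp continuous_snd).mul cF'))).mul cF.neg.rexp)
    have hP : ∀ p s, HasDerivAt (fun s => P s p) (ψ s p) s := by
      intro p s
      have h1 : HasDerivAt (fun s => Real.exp (-prim T₁ s p.1 p.2))
          (Real.exp (-prim T₁ s p.1 p.2) * -T₁ s p.1 p.2) s :=
        (hasDerivAt_prim hξ.smooth₁ s p.1 p.2).fun_neg.exp
      have h2 : HasDerivAt (fun s => primA T₁ T₂ s p.1 p.2) (velA T₁ T₂ s p.1 p.2) s :=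
        hasDerivAt_prim hT s p.1 p.2
      refine ((((h2.const_mul (S₁ p.1 p.2)).add_const (S₂ p.1 p.2)).mul h1).const_mul
        c).congr_deriv ?_
      simp only [ψ]
      ring
    obtain ⟨i1, i2⟩ := intervalIntegral_integral_deriv hψ hP (R := R) fun s y z hyz => by
      simp [ψ, hS y z hyz]
    refine ⟨fun s => ∫ p, ψ s p, fun s _ => hL.tendsto_integral s (h0 s) τ, i1, i2.trans ?_⟩
    rw [← integral_const_mul]
    refine integral_congr_ae (Eventually.of_forall fun p => ?_)
    simp only [P, primA, prim_zero]
    rw [neg_zero, Real.exp_zero]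
    ring

end Rindler
end

/-! ### The theorem -/

theorem mainTheorem1 (G κ : ℝ) (hG : 0 < G) (hκ : 0 < κ) (χ : Pt → Pt) (hχ : Generated χ) :
    (∃ F₁ F₂ : ℝ → ℝ → ℝ, HasLabels χ F₁ F₂) ∧
    (∀ ξ ∈ superdilatations, ∀ η ∈ superdilatations, ∀ ζ ∈ superdilatations,
      IntegrableAtHorizon G (pullback χ (rindlerMetric κ)) ξ η ζ) ∧
    (∃ X : ℝ → Pt → Pt, IsPath X χ) ∧
    (∀ F₁ F₂ : ℝ → ℝ → ℝ, HasLabels χ F₁ F₂ →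
      ∀ X : ℝ → Pt → Pt, IsPath X χ → ∀ τ : ℝ,
        (∀ (V₁ : VField) (T₁ : ℝ → ℝ → ℝ), IsSuperdilatation V₁ T₁ (fun _ _ => 0) →
          Integrable (fun p : ℝ × ℝ =>
            T₁ p.1 p.2 * (F₂ p.1 p.2 * expQuot (-F₁ p.1 p.2))) ∧
          IsCharge G (fun s => pullback (X s) (rindlerMetric κ)) V₁ τ
            (1 / (16 * Real.pi * G * κ) *
              ∫ p : ℝ × ℝ, T₁ p.1 p.2 * (F₂ p.1 p.2 * expQuot (-F₁ p.1 p.2)))) ∧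
        (∀ (V₂ : VField) (T₂ : ℝ → ℝ → ℝ), IsSuperdilatation V₂ (fun _ _ => 0) T₂ →
          Integrable (fun p : ℝ × ℝ => T₂ p.1 p.2 * (Real.exp (-F₁ p.1 p.2) - 1)) ∧
          IsCharge G (fun s => pullback (X s) (rindlerMetric κ)) V₂ τ
            (1 / (16 * Real.pi * G * κ) *
              ∫ p : ℝ × ℝ, T₂ p.1 p.2 * (Real.exp (-F₁ p.1 p.2) - 1)))) := by
  obtain ⟨X, hX, hX1⟩ := hχ.exists_isPath
  refine ⟨?_, ?_, ⟨X, hX⟩, ?_⟩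
  · obtain ⟨-, ⟨ξ, T₁, T₂, hξ, hev⟩, -⟩ := hX
    rw [← hX1]
    exact ⟨_, _, (hev.horizonMap hξ).hasLabels⟩
  · obtain ⟨-, ⟨ξ, T₁, T₂, hξ, hev⟩, -⟩ := hX
    intro ζ₁ h₁ ζ₂ h₂ ζ₃ h₃
    rw [← hX1]
    exact ((hev.horizonMap hξ).horizonMetric hκ).integrableAtHorizon G 1 h₁ h₂ h₃
  · rintro F₁ F₂ hF Y ⟨-, ⟨ξ, T₁, T₂, hξ, hev⟩, hY⟩ τ
    -- The given labels need not be those constructed from the path `Y`; uniqueness identifies them,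
    -- so the charges depend on the end point alone.
    have hm := hev.horizonMap hξ
    have e₁ : ∀ p : ℝ × ℝ, prim T₁ 1 p.1 p.2 = F₁ p.1 p.2 := fun p =>
      (hm.labels_unique hY hF p.1 p.2).1
    have e₂ : ∀ p : ℝ × ℝ, F₂ p.1 p.2 * expQuot (-F₁ p.1 p.2) =
        primA T₁ T₂ 1 p.1 p.2 * Real.exp (-F₁ p.1 p.2) := fun p => by
      rw [hm.mul_expQuot_neg hY hF, e₁]
    simp only [e₂]
    constructor
    · intro V S hV
      simpa [e₁] using hev.isCharge hξ hκ G τ hV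
    · intro V S hV
      simpa [e₁] using hev.isCharge hξ hκ G τ hV
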